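/- Let $M$ be an $n$-dimensional complex manifold (Hausdorff, second countable), $\overline M$ its conjugate manifold, and let $A^2(M)$ be the Hilbert space of holomorphic $n$-forms $f$ on $M$ with $\left|\int_M f\wedge\overline f\right|<\infty$. For a complete orthonormal basis $(\phi_m)$ of $A^2(M)$ put $$K(z,\overline w)=\sum_m \phi_m(z)\wedge\overline{\phi_m(w)}=K^*(z,\overline w)\,dz_1\wedge\cdots\wedge dz_n\wedge d\overline{w_1}\wedge\cdots\wedge d\overline{w_n}$$ in local holomorphic coordinates $z$ and $w$, and $$G(z,\overline w)=\bigl(g_{j\overline k}(z,\overline w)\bigr),\qquad g_{j\overline k}(z,\overline w)=\frac{\partial^2\log K^*(z,\overline w)}{\partial z_j\,\partial\overline{w_k}}\quad\text{where } K(z,\overline w)\neq 0 .$$ Suppose that $M$ possesses the Bergman metric, i.e. $K(z,\overline z)\ne 0$ and $\left(\frac{\partial^2\log K^*(z,\overline z)}{\partial z_j\partial\overline{z_k}}\right)$ is positive definite at every point of $M$. Fix $p\in M$ and let $$Z_0^p=\{z\in M: K(z,\overline p)=0\},\quad Z_1^p=\{z\in M\setminus Z_0^p:\det G(z,\overline p)=0\},\quad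 M^p=M\setminus(Z_0^p\cup Z_1^p).$$ Then $M^p$ is open in $M$, and there is a holomorphic affine connection $\nabla^p$ on the holomorphic tangent bundle $T'M^p$ whose matrix of connection $1$-forms in every holomorphic chart is $\partial G\cdot G^{-1}$ with $G=G(z,\overline p)$; that is, $$\nabla^p_{\partial/\partial z_l}\frac{\partial}{\partial z_k}=\sum_j\Gamma^j_{kl}(z,\overline p)\frac{\partial}{\partial z_j},\qquad \Gamma^j_{kl}(z,\overline p)=\sum_m\frac{\partial g_{k\overline m}(z,\overline p)}{\partial z_l}\,g^{\overline m j}(z,\overline p),$$ where $(g^{\overline m j})=G^{-1}$. It satisfies: 1. $\nabla^p$ is locally flat: its torsion and its curvature vanish on $M^p$. 2. The affine geodesic equations of $\nabla^p$ are $$\frac{d^2z_j}{dt^2}+\sum_{k,l}\Gamma^j_{kl}(z(t),\overline p)\frac{dz_k}{dt}\frac{dz_l}{dt}=0,\qquad j=1,\dots,n;$$ that is, a $C^2$ curve $\gamma$ of a real variable $t$ in $M^p$ satisfies $\nabla^p_{\gamma'}\gamma'=0$ if and only if it satisfies this system in all holomorphic charts. (In particular this holds for the geodesics with $\gamma(0)=p$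 and prescribed initial velocity.) 3. If $f:M\to\widetilde M$ is a biholomorphism onto a complex manifold $\widetilde M$ and $q=f(p)$, then $f(M^p)=\widetilde M^q$, and $$f_*(\nabla^p_XY)=\nabla^q_{f_*X}(f_*Y)$$ for all holomorphic vector fields $X,Y$ on open subsets of $M^p$, where $\nabla^q$ is any holomorphic affine connection on $T'\widetilde M^q$ with connection form $\partial\widetilde G\cdot\widetilde G^{-1}$, $\widetilde G=\widetilde G(\cdot,\overline q)$. -/

import Mathlib

open scoped Manifold ContDiff ComplexOrder ComplexConjugate ENNReal

noncomputable section

namespace BergmanGeometry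

/-! ### Wirtinger derivatives on `ℂⁿ` -/

/-- `∂F/∂z_j = ½ (∂F/∂x_j - i ∂F/∂y_j)`. -/
def wirtinger {n : ℕ} (j : Fin n) (F : (Fin n → ℂ) → ℂ) (z : Fin n → ℂ) : ℂ :=
  (1 / 2) * (fderiv ℝ F z (Pi.single j 1) - Complex.I * fderiv ℝ F z (Pi.single j Complex.I))

/-- `∂F/∂z̄_k = ½ (∂F/∂x_k + i ∂F/∂y_k)`. -/
def wirtingerBar {n : ℕ} (k : Fin n) (F : (Fin n → ℂ) → ℂ) (z : Fin n → ℂ) : ℂ :=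
  (1 / 2) * (fderiv ℝ F z (Pi.single k 1) + Complex.I * fderiv ℝ F z (Pi.single k Complex.I))

/-! ### Vector fields and `n`-forms on an `n`-dimensional complex manifold

The manifold is modelled on `ℂⁿ = (Fin n → ℂ)` over the field `ℂ`, so that `TangentSpace` is the
holomorphic tangent space `T'M`. "Holomorphic charts" are the members of the maximal atlas. -/

/-- Sections of the holomorphic tangent bundle (no regularity imposed). -/
abbrev VField (n : ℕ) (M : Type*) [TopologicalSpace M] [ChartedSpace (Fin n → ℂ) M] : Type _ :=
  ∀ x : M, TangentSpace 𝓘(ℂ, Fin n → ℂ) x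

/-- Sections of the bundle of complex-multilinear alternating `n`-forms on `T'M`, that is, of the
canonical bundle (no regularity imposed). -/
abbrev NForm (n : ℕ) (M : Type*) [TopologicalSpace M] [ChartedSpace (Fin n → ℂ) M] : Type _ :=
  ∀ x : M, (TangentSpace 𝓘(ℂ, Fin n → ℂ) x) [⋀^Fin n]→L[ℂ] ℂ

section Definitions

variable {n : ℕ} {M : Type*} [TopologicalSpace M] [ChartedSpace (Fin n → ℂ) M]

/-- The holomorphic charts of `M`. -/
def holCharts (n : ℕ) (M : Type*) [TopologicalSpace M] [ChartedSpace (Fin n → ℂ) M] :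
    Set (OpenPartialHomeomorph M (Fin n → ℂ)) :=
  IsManifold.maximalAtlas 𝓘(ℂ, Fin n → ℂ) ω M

/-- The coordinate vector field `∂/∂z_i` of the chart `φ` (meaningful on `φ.source`). -/
def coordField (φ : OpenPartialHomeomorph M (Fin n → ℂ)) (i : Fin n) : VField n M :=
  VectorField.mpullback 𝓘(ℂ, Fin n → ℂ) 𝓘(ℂ, Fin n → ℂ) φ (fun _ => Pi.single i (1 : ℂ))

/-- The coefficient `f*` of the form `f = f* dz_1 ∧ ⋯ ∧ dz_n` in the chart `φ`, as a function
on `φ.target`. -/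
def formCoeff (f : NForm n M) (φ : OpenPartialHomeomorph M (Fin n → ℂ)) (z : Fin n → ℂ) : ℂ :=
  f (φ.symm z) (fun i => coordField φ i (φ.symm z))

/-- `f` is a holomorphic `n`-form on `M`. -/
def IsHolomorphicForm (f : NForm n M) : Prop :=
  ∀ φ ∈ holCharts n M, DifferentiableOn ℂ (formCoeff f φ) φ.target

/-! ### The space `A²(M)` -/

/-- `‖f‖² = |∫_M f ∧ f̄|`, with values in `[0, ∞]`. In a chart, `f ∧ f̄` is up to a unimodular
constant `2ⁿ |f*|²` times Lebesgue measure; the integral of this nonnegative density over `M` is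
the supremum of its integrals over finite families of pairwise disjoint measurable pieces of `M`,
each of which lies in a chart. -/
def normSq (f : NForm n M) : ℝ≥0∞ :=
  ⨆ (N : ℕ) (φ : Fin N → OpenPartialHomeomorph M (Fin n → ℂ)) (A : Fin N → Set (Fin n → ℂ))
    (_ : ∀ i, φ i ∈ holCharts n M ∧ MeasurableSet (A i) ∧ A i ⊆ (φ i).target)
    (_ : Pairwise fun i j => Disjoint ((φ i).symm '' A i) ((φ j).symm '' A j)),
    ∑ i, 2 ^ n * ∫⁻ z in A i, ‖formCoeff f (φ i) z‖ₑ ^ 2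

/-- The space `A²(M)` of square-integrable holomorphic `n`-forms. -/
def A2 (n : ℕ) (M : Type*) [TopologicalSpace M] [ChartedSpace (Fin n → ℂ) M] :
    Set (NForm n M) :=
  {f | IsHolomorphicForm f ∧ normSq f < ⊤}

/-- The inner product `⟨f, g⟩ = c ∫_M f ∧ ḡ` of `A²(M)` (`c = i^{n²}`), obtained by integrating
the pointwise identity `f ∧ ḡ = ¼ ∑_{k<4} i^k (f + i^k g) ∧ conj (f + i^k g)`. -/
def innerA2 (f g : NForm n M) : ℂ :=
  (1 / 4) * ∑ k ∈ Finset.range 4,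
    Complex.I ^ k * ((normSq (f + (Complex.I ^ k : ℂ) • g)).toReal : ℂ)

/-- `S` is a complete orthonormal basis of `A²(M)`. -/
structure IsOrthonormalBasis (S : Set (NForm n M)) : Prop where
  subset : S ⊆ A2 n M
  norm_one : ∀ f ∈ S, innerA2 f f = 1
  orthogonal : ∀ f ∈ S, ∀ g ∈ S, f ≠ g → innerA2 f g = 0
  complete : ∀ f ∈ A2 n M, (∀ g ∈ S, innerA2 f g = 0) → f = 0

/-! ### The Bergman kernel form and its polarized metric tensor -/

open Classical in
/-- The coefficient `K*(z, w̄)` of the Bergman kernel form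
`K(z, w̄) = ∑ s(z) ∧ conj (s(w)) = K*(z, w̄) dz_1 ∧ ⋯ ∧ dz_n ∧ dw̄_1 ∧ ⋯ ∧ dw̄_n`
with respect to a chart `φ` (coordinates `z`) and a chart `ψ` (coordinates `w`). The sum runs over
a complete orthonormal basis of `A²(M)`; it does not depend on which. (A basis always exists, so
the value `0` of the second branch is never taken.) -/
def kernel (φ ψ : OpenPartialHomeomorph M (Fin n → ℂ)) (z w : Fin n → ℂ) : ℂ :=
  if h : ∃ S : Set (NForm n M), IsOrthonormalBasis S then
    ∑' s : h.choose, formCoeff (s : NForm n M) φ z * conj (formCoeff (s : NForm n M) ψ w)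
  else 0

/-- The matrix `(∂² log K*(z, z̄) / ∂z_j ∂z̄_k)` in the chart `φ`. -/
def metricMatrix (φ : OpenPartialHomeomorph M (Fin n → ℂ)) (z : Fin n → ℂ) :
    Matrix (Fin n) (Fin n) ℂ :=
  Matrix.of fun j k =>
    wirtinger j (wirtingerBar k fun u => Complex.log (kernel φ φ u u)) z

/-- `M` possesses the Bergman metric: the Bergman kernel form vanishes nowhere on the diagonal and
the matrix of the Bergman metric is positive definite at every point. -/
def HasBergmanMetric (n : ℕ) (M : Type*) [TopologicalSpace M] [ChartedSpace (Fin n → ℂ) M] :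
    Prop :=
  ∀ φ ∈ holCharts n M, ∀ z ∈ φ.target, kernel φ φ z z ≠ 0 ∧ (metricMatrix φ z).PosDef

/-- The matrix `G(z, w̄)` with entries `g_{j k̄}(z, w̄) = ∂² log K*(z, w̄) / ∂z_j ∂w̄_k`, where
`∂ log K* / ∂w̄_k` is the logarithmic derivative `(∂K* / ∂w̄_k) / K*`, the same for every local
branch of `log K*`. -/
def polarizedMetric (φ ψ : OpenPartialHomeomorph M (Fin n → ℂ)) (z w : Fin n → ℂ) :
    Matrix (Fin n) (Fin n) ℂ :=
  Matrix.of fun j k =>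
    wirtinger j (fun u => wirtingerBar k (fun v => kernel φ ψ u v) w / kernel φ ψ u w) z

/-- `Z₀ᵖ = {x ∈ M : K(x, p̄) = 0}`. -/
def Z0 (n : ℕ) {M : Type*} [TopologicalSpace M] [ChartedSpace (Fin n → ℂ) M] (p : M) : Set M :=
  {x | kernel (chartAt (Fin n → ℂ) x) (chartAt (Fin n → ℂ) p)
    (chartAt (Fin n → ℂ) x x) (chartAt (Fin n → ℂ) p p) = 0}

/-- `Z₁ᵖ = {x ∈ M - Z₀ᵖ : det G(x, p̄) = 0}`. -/
def Z1 (n : ℕ) {M : Type*} [TopologicalSpace M] [ChartedSpace (Fin n → ℂ) M] (p : M) : Set M :=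
  {x | x ∉ Z0 n p ∧ (polarizedMetric (chartAt (Fin n → ℂ) x) (chartAt (Fin n → ℂ) p)
    (chartAt (Fin n → ℂ) x x) (chartAt (Fin n → ℂ) p p)).det = 0}

/-- `Mᵖ = M - (Z₀ᵖ ∪ Z₁ᵖ)`. -/
def regularSet (n : ℕ) {M : Type*} [TopologicalSpace M] [ChartedSpace (Fin n → ℂ) M] (p : M) :
    Set M :=
  (Z0 n p ∪ Z1 n p)ᶜ

/-- The coefficient `Γ^j_{kl}(z, p̄) = ∑_m ∂g_{k m̄}(z, p̄)/∂z_l · g^{m̄ j}(z, p̄)` in the chart `φ`,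
that is, the `dz_l`-coefficient of the entry in row `k` and column `j` of `∂G · G⁻¹`. Here `G` is
formed with a chart `ψ` around `p`. -/
def christoffel (φ ψ : OpenPartialHomeomorph M (Fin n → ℂ)) (p : M) (j k l : Fin n)
    (z : Fin n → ℂ) : ℂ :=
  ∑ m, wirtinger l (fun u => polarizedMetric φ ψ u (ψ p) k m) z *
    ((polarizedMetric φ ψ z (ψ p))⁻¹) m j

/-! ### Holomorphic affine connections

A connection is an operator `D` on vector fields; `D Y x (X x)` is `(∇_X Y)(x)`. -/

variable [IsManifold 𝓘(ℂ, Fin n → ℂ) ω M]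

/-- `X` is a holomorphic vector field on the (open) set `U`. -/
def IsHolomorphicField (X : VField n M) (U : Set M) : Prop :=
  MDifferentiableOn 𝓘(ℂ, Fin n → ℂ) (𝓘(ℂ, Fin n → ℂ).tangent)
    (fun x => (⟨x, X x⟩ : TangentBundle 𝓘(ℂ, Fin n → ℂ) M)) U

/-- Operators sending a vector field `Y` to the section `∇Y` of `End T'M`. -/
abbrev ConnOp (n : ℕ) (M : Type*) [TopologicalSpace M] [ChartedSpace (Fin n → ℂ) M] : Type _ :=
  VField n M →
    (∀ x : M, TangentSpace 𝓘(ℂ, Fin n → ℂ) x →L[ℂ] TangentSpace 𝓘(ℂ, Fin n → ℂ) x)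

/-- `D` is a holomorphic affine connection on the holomorphic tangent bundle of the open set `W`:
a covariant derivative for which `∇_X Y` is holomorphic whenever `X` and `Y` are. -/
structure IsHolomorphicConnectionOn (D : ConnOp n M) (W : Set M) : Prop where
  covariant : IsCovariantDerivativeOn (Fin n → ℂ) D W
  holomorphic : ∀ U : Set M, IsOpen U → U ⊆ W → ∀ X Y : VField n M,
    IsHolomorphicField X U → IsHolomorphicField Y U →
      IsHolomorphicField (fun x => D Y x (X x)) U

/-- The torsion `T(X, Y) = ∇_X Y - ∇_Y X - [X, Y]`. -/
def torsion (D : ConnOp n M) (X Y : VField n M) : VField n M := fun x =>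
  D Y x (X x) - D X x (Y x) - VectorField.mlieBracket 𝓘(ℂ, Fin n → ℂ) X Y x

/-- The curvature `R(X, Y) Z = ∇_X ∇_Y Z - ∇_Y ∇_X Z - ∇_{[X, Y]} Z`. -/
def curvature (D : ConnOp n M) (X Y Z : VField n M) : VField n M := fun x =>
  D (fun y => D Z y (Y y)) x (X x) - D (fun y => D Z y (X y)) x (Y x) -
    D Z x (VectorField.mlieBracket 𝓘(ℂ, Fin n → ℂ) X Y x)

/-- `D` is locally flat on `W`: its torsion and its curvature are zero there. -/
def IsLocallyFlatOn (D : ConnOp n M) (W : Set M) : Prop :=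
  ∀ U : Set M, IsOpen U → U ⊆ W → ∀ X Y Z : VField n M,
    IsHolomorphicField X U → IsHolomorphicField Y U → IsHolomorphicField Z U →
      ∀ x ∈ U, torsion D X Y x = 0 ∧ curvature D X Y Z x = 0

/-! ### Geodesics -/

/-- The curve `γ` is of class `C²` (as a curve of a real variable) on the open set `J`. -/
def IsC2Curve (n : ℕ) {M : Type*} [TopologicalSpace M] [ChartedSpace (Fin n → ℂ) M]
    (γ : ℝ → M) (J : Set ℝ) : Prop :=
  ∀ t ∈ J, ContinuousAt γ t ∧
    ContDiffAt ℝ 2 (fun s => chartAt (Fin n → ℂ) (γ t) (γ s)) t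

/-- The velocity `γ'(t) ∈ T'_{γ(t)} M`, that is, `∑ (dz_i/dt) ∂/∂z_i` in a chart at `γ(t)`. -/
def velocity (n : ℕ) {M : Type*} [TopologicalSpace M] [ChartedSpace (Fin n → ℂ) M]
    (γ : ℝ → M) (t : ℝ) : TangentSpace 𝓘(ℂ, Fin n → ℂ) (γ t) :=
  ∑ i, deriv (fun s => chartAt (Fin n → ℂ) (γ t) (γ s) i) t •
    coordField (chartAt (Fin n → ℂ) (γ t)) i (γ t)

/-- `V'` is the covariant derivative at time `t` of the vector field `V` along `γ`: if
`V = ∑ a_i E_i` near `t` with vector fields `E_i` holomorphic near `γ(t)`, then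
`V' = ∑ (a_i' E_i + a_i ∇_{γ'} E_i)`. -/
def HasCovDerivAlong (D : ConnOp n M) (γ : ℝ → M)
    (V : ∀ t : ℝ, TangentSpace 𝓘(ℂ, Fin n → ℂ) (γ t)) (t : ℝ)
    (V' : TangentSpace 𝓘(ℂ, Fin n → ℂ) (γ t)) : Prop :=
  ∃ (U : Set M) (E : Fin n → VField n M) (a : Fin n → ℝ → ℂ),
    IsOpen U ∧ γ t ∈ U ∧ (∀ i, IsHolomorphicField (E i) U) ∧
    (∀ i, DifferentiableAt ℝ (a i) t) ∧
    (∀ᶠ s in nhds t, V s = ∑ i, a i s • E i (γ s)) ∧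
    V' = ∑ i, (deriv (a i) t • E i (γ t) + a i t • D (E i) (γ t) (velocity n γ t))

/-- `γ` is an affine geodesic of the connection `D` on the open set `J`: it is `C²` and
`∇_{γ'} γ' = 0`. -/
def IsGeodesicOn (D : ConnOp n M) (γ : ℝ → M) (J : Set ℝ) : Prop :=
  IsC2Curve n γ J ∧ ∀ t ∈ J, HasCovDerivAlong D γ (velocity n γ) t 0

/-- The system `z_j'' + ∑_{k,l} Γ^j_{kl}(z, p̄) z_k' z_l' = 0` holds on `J` in all holomorphic
charts `φ` met by `γ` (and all charts `ψ` around `p`). -/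
def SolvesPolarizedGeodesicODE (p : M) (γ : ℝ → M) (J : Set ℝ) : Prop :=
  ∀ φ ∈ holCharts n M, ∀ ψ ∈ holCharts n M, p ∈ ψ.source →
    ∀ t ∈ J, γ t ∈ φ.source → ∀ j : Fin n,
      iteratedDeriv 2 (fun s => φ (γ s) j) t +
        ∑ k, ∑ l, christoffel φ ψ p j k l (φ (γ t)) *
          deriv (fun s => φ (γ s) k) t * deriv (fun s => φ (γ s) l) t = 0

/-! ### The connection with connection form `∂G · G⁻¹` -/

/-- `D` is a holomorphic affine connection on `T'Mᵖ` whose connection form in every holomorphic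
chart is `ω = ∂G · G⁻¹`, that is, `∇_{∂/∂z_l} ∂/∂z_k = ∑_j Γ^j_{kl}(z, p̄) ∂/∂z_j`. -/
structure IsBochnerConnection (p : M) (D : ConnOp n M) : Prop
    extends IsHolomorphicConnectionOn D (regularSet n p) where
  connection_form : ∀ φ ∈ holCharts n M, ∀ ψ ∈ holCharts n M, p ∈ ψ.source →
    ∀ x ∈ φ.source ∩ regularSet n p, ∀ k l : Fin n,
      D (coordField φ k) x (coordField φ l x) =
        ∑ j, christoffel φ ψ p j k l (φ x) • coordField φ j x

/-- The push-forward `f_* X` of a vector field under a biholomorphism. -/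
def pushforward {N : Type*} [TopologicalSpace N] [ChartedSpace (Fin n → ℂ) N]
    (f : M ≃ₘ^ω⟮𝓘(ℂ, Fin n → ℂ), 𝓘(ℂ, Fin n → ℂ)⟯ N) (X : VField n M) : VField n N :=
  VectorField.mpullback 𝓘(ℂ, Fin n → ℂ) 𝓘(ℂ, Fin n → ℂ) f.symm X

end Definitions

end BergmanGeometry

end

/-!
The connection `∇ᵖ` is the pull-back of the flat connection of `ℂⁿ` under a local biholomorphism,
namely Bochner's representative coordinates with respect to `p`.

`A²(M)` is a Hilbert space, by the sub-mean value inequality and locally uniform convergence of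
Cauchy sequences (`exists_hilbertModel`, `HilbertModel.completeSpace`), and the functionals
`f ↦ f*(w)` and `f ↦ ∂f*/∂w_k (w)` on it are bounded. Fix a chart `ψ` around `p`. The functionals at
`w = ψ p` are represented by holomorphic forms `h₀` and `h_k`, whose coefficients are `K*(·, p̄)`
and `∂K*/∂w̄_k (·, p̄)` (`exists_kernel_forms`). The quotients `u_k = h_k / h₀`, that is
`∂ log K*/∂w̄_k (·, p̄)`, are holomorphic functions on `M ∖ Z₀ᵖ` which need no chart in the first
argument (`bochnerCoord`), and `G(z, p̄)` is the Jacobian matrix of the map `u`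
(`polarizedMetric_eq_mfderiv`). Hence `Mᵖ` is the set where `u` is a local biholomorphism
(`mem_regularSet_iff`); it is open, and there `du (∇_X Y) = X (Y u)` defines a holomorphic
connection (`devConn`). Its connection form is `∂G · G⁻¹` (`devConn_bochnerCoord_coordField`).
Another chart at `p` changes `u` by an affine transformation (`exists_bochnerCoord_eq_affine`), so
that `∇` does not depend on `ψ`.

The three properties are read off from the description of `∇` by `u`.

* Torsion and curvature are mapped by `du` to `X (Y F) - Y (X F) - [X, Y] F`, with `F = u` and
  `F = Z u` respectively, and this expression vanishes (`mvfderiv_mlieBracket`).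
* Along a curve, `du` maps the covariant derivative to the ordinary derivative
  (`IsDevelopingMapOn.mvfderiv_hasCovDerivAlong`). The covariant derivative is therefore unique, and
  computing it in the coordinate frame of a chart yields the system of geodesic equations
  (`IsC2Curve.hasCovDerivAlong_velocity`).
* The pull-back of `n`-forms is isometric and the kernel does not depend on the orthonormal basis
  (`kernel_eq_tsum`), so the kernel, and with it `u`, is invariant under biholomorphisms
  (`kernel_transportChart`, `bochnerCoord_diffeomorph`). As a connection is determined by its
  connection form (`covariant_ext`), every connection on the target with the prescribed form is the
  one given by the corresponding coordinates there (`IsBochnerConnection.eq_devConn`), and the two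
  connections correspond to each other (`mfderiv_devConn_bochnerCoord`).
-/

noncomputable section

namespace BergmanGeometry

/-! ### Holomorphic functions of several variables -/

section SeveralVariables

open Filter Metric Set Topology

variable {E G : Type*} [NormedAddCommGroup E] [NormedSpace ℂ E]
  [NormedAddCommGroup G] [NormedSpace ℂ G]

/-- The **Cauchy estimate** for the first derivative in several variables. -/
theorem norm_fderiv_le_of_norm_le {f : E → G} {a : E} {r C : ℝ} (hr : 0 < r)
    (hf : DifferentiableOn ℂ f (ball a r)) (hC : ∀ z ∈ ball a r, ‖f z‖ ≤ C) :
    ‖fderiv ℂ f a‖ ≤ 2 * C / r := by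
  refine Complex.norm_fderiv_le_div_of_mapsTo_ball hf (fun z hz => ?_) hr
  rw [mem_closedBall, dist_eq_norm]
  linarith [norm_sub_le (f z) (f a), hC z hz, hC a (mem_ball_self hr)]

/-- A locally uniform limit of holomorphic functions of several variables is holomorphic: by the
Cauchy estimate the derivatives form a uniform Cauchy sequence on a smaller ball. -/
theorem differentiableAt_of_uniformCauchySeqOn [CompleteSpace G] {F : ℕ → E → G}
    {f : E → G} {a : E} {r : ℝ} (hr : 0 < r) (hF : ∀ i, DifferentiableOn ℂ (F i) (ball a r))
    (hc : UniformCauchySeqOn F atTop (ball a r))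
    (hlim : ∀ z ∈ ball a r, Tendsto (fun i => F i z) atTop (𝓝 (f z))) :
    DifferentiableAt ℂ f a := by
  have hsub : ∀ z ∈ ball a (r / 2), ball z (r / 2) ⊆ ball a r := fun z hz =>
    ball_subset_ball' (by rw [mem_ball] at hz; linarith)
  have hmem : ∀ z ∈ ball a (r / 2), z ∈ ball a r := fun z hz => ball_subset_ball (by linarith) hz
  have hd : ∀ i, ∀ z ∈ ball a (r / 2), DifferentiableAt ℂ (F i) z := fun i z hz =>
    (hF i).differentiableAt (isOpen_ball.mem_nhds (hmem z hz))
  have hcd : UniformCauchySeqOn (fun i => fderiv ℂ (F i)) atTop (ball a (r / 2)) := by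
    rw [Metric.uniformCauchySeqOn_iff] at hc ⊢
    intro ε hε
    obtain ⟨N, hN⟩ := hc (ε * r / 8) (by positivity)
    refine ⟨N, fun m hm k hk z hz => ?_⟩
    rw [dist_eq_norm, ← fderiv_sub (hd m z hz) (hd k z hz)]
    have h1 := norm_fderiv_le_of_norm_le (f := F m - F k) (a := z) (r := r / 2) (C := ε * r / 8)
      (by positivity) (((hF m).sub (hF k)).mono (hsub z hz)) (fun w hw => by
        have := hN m hm k hk w (hsub z hz hw)
        rw [dist_eq_norm] at this
        exact this.le)
    refine h1.trans_lt ?_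
    rw [div_lt_iff₀ (by positivity)]
    nlinarith [mul_pos hε hr]
  have hex : ∀ z : E, ∃ L : E →L[ℂ] G, z ∈ ball a (r / 2) →
      Tendsto (fun i => fderiv ℂ (F i) z) atTop (𝓝 L) := by
    intro z
    by_cases hz : z ∈ ball a (r / 2)
    · obtain ⟨L, hL⟩ := cauchySeq_tendsto_of_complete (hcd.cauchySeq hz)
      exact ⟨L, fun _ => hL⟩
    · exact ⟨0, fun h => absurd h hz⟩
  choose L hL using hex
  exact (hasFDerivAt_of_tendstoLocallyUniformlyOn isOpen_ball
    (hcd.tendstoUniformlyOn_of_tendsto fun z hz => hL z hz).tendstoLocallyUniformlyOn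
    (fun i z hz => (hd i z hz).hasFDerivAt) (fun z hz => hlim z (hmem z hz))
    (mem_ball_self (by positivity))).differentiableAt

/-- The difference quotients of a bounded holomorphic function converge to the directional
derivative at a rate which depends only on the bound `C` and the radius `r`. This is the Schwarz
lemma, applied twice: to `f` on the complex line through `z` in the direction `v`, and to the
resulting slope function, which is holomorphic and bounded. -/
theorem norm_slope_sub_fderiv_le [CompleteSpace G] {f : E → G} {z v : E} {r C : ℝ}
    (hr : 0 < r) (hv : ‖v‖ ≤ 1) (hf : DifferentiableOn ℂ f (ball z r))
    (hC : ∀ w ∈ ball z r, ‖f w‖ ≤ C) {t : ℂ} (ht0 : t ≠ 0) (ht : ‖t‖ < r) :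
    ‖t⁻¹ • (f (z + t • v) - f z) - fderiv ℂ f z v‖ ≤ 4 * C / r / r * ‖t‖ := by
  set g : ℂ → G := fun s => f (z + s • v) with hg
  have hmaps : MapsTo (fun s : ℂ => z + s • v) (ball 0 r) (ball z r) := by
    intro s hs
    rw [mem_ball, dist_eq_norm, add_sub_cancel_left, norm_smul]
    rw [mem_ball_zero_iff] at hs
    nlinarith [norm_nonneg s, norm_nonneg v]
  have hgd : DifferentiableOn ℂ g (ball 0 r) := hf.comp (by fun_prop) hmaps
  have hg0 : g 0 = f z := by simp [hg]
  have hgbd : MapsTo g (ball 0 r) (closedBall (g 0) (2 * C)) := by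
    intro s hs
    rw [mem_closedBall, dist_eq_norm, hg0]
    linarith [norm_sub_le (g s) (f z), hC _ (hmaps hs), hC z (mem_ball_self hr)]
  have hds : DifferentiableOn ℂ (dslope g 0) (ball 0 r) :=
    (Complex.differentiableOn_dslope (ball_mem_nhds 0 hr)).2 hgd
  have hdsb : MapsTo (dslope g 0) (ball 0 r) (closedBall (dslope g 0 0) (4 * C / r)) := by
    intro s hs
    have h1 := Complex.norm_dslope_le_div_of_mapsTo_ball hgd hgbd hs
    have h2 := Complex.norm_dslope_le_div_of_mapsTo_ball hgd hgbd (mem_ball_self hr)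
    rw [mem_closedBall, dist_eq_norm]
    calc _ ≤ _ := norm_sub_le _ _
      _ ≤ 2 * C / r + 2 * C / r := add_le_add h1 h2
      _ = 4 * C / r := by ring
  have h := Complex.dist_le_div_mul_dist_of_mapsTo_ball hds hdsb
    (z := t) (by rwa [mem_ball_zero_iff])
  have hder : deriv g 0 = fderiv ℂ f z v := by
    have h1 : HasFDerivAt f (fderiv ℂ f z) (z + (0 : ℂ) • v) := by
      simpa using (hf.differentiableAt (ball_mem_nhds z hr)).hasFDerivAt
    have h2 : HasDerivAt (fun s : ℂ => z + s • v) v 0 := by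
      simpa using ((hasDerivAt_id (0 : ℂ)).smul_const v).const_add z
    exact (h1.comp_hasDerivAt (0 : ℂ) h2).deriv
  rw [dslope_same, dslope_of_ne _ ht0, hder, slope_def_module, hg0, dist_eq_norm] at h
  simpa using h

/-- Directional derivatives of holomorphic functions of several variables are holomorphic, as
locally uniform limits of difference quotients. -/
theorem differentiableOn_fderiv_apply [CompleteSpace G] {f : E → G} {U : Set E} (hU : IsOpen U)
    (hf : DifferentiableOn ℂ f U) (v : E) : DifferentiableOn ℂ (fun z => fderiv ℂ f z v) U := by
  -- it suffices to treat short vectors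
  suffices H : ∀ v : E, ‖v‖ ≤ 1 → DifferentiableOn ℂ (fun z => fderiv ℂ f z v) U by
    have h1 := H (((‖v‖ + 1 : ℝ) : ℂ)⁻¹ • v) (by
      rw [norm_smul, norm_inv, Complex.norm_real, Real.norm_of_nonneg (by positivity),
        inv_mul_le_iff₀ (by positivity)]
      linarith)
    have hne : ((‖v‖ + 1 : ℝ) : ℂ) ≠ 0 := by
      exact_mod_cast (by positivity : (‖v‖ + 1 : ℝ) ≠ 0)
    refine (h1.const_smul (((‖v‖ + 1 : ℝ) : ℂ))).congr fun z _ => ?_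
    rw [Pi.smul_apply, map_smul, smul_inv_smul₀ hne]
  intro v hv a ha
  refine DifferentiableAt.differentiableWithinAt ?_
  obtain ⟨r₁, hr₁, h₁⟩ := Metric.mem_nhds_iff.1 (hU.mem_nhds ha)
  obtain ⟨r₂, hr₂, h₂⟩ := Metric.continuousAt_iff.1
    (hf.continuousOn.continuousAt (hU.mem_nhds ha)) 1 one_pos
  set r := min r₁ r₂ with hrdef
  have hr : 0 < r := lt_min hr₁ hr₂
  have hbU : ball a r ⊆ U := (ball_subset_ball (min_le_left _ _)).trans h₁
  set C := ‖f a‖ + 1 with hCdef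
  have hC : ∀ w ∈ ball a r, ‖f w‖ ≤ C := by
    intro w hw
    have := h₂ (ball_subset_ball (min_le_right _ _) hw)
    rw [dist_eq_norm] at this
    linarith [norm_sub_norm_le (f w) (f a)]
  have hsub : ∀ z ∈ ball a (r / 2), ball z (r / 2) ⊆ ball a r := fun z hz =>
    ball_subset_ball' (by rw [mem_ball] at hz; linarith)
  set t : ℕ → ℂ := fun i => ((r / 4 / (i + 1) : ℝ) : ℂ) with ht
  have ht0 : ∀ i, t i ≠ 0 := fun i => by
    exact Complex.ofReal_ne_zero.2 (by positivity)
  have htn : ∀ i, ‖t i‖ = r / 4 / (i + 1) := fun i => by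
    rw [ht, Complex.norm_real, Real.norm_of_nonneg (by positivity)]
  have htlt : ∀ i, ‖t i‖ < r / 2 := fun i => by
    rw [htn]
    have : r / 4 / ((i : ℝ) + 1) ≤ r / 4 :=
      div_le_self (by positivity) (by linarith [(Nat.cast_nonneg i : (0 : ℝ) ≤ i)])
    linarith
  have htlim : Tendsto (fun i => ‖t i‖) atTop (𝓝 0) := by
    simp_rw [htn]
    exact tendsto_const_div_atTop_nhds_zero_nat (r / 4) |>.comp (tendsto_add_atTop_nat 1) |>.congr
      fun i => by simp
  have key : ∀ i, ∀ z ∈ ball a (r / 2),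
      ‖(t i)⁻¹ • (f (z + t i • v) - f z) - fderiv ℂ f z v‖ ≤
        4 * C / (r / 2) / (r / 2) * ‖t i‖ := fun i z hz =>
    norm_slope_sub_fderiv_le (by positivity) hv (hf.mono ((hsub z hz).trans hbU))
      (fun w hw => hC w (hsub z hz hw)) (ht0 i) (htlt i)
  have hunif : TendstoUniformlyOn (fun i z => (t i)⁻¹ • (f (z + t i • v) - f z))
      (fun z => fderiv ℂ f z v) atTop (ball a (r / 2)) := by
    rw [Metric.tendstoUniformlyOn_iff]
    intro ε hε
    have h0 : Tendsto (fun i => 4 * C / (r / 2) / (r / 2) * ‖t i‖) atTop (𝓝 0) := by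
      simpa using htlim.const_mul (4 * C / (r / 2) / (r / 2))
    filter_upwards [h0.eventually (gt_mem_nhds hε)] with i hi z hz
    rw [dist_comm, dist_eq_norm]
    exact (key i z hz).trans_lt hi
  refine differentiableAt_of_uniformCauchySeqOn (r := r / 2) (by positivity) (fun i => ?_)
    hunif.uniformCauchySeqOn (fun z hz => hunif.tendsto_at hz)
  have hmaps : MapsTo (fun z : E => z + t i • v) (ball a (r / 2)) (ball a r) := fun z hz => by
    refine hsub z hz ?_
    rw [mem_ball, dist_eq_norm, add_sub_cancel_left, norm_smul]
    nlinarith [htlt i, norm_nonneg v, norm_nonneg (t i)]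
  exact (((hf.mono hbU).comp (by fun_prop) hmaps).sub
    ((hf.mono hbU).mono (ball_subset_ball (by linarith)))).const_smul _

/-- Holomorphic functions of finitely many variables are smooth. -/
theorem contDiffOn_of_differentiableOn [FiniteDimensional ℂ E] [CompleteSpace G] {f : E → G}
    {U : Set E} (hU : IsOpen U) (hf : DifferentiableOn ℂ f U) : ContDiffOn ℂ ∞ f U := by
  refine contDiffOn_infty.2 fun k => ?_
  induction k generalizing f with
  | zero => exact contDiffOn_zero.2 hf.continuousOn
  | succ k ih =>
    push_cast
    refine (contDiffOn_succ_iff_fderiv_of_isOpen hU).2 ⟨hf, fun h => ?_, ?_⟩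
    · exact absurd h (by simp)
    · exact contDiffOn_clm_apply.2 fun v => ih (differentiableOn_fderiv_apply hU hf v)

open MeasureTheory in
/-- The mean value inequality `|f(a)|² ≤ avg |f(a + e^{iθ} v)|²` on a complex line. -/
theorem enorm_sq_le_lintegral_circle {f : E → ℂ} {a v : E} {r : ℝ}
    (hf : DifferentiableOn ℂ f (ball a r)) (hv : ‖v‖ < r) :
    ENNReal.ofReal (2 * Real.pi) * ‖f a‖ₑ ^ 2 ≤
      ∫⁻ θ in Ioc 0 (2 * Real.pi), ‖f (a + circleMap 0 1 θ • v)‖ₑ ^ 2 := by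
  set g : ℂ → ℂ := fun s => f (a + s • v) ^ 2 with hg
  have hmaps : MapsTo (fun s : ℂ => a + s • v) (closedBall 0 1) (ball a r) := by
    intro s hs
    rw [mem_ball, dist_eq_norm, add_sub_cancel_left, norm_smul]
    rw [mem_closedBall_zero_iff] at hs
    nlinarith [norm_nonneg s, norm_nonneg v]
  have hgd : DifferentiableOn ℂ g (closedBall 0 1) :=
    (hf.comp (by fun_prop) hmaps).pow 2
  -- the mean value property of the holomorphic function `s ↦ f (a + s v) ^ 2`
  have hmv : Real.circleAverage g 0 1 = f a ^ 2 := by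
    have : DiffContOnCl ℂ g (ball 0 |1|) := by
      rw [abs_one]
      exact ⟨hgd.mono ball_subset_closedBall, by
        rw [closure_ball _ one_ne_zero]; exact hgd.continuousOn⟩
    rw [this.circleAverage]
    simp [hg]
  rw [Real.circleAverage_def, intervalIntegral.integral_of_le (by positivity)] at hmv
  have h1 : ((2 * Real.pi : ℝ) : ℂ) * f a ^ 2 =
      ∫ θ in Ioc 0 (2 * Real.pi), g (circleMap 0 1 θ) := by
    rw [← hmv, Complex.real_smul, ← mul_assoc, ← Complex.ofReal_mul,
      mul_inv_cancel₀ (by positivity), Complex.ofReal_one, one_mul]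
  have h2 := enorm_integral_le_lintegral_enorm (μ := volume.restrict (Ioc 0 (2 * Real.pi)))
    (fun θ => g (circleMap 0 1 θ))
  rw [← h1, enorm_mul, enorm_pow] at h2
  convert h2 using 2
  · rw [← ofReal_norm, Complex.norm_real, Real.norm_of_nonneg (by positivity)]
  · simp [hg, enorm_pow]

open MeasureTheory in
/-- A holomorphic function on a polydisc satisfies the sub-mean value inequality for `|f|²`. The
one-variable inequality holds on every complex line through the centre; integrating it over `v` in
the polydisc gives the claim, because the rotations `v ↦ e^{iθ} v` preserve the volume. -/
theorem volume_ball_mul_enorm_sq_le {n : ℕ} {f : (Fin n → ℂ) → ℂ} {a : Fin n → ℂ} {r : ℝ}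
    (hf : DifferentiableOn ℂ f (ball a r)) :
    volume (ball a r) * ‖f a‖ₑ ^ 2 ≤ ∫⁻ z in ball a r, ‖f z‖ₑ ^ 2 := by
  classical
  -- extension by zero, so that all integrands are measurable on the whole space
  set F : (Fin n → ℂ) → ℝ≥0∞ := (ball a r).indicator fun z => ‖f z‖ₑ ^ 2 with hF
  have hFm : Measurable F := by
    have hc : ContinuousOn (fun z => ‖f z‖ₑ ^ 2) (ball a r) :=
      (ENNReal.continuous_pow 2).comp_continuousOn hf.continuousOn.enorm
    have := hc.measurable_piecewise (g := fun _ => (0 : ℝ≥0∞)) continuousOn_const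
      (isOpen_ball (x := a) (ε := r)).measurableSet
    rw [hF]
    convert this using 1
    funext z
    by_cases hz : z ∈ ball a r <;> simp [hz]
  -- `v ↦ e^{iθ} v` acts as a rotation in each coordinate
  have hrot : ∀ θ : ℝ, ∫⁻ v, F (a + circleMap 0 1 θ • v) = ∫⁻ z, F z := by
    intro θ
    have hmp : MeasurePreserving (fun v : Fin n → ℂ => circleMap 0 1 θ • v) volume volume := by
      have := volume_preserving_pi (ι := Fin n) (α' := fun _ => ℂ) (β' := fun _ => ℂ)
        (f := fun _ => rotation (Circle.exp θ))
        (fun _ => (rotation (Circle.exp θ)).measurePreserving)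
      have heq : (fun v : Fin n → ℂ => circleMap 0 1 θ • v) =
          fun v i => rotation (Circle.exp θ) (v i) := by
        funext v i
        simp [circleMap, rotation_apply]
      rw [heq]
      exact this
    rw [hmp.lintegral_comp (f := fun z => F (a + z)) (hFm.comp (measurable_const_add a)),
      lintegral_add_left_eq_self]
  have hpi : ENNReal.ofReal (2 * Real.pi) ≠ 0 := by
    simp [Real.pi_pos]
  have hpt : ENNReal.ofReal (2 * Real.pi) ≠ ⊤ := ENNReal.ofReal_ne_top
  have hball : volume (ball a r) = volume (ball (0 : Fin n → ℂ) r) :=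
    Measure.addHaar_ball_center _ _ _
  have hmeas : Measurable (Function.uncurry fun (v : Fin n → ℂ) (θ : ℝ) =>
      F (a + circleMap 0 1 θ • v)) :=
    hFm.comp (by fun_prop)
  have hmain : ENNReal.ofReal (2 * Real.pi) * (volume (ball a r) * ‖f a‖ₑ ^ 2) ≤
      ENNReal.ofReal (2 * Real.pi) * ∫⁻ z in ball a r, ‖f z‖ₑ ^ 2 := by
    calc ENNReal.ofReal (2 * Real.pi) * (volume (ball a r) * ‖f a‖ₑ ^ 2)
        = ∫⁻ _ in ball (0 : Fin n → ℂ) r, ENNReal.ofReal (2 * Real.pi) * ‖f a‖ₑ ^ 2 := by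
          rw [setLIntegral_const, hball]; ring
      _ ≤ ∫⁻ v in ball (0 : Fin n → ℂ) r,
            ∫⁻ θ in Ioc 0 (2 * Real.pi), F (a + circleMap 0 1 θ • v) := by
          refine setLIntegral_mono' measurableSet_ball fun v hv => ?_
          rw [mem_ball_zero_iff] at hv
          refine (enorm_sq_le_lintegral_circle hf hv).trans_eq (lintegral_congr fun θ => ?_)
          rw [hF, indicator_of_mem]
          rw [mem_ball, dist_eq_norm, add_sub_cancel_left, norm_smul]
          simpa using hv
      _ ≤ ∫⁻ v, ∫⁻ θ in Ioc 0 (2 * Real.pi), F (a + circleMap 0 1 θ • v) :=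
          setLIntegral_le_lintegral _ _
      _ = ∫⁻ θ in Ioc 0 (2 * Real.pi), ∫⁻ v, F (a + circleMap 0 1 θ • v) :=
          lintegral_lintegral_swap hmeas.aemeasurable
      _ = ENNReal.ofReal (2 * Real.pi) * ∫⁻ z in ball a r, ‖f z‖ₑ ^ 2 := by
          simp_rw [hrot, lintegral_const]
          rw [hF, lintegral_indicator measurableSet_ball, mul_comm]
          simp
  exact (ENNReal.mul_le_mul_iff_right hpi hpt).1 hmain

end SeveralVariables

/-! ### Charts and the coefficients of `n`-forms -/

section Charts

open Set Filter Topology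

theorem isOpen_transition_domain {n : ℕ} {M : Type*} [TopologicalSpace M]
    (φ φ' : OpenPartialHomeomorph M (Fin n → ℂ)) :
    IsOpen (φ.target ∩ φ.symm ⁻¹' φ'.source) :=
  φ.isOpen_inter_preimage_symm φ'.open_source

variable {n : ℕ} {M : Type*} [TopologicalSpace M] [ChartedSpace (Fin n → ℂ) M]

/-- The coefficient of an `n`-form with respect to the standard frame of
`TangentSpace 𝓘(ℂ, ℂⁿ) x = ℂⁿ`, that is, with respect to the preferred chart at `x`. It determines
the form, but need not depend continuously on `x`. -/
def refCoeff (f : NForm n M) (x : M) : ℂ :=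
  f x (fun i => (Pi.single i 1 : Fin n → ℂ))

/-- The value of the `n`-covector `dx_1 ∧ ⋯ ∧ dx_n` of the preferred chart at `x` on the coordinate
frame of `φ`. -/
def chartJac (φ : OpenPartialHomeomorph M (Fin n → ℂ)) (x : M) : ℂ :=
  ContinuousLinearMap.det (R := ℂ) (M := Fin n → ℂ)
    (mfderiv 𝓘(ℂ, Fin n → ℂ) 𝓘(ℂ, Fin n → ℂ) φ x).inverse

/-- The coefficient in an arbitrary chart differs from `refCoeff` by a factor which does not depend
on the form. Limits and quotients of coefficients can therefore be taken pointwise in the tangent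
spaces. -/
theorem formCoeff_eq (f : NForm n M) (φ : OpenPartialHomeomorph M (Fin n → ℂ)) (z : Fin n → ℂ) :
    formCoeff f φ z = chartJac φ (φ.symm z) * refCoeff f (φ.symm z) := by
  set L : (Fin n → ℂ) →L[ℂ] (Fin n → ℂ) :=
    (mfderiv 𝓘(ℂ, Fin n → ℂ) 𝓘(ℂ, Fin n → ℂ) φ (φ.symm z)).inverse with hL
  set a : (Fin n → ℂ) [⋀^Fin n]→ₗ[ℂ] ℂ := (f (φ.symm z)).toAlternatingMap with ha
  set e : Module.Basis (Fin n) ℂ (Fin n → ℂ) := Pi.basisFun ℂ (Fin n) with he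
  have h1 : formCoeff f φ z = a (L.toLinearMap ∘ e) := by
    rw [ha]
    simp only [he, hL, formCoeff, coordField]
    change _ = (f (φ.symm z)) _
    congr 1
    funext i
    simp only [Function.comp_apply, Pi.basisFun_apply]
    rfl
  have h2 : refCoeff f (φ.symm z) = a e := by
    rw [ha]
    simp only [he, refCoeff]
    change _ = (f (φ.symm z)) _
    congr 1
    funext i
    simp
  rw [h1, h2]
  conv_lhs => rw [a.eq_smul_basis_det e]
  rw [AlternatingMap.smul_apply, e.det_comp, e.det_self, smul_eq_mul, mul_one, mul_comm]
  rfl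

theorem nform_ext {f g : NForm n M} (h : ∀ x, refCoeff f x = refCoeff g x) : f = g := by
  funext x
  set e : Module.Basis (Fin n) ℂ (Fin n → ℂ) := Pi.basisFun ℂ (Fin n) with he
  have h2 : ∀ f : NForm n M, refCoeff f x =
      ((f x).toAlternatingMap : (Fin n → ℂ) [⋀^Fin n]→ₗ[ℂ] ℂ) e := by
    intro f
    simp only [he, refCoeff]
    change _ = (f x) _
    congr 1
    funext i
    simp
  apply ContinuousAlternatingMap.toAlternatingMap_injective
  have hf := AlternatingMap.eq_smul_basis_det e
    ((f x).toAlternatingMap : (Fin n → ℂ) [⋀^Fin n]→ₗ[ℂ] ℂ)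
  have hg := AlternatingMap.eq_smul_basis_det e
    ((g x).toAlternatingMap : (Fin n → ℂ) [⋀^Fin n]→ₗ[ℂ] ℂ)
  exact hf.trans ((congrArg (· • e.det) ((h2 f).symm.trans ((h x).trans (h2 g)))).trans hg.symm)

/-- The `n`-form with prescribed reference coefficient. -/
def nformOfRefCoeff (c : M → ℂ) : NForm n M := fun x =>
  c x • (ContinuousLinearMap.id ℂ ℂ).compContinuousAlternatingMap
    (show (Fin n → ℂ) [⋀^Fin n]→L[ℂ] ℂ from
      ⟨(ContinuousMultilinearMap.mk (Pi.basisFun ℂ (Fin n)).det.toMultilinearMap (by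
        change Continuous fun v => (Pi.basisFun ℂ (Fin n)).det v
        simp only [Module.Basis.det_apply]
        refine Continuous.matrix_det ?_
        refine continuous_pi fun i => continuous_pi fun j => ?_
        simp only [Module.Basis.toMatrix_apply, Pi.basisFun_repr]
        fun_prop)),
        (Pi.basisFun ℂ (Fin n)).det.map_eq_zero_of_eq'⟩)

theorem refCoeff_nformOfRefCoeff (c : M → ℂ) (x : M) :
    refCoeff (n := n) (nformOfRefCoeff c) x = c x := by
  have : (Pi.basisFun ℂ (Fin n)).det (fun i => (Pi.single i 1 : Fin n → ℂ)) = 1 := by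
    have h : (fun i => (Pi.single i 1 : Fin n → ℂ)) = Pi.basisFun ℂ (Fin n) := by
      funext i
      simp
    rw [h]
    exact (Pi.basisFun ℂ (Fin n)).det_self
  change c x • (Pi.basisFun ℂ (Fin n)).det (fun i => (Pi.single i 1 : Fin n → ℂ)) = c x
  rw [this, smul_eq_mul, mul_one]

variable {φ φ' ψ : OpenPartialHomeomorph M (Fin n → ℂ)}

theorem formCoeff_add (f g : NForm n M) (φ : OpenPartialHomeomorph M (Fin n → ℂ))
    (z : Fin n → ℂ) : formCoeff (f + g) φ z = formCoeff f φ z + formCoeff g φ z := rfl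

theorem formCoeff_smul (c : ℂ) (f : NForm n M) (φ : OpenPartialHomeomorph M (Fin n → ℂ))
    (z : Fin n → ℂ) : formCoeff (c • f) φ z = c * formCoeff f φ z := rfl

theorem formCoeff_sub (f g : NForm n M) (φ : OpenPartialHomeomorph M (Fin n → ℂ))
    (z : Fin n → ℂ) : formCoeff (f - g) φ z = formCoeff f φ z - formCoeff g φ z := rfl

theorem formCoeff_zero (φ : OpenPartialHomeomorph M (Fin n → ℂ))
    (z : Fin n → ℂ) : formCoeff (0 : NForm n M) φ z = 0 := rfl

theorem mdifferentiable_of_mem_holCharts (hφ : φ ∈ holCharts n M) :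
    φ.MDifferentiable 𝓘(ℂ, Fin n → ℂ) 𝓘(ℂ, Fin n → ℂ) :=
  ⟨(contMDiffOn_of_mem_maximalAtlas hφ).mdifferentiableOn (by simp),
    (contMDiffOn_symm_of_mem_maximalAtlas hφ).mdifferentiableOn (by simp)⟩

theorem isInvertible_mfderiv_chart (hφ : φ ∈ holCharts n M) {x : M} (hx : x ∈ φ.source) :
    (mfderiv 𝓘(ℂ, Fin n → ℂ) 𝓘(ℂ, Fin n → ℂ) φ x).IsInvertible :=
  ⟨(mdifferentiable_of_mem_holCharts hφ).mfderiv hx, rfl⟩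

theorem mfderiv_chart_coordField (hφ : φ ∈ holCharts n M) {x : M} (hx : x ∈ φ.source)
    (i : Fin n) :
    mfderiv 𝓘(ℂ, Fin n → ℂ) 𝓘(ℂ, Fin n → ℂ) φ x (coordField φ i x) =
      (Pi.single i (1 : ℂ) : Fin n → ℂ) :=
  (isInvertible_mfderiv_chart hφ hx).self_apply_inverse _

theorem chartJac_ne_zero (hφ : φ ∈ holCharts n M) {x : M} (hx : x ∈ φ.source) :
    chartJac φ x ≠ 0 := by
  obtain ⟨e, he⟩ := (isInvertible_mfderiv_chart hφ hx).inverse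
  set e' : (Fin n → ℂ) ≃L[ℂ] (Fin n → ℂ) := e
  have : chartJac φ x = LinearMap.det (e'.toLinearEquiv : (Fin n → ℂ) →ₗ[ℂ] (Fin n → ℂ)) := by
    rw [chartJac, ← he]; rfl
  rw [this]
  exact (LinearEquiv.isUnit_det' e'.toLinearEquiv).ne_zero

/-- The transition map between two holomorphic charts is holomorphic. -/
theorem differentiableOn_transition (hφ : φ ∈ holCharts n M) (hφ' : φ' ∈ holCharts n M) :
    DifferentiableOn ℂ (φ' ∘ φ.symm) (φ.target ∩ φ.symm ⁻¹' φ'.source) := by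
  rw [← mdifferentiableOn_iff_differentiableOn]
  exact (mdifferentiable_of_mem_holCharts hφ').1.comp
    ((mdifferentiable_of_mem_holCharts hφ).2.mono inter_subset_left) (fun z hz => hz.2)

/-- A function which is holomorphic in the chart `φ` is differentiable on the manifold, with the
derivative given by the chain rule. -/
theorem hasMFDerivAt_of_differentiableAt_chart {G : Type*} [NormedAddCommGroup G] [NormedSpace ℂ G]
    {F : M → G} {x : M} (hφ : φ ∈ holCharts n M) (hx : x ∈ φ.source)
    (hF : DifferentiableAt ℂ (F ∘ φ.symm) (φ x)) :
    HasMFDerivAt 𝓘(ℂ, Fin n → ℂ) 𝓘(ℂ, G) F x ((fderiv ℂ (F ∘ φ.symm) (φ x)).comp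
      (mfderiv 𝓘(ℂ, Fin n → ℂ) 𝓘(ℂ, Fin n → ℂ) φ x)) := by
  have h1 : HasMFDerivAt 𝓘(ℂ, Fin n → ℂ) 𝓘(ℂ, Fin n → ℂ) φ x _ :=
    ((mdifferentiable_of_mem_holCharts hφ).mdifferentiableAt hx).hasMFDerivAt
  refine (hF.hasFDerivAt.hasMFDerivAt.comp x h1).congr_of_eventuallyEq ?_
  filter_upwards [φ.open_source.mem_nhds hx] with y hy
  simp [hy]

theorem mfderiv_chart_eq (hφ : φ ∈ holCharts n M) (hφ' : φ' ∈ holCharts n M) {x : M}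
    (hx : x ∈ φ.source) (hx' : x ∈ φ'.source) :
    mfderiv 𝓘(ℂ, Fin n → ℂ) 𝓘(ℂ, Fin n → ℂ) φ' x = (fderiv ℂ (φ' ∘ φ.symm) (φ x)).comp
      (mfderiv 𝓘(ℂ, Fin n → ℂ) 𝓘(ℂ, Fin n → ℂ) φ x) := by
  refine (hasMFDerivAt_of_differentiableAt_chart hφ hx ?_).mfderiv
  exact (differentiableOn_transition hφ hφ').differentiableAt
    ((isOpen_transition_domain φ φ').mem_nhds ⟨φ.map_source hx, by simpa [hx] using hx'⟩)

/-- The chain rule for Jacobians; `chartJac` is formed with the inverse derivative of the chart, so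
the transition map goes from `φ` to `φ'`. -/
theorem chartJac_eq (hφ : φ ∈ holCharts n M) (hφ' : φ' ∈ holCharts n M) {x : M}
    (hx : x ∈ φ.source) (hx' : x ∈ φ'.source) :
    chartJac φ x = (fderiv ℂ (φ' ∘ φ.symm) (φ x)).det * chartJac φ' x := by
  set A : (Fin n → ℂ) →L[ℂ] (Fin n → ℂ) := mfderiv 𝓘(ℂ, Fin n → ℂ) 𝓘(ℂ, Fin n → ℂ) φ x
  set A' : (Fin n → ℂ) →L[ℂ] (Fin n → ℂ) := mfderiv 𝓘(ℂ, Fin n → ℂ) 𝓘(ℂ, Fin n → ℂ) φ' x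
  have hA : A.IsInvertible := isInvertible_mfderiv_chart hφ hx
  have hA' : A'.IsInvertible := isInvertible_mfderiv_chart hφ' hx'
  have h : A' = (fderiv ℂ (φ' ∘ φ.symm) (φ x)).comp A := mfderiv_chart_eq hφ hφ' hx hx'
  have h2 : A.inverse = A'.inverse.comp (fderiv ℂ (φ' ∘ φ.symm) (φ x)) := by
    ext1 v
    obtain ⟨w, rfl⟩ : ∃ w, A w = v := ⟨A.inverse v, hA.self_apply_inverse v⟩
    rw [hA.inverse_apply_self, ContinuousLinearMap.comp_apply,
      ← ContinuousLinearMap.comp_apply _ A, ← h, hA'.inverse_apply_self]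
  change A.inverse.det = _ * A'.inverse.det
  rw [h2]
  exact (LinearMap.det_comp _ _).trans (mul_comm _ _)

/-- The transformation rule for the coefficient of an `n`-form. -/
theorem formCoeff_transition (f : NForm n M) (hφ : φ ∈ holCharts n M) (hφ' : φ' ∈ holCharts n M)
    {z : Fin n → ℂ} (hz : z ∈ φ.target) (hz' : φ.symm z ∈ φ'.source) :
    formCoeff f φ z = (fderiv ℂ (φ' ∘ φ.symm) z).det * formCoeff f φ' (φ' (φ.symm z)) := by
  rw [formCoeff_eq, formCoeff_eq, φ'.left_inv hz',
    chartJac_eq hφ hφ' (φ.map_target hz) hz', φ.right_inv hz, mul_assoc]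

theorem det_fderiv_transition_ne_zero (hφ : φ ∈ holCharts n M) (hφ' : φ' ∈ holCharts n M)
    {z : Fin n → ℂ} (hz : z ∈ φ.target) (hz' : φ.symm z ∈ φ'.source) :
    (fderiv ℂ (φ' ∘ φ.symm) z).det ≠ 0 := by
  have h := chartJac_eq hφ hφ' (φ.map_target hz) hz'
  rw [φ.right_inv hz] at h
  intro h0
  rw [h0, zero_mul] at h
  exact chartJac_ne_zero hφ (φ.map_target hz) h

variable [IsManifold 𝓘(ℂ, Fin n → ℂ) ω M]

theorem chartAt_mem_holCharts (x : M) : chartAt (Fin n → ℂ) x ∈ holCharts n M :=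
  IsManifold.chart_mem_maximalAtlas x

end Charts

/-! ### The norm as a sum over a countable partition into chart pieces -/

section NormSq

open Set Filter Topology MeasureTheory

variable {n : ℕ} {M : Type*} [TopologicalSpace M] [ChartedSpace (Fin n → ℂ) M]
  {φ φ' : OpenPartialHomeomorph M (Fin n → ℂ)}

/-- The real Jacobian of a complex linear map is the squared modulus of the complex one. -/
theorem ofReal_abs_det_restrictScalars (L : (Fin n → ℂ) →L[ℂ] (Fin n → ℂ)) :
    ENNReal.ofReal |(L.restrictScalars ℝ).det| = ‖L.det‖ₑ ^ 2 := by
  have h : (L.restrictScalars ℝ).det = ‖L.det‖ ^ 2 := by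
    have := LinearMap.det_restrictScalars (R := ℝ) (S := ℂ) (A := Fin n → ℂ) (f := L.toLinearMap)
    rw [Algebra.norm_complex_apply, Complex.normSq_eq_norm_sq] at this
    exact this
  rw [h, abs_of_nonneg (by positivity), ← ofReal_norm, ENNReal.ofReal_pow (norm_nonneg _)]

theorem injOn_transition {n : ℕ} {M : Type*} [TopologicalSpace M]
    {φ φ' : OpenPartialHomeomorph M (Fin n → ℂ)} {A : Set (Fin n → ℂ)} (hA : A ⊆ φ.target)
    (hA' : A ⊆ φ.symm ⁻¹' φ'.source) : InjOn (φ' ∘ φ.symm) A := fun _ hz _ hw h =>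
  φ.symm.injOn (hA hz) (hA hw) (φ'.injOn (hA' hz) (hA' hw) h)

theorem hasFDerivWithinAt_transition (hφ : φ ∈ holCharts n M) (hφ' : φ' ∈ holCharts n M)
    {A : Set (Fin n → ℂ)} (hA : A ⊆ φ.target) (hA' : A ⊆ φ.symm ⁻¹' φ'.source) :
    ∀ z ∈ A, HasFDerivWithinAt (φ' ∘ φ.symm)
      ((fderiv ℂ (φ' ∘ φ.symm) z).restrictScalars ℝ) A z := fun _ hz =>
  (((differentiableOn_transition hφ hφ').differentiableAt
    ((isOpen_transition_domain φ φ').mem_nhds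
      ⟨hA hz, hA' hz⟩)).hasFDerivAt.restrictScalars ℝ).hasFDerivWithinAt

theorem measurableSet_image_transition (hφ : φ ∈ holCharts n M) (hφ' : φ' ∈ holCharts n M)
    {A : Set (Fin n → ℂ)} (hA : A ⊆ φ.target) (hA' : A ⊆ φ.symm ⁻¹' φ'.source)
    (hAm : MeasurableSet A) : MeasurableSet ((φ' ∘ φ.symm) '' A) :=
  measurable_image_of_fderivWithin hAm (hasFDerivWithinAt_transition hφ hφ' hA hA')
    (injOn_transition hA hA')

/-- The integral of the density `f ∧ f̄` over a piece of `M` does not depend on the chart. -/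
theorem lintegral_formCoeff_transition (f : NForm n M) (hφ : φ ∈ holCharts n M)
    (hφ' : φ' ∈ holCharts n M) {A : Set (Fin n → ℂ)} (hA : A ⊆ φ.target)
    (hA' : A ⊆ φ.symm ⁻¹' φ'.source) (hAm : MeasurableSet A) :
    ∫⁻ z in A, ‖formCoeff f φ z‖ₑ ^ 2 =
      ∫⁻ z in (φ' ∘ φ.symm) '' A, ‖formCoeff f φ' z‖ₑ ^ 2 := by
  rw [lintegral_image_eq_lintegral_abs_det_fderiv_mul volume hAm
    (hasFDerivWithinAt_transition hφ hφ' hA hA') (injOn_transition hA hA')]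
  refine setLIntegral_congr_fun hAm fun z hz => ?_
  rw [formCoeff_transition f hφ hφ' (hA hz) (hA' hz), ofReal_abs_det_restrictScalars,
    enorm_mul, mul_pow]
  rfl

/-- A countable family of holomorphic charts covering `M`. -/
structure ChartCover (n : ℕ) (M : Type*) [TopologicalSpace M] [ChartedSpace (Fin n → ℂ) M] where
  /-- The charts of the cover. -/
  chart : ℕ → OpenPartialHomeomorph M (Fin n → ℂ)
  mem : ∀ i, chart i ∈ holCharts n M
  cover : ⋃ i, (chart i).source = univ

theorem nonempty_chartCover [SecondCountableTopology M] [Nonempty M]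
    [IsManifold 𝓘(ℂ, Fin n → ℂ) ω M] : Nonempty (ChartCover n M) := by
  obtain ⟨s, hs, hcov⟩ := TopologicalSpace.countable_cover_nhds
    (f := fun x : M => (chartAt (Fin n → ℂ) x).source) (fun x => chart_source_mem_nhds _ x)
  have hne : s.Nonempty := by
    rw [nonempty_iff_ne_empty]
    rintro rfl
    simp only [mem_empty_iff_false, iUnion_of_empty, iUnion_empty] at hcov
    exact empty_ne_univ hcov
  obtain ⟨e, rfl⟩ := hs.exists_eq_range hne
  refine ⟨⟨fun i => chartAt _ (e i), fun i => chartAt_mem_holCharts _, ?_⟩⟩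
  rwa [biUnion_range] at hcov

namespace ChartCover

variable (P : ChartCover n M)

/-- The cells of the partition of `M` obtained by making the chart domains disjoint. -/
def cell (i : ℕ) : Set M := disjointed (fun i => (P.chart i).source) i

/-- The image of a cell in its chart. -/
def piece (i : ℕ) : Set (Fin n → ℂ) := (P.chart i).target ∩ (P.chart i).symm ⁻¹' P.cell i

theorem cell_subset (i : ℕ) : P.cell i ⊆ (P.chart i).source :=
  disjointed_subset (fun i => (P.chart i).source) i

theorem pairwise_disjoint_cell : Pairwise (Function.onFun Disjoint P.cell) :=
  disjoint_disjointed _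

theorem iUnion_cell : ⋃ i, P.cell i = univ := by
  rw [← P.cover]
  exact iUnion_disjointed

theorem symm_image_piece_subset (i : ℕ) : (P.chart i).symm '' P.piece i ⊆ P.cell i := by
  rintro _ ⟨z, hz, rfl⟩
  exact hz.2

theorem measurableSet_preimage_cell (ψ : OpenPartialHomeomorph M (Fin n → ℂ)) (i : ℕ) :
    MeasurableSet (ψ.target ∩ ψ.symm ⁻¹' P.cell i) := by
  have h : ψ.target ∩ ψ.symm ⁻¹' P.cell i = (ψ.target ∩ ψ.symm ⁻¹' (P.chart i).source) \
      (ψ.target ∩ ψ.symm ⁻¹' (⋃ j ∈ Finset.Iio i, (P.chart j).source)) := by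
    ext z
    simp only [cell, disjointed_apply, Finset.sup_set_eq_biUnion, mem_inter_iff,
      mem_preimage, Set.mem_sdiff]
    tauto
  rw [h]
  exact (ψ.isOpen_inter_preimage_symm (P.chart i).open_source).measurableSet.diff
    (ψ.isOpen_inter_preimage_symm
      (isOpen_biUnion fun j _ => (P.chart j).open_source)).measurableSet

theorem measurableSet_piece (i : ℕ) : MeasurableSet (P.piece i) :=
  P.measurableSet_preimage_cell _ i

/-- The supremum defining `normSq` is attained by any countable partition into chart pieces. -/
theorem normSq_eq (f : NForm n M) :
    normSq f = ∑' i, 2 ^ n * ∫⁻ z in P.piece i, ‖formCoeff f (P.chart i) z‖ₑ ^ 2 := by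
  apply le_antisymm
  · refine iSup_le fun N => iSup_le fun ψ => iSup_le fun A => iSup_le fun hA =>
      iSup_le fun hdisj => ?_
    have hAi : ∀ j i, A j ∩ (ψ j).symm ⁻¹' P.cell i =
        A j ∩ ((ψ j).target ∩ (ψ j).symm ⁻¹' P.cell i) := fun j i => by
      rw [← inter_assoc, inter_eq_left.2 (hA j).2.2]
    have hm : ∀ j i, MeasurableSet (A j ∩ (ψ j).symm ⁻¹' P.cell i) := fun j i => by
      rw [hAi]
      exact (hA j).2.1.inter (P.measurableSet_preimage_cell _ i)
    -- cut the pieces of the given family along the cells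
    have h1 : ∀ j, ∫⁻ z in A j, ‖formCoeff f (ψ j) z‖ₑ ^ 2 =
        ∑' i, ∫⁻ z in A j ∩ (ψ j).symm ⁻¹' P.cell i, ‖formCoeff f (ψ j) z‖ₑ ^ 2 := by
      intro j
      rw [← lintegral_iUnion (hm j)]
      · rw [← inter_iUnion, ← preimage_iUnion, P.iUnion_cell, preimage_univ, inter_univ]
      · intro i k hik
        exact ((P.pairwise_disjoint_cell hik).preimage _).mono inter_subset_right
          inter_subset_right
    -- transport them to the charts of the cells; the images `T j i`, for fixed `i`, are disjoint
    -- subsets of the `i`-th piece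
    set T : Fin N → ℕ → Set (Fin n → ℂ) := fun j i =>
      (P.chart i ∘ (ψ j).symm) '' (A j ∩ (ψ j).symm ⁻¹' P.cell i) with hT
    have hsub : ∀ j i, A j ∩ (ψ j).symm ⁻¹' P.cell i ⊆ (ψ j).target := fun j i =>
      inter_subset_left.trans (hA j).2.2
    have hsub' : ∀ j i, A j ∩ (ψ j).symm ⁻¹' P.cell i ⊆ (ψ j).symm ⁻¹' (P.chart i).source :=
      fun j i z hz => P.cell_subset i hz.2
    have h2 : ∀ j i, ∫⁻ z in A j ∩ (ψ j).symm ⁻¹' P.cell i, ‖formCoeff f (ψ j) z‖ₑ ^ 2 =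
        ∫⁻ z in T j i, ‖formCoeff f (P.chart i) z‖ₑ ^ 2 := fun j i =>
      lintegral_formCoeff_transition f (hA j).1 (P.mem i) (hsub j i) (hsub' j i) (hm j i)
    have hTm : ∀ j i, MeasurableSet (T j i) := fun j i =>
      measurableSet_image_transition (hA j).1 (P.mem i) (hsub j i) (hsub' j i) (hm j i)
    have hTsymm : ∀ j i, ∀ z ∈ T j i, z ∈ P.piece i ∧
        (P.chart i).symm z ∈ (ψ j).symm '' A j := by
      rintro j i _ ⟨w, hw, rfl⟩
      have hs := hsub' j i hw
      simp only [Function.comp_apply]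
      refine ⟨⟨(P.chart i).map_source hs, ?_⟩, ?_⟩
      · rw [mem_preimage, (P.chart i).left_inv hs]
        exact hw.2
      · rw [(P.chart i).left_inv hs]
        exact ⟨w, hw.1, rfl⟩
    have hTd : ∀ i, Pairwise (Function.onFun Disjoint fun j => T j i) := by
      intro i j k hjk
      rw [Function.onFun, disjoint_left]
      intro z hz hz'
      exact disjoint_left.1 (hdisj hjk) (hTsymm j i z hz).2 (hTsymm k i z hz').2
    simp_rw [h1, h2, ← ENNReal.tsum_mul_left]
    rw [← Summable.tsum_finsetSum (fun _ _ => ENNReal.summable)]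
    refine ENNReal.tsum_le_tsum fun i => ?_
    rw [← Finset.mul_sum]
    gcongr
    rw [← tsum_fintype (L := .unconditional _), ← lintegral_iUnion (fun j => hTm j i) (hTd i)]
    exact lintegral_mono_set (iUnion_subset fun j z hz => (hTsymm j i z hz).1)
  · rw [ENNReal.tsum_eq_iSup_nat]
    refine iSup_le fun N => ?_
    refine le_iSup_of_le N (le_iSup_of_le (fun i => P.chart i) (le_iSup_of_le (fun i => P.piece i)
      (le_iSup_of_le (fun i => ⟨P.mem i, P.measurableSet_piece i, inter_subset_left⟩)
        (le_iSup_of_le (fun i j hij => ?_) ?_))))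
    · exact (P.pairwise_disjoint_cell (fun h => hij (Fin.ext h))).mono
        (P.symm_image_piece_subset i) (P.symm_image_piece_subset j)
    · rw [← Fin.sum_univ_eq_sum_range
        (fun i => 2 ^ n * ∫⁻ z in P.piece i, ‖formCoeff f (P.chart i) z‖ₑ ^ 2)]

end ChartCover

end NormSq

/-! ### The Hilbert space `A²(M)` -/

section HilbertSpace

open Set Filter Topology MeasureTheory Metric

variable {n : ℕ} {M : Type*} [TopologicalSpace M] [ChartedSpace (Fin n → ℂ) M]
  {φ : OpenPartialHomeomorph M (Fin n → ℂ)}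

namespace ChartCover

variable (P : ChartCover n M)

/-- The measure on `ℕ × ℂⁿ`, a disjoint union of copies of `ℂⁿ`, which is `2ⁿ` times Lebesgue
measure on the `i`-th piece of the `i`-th copy. With respect to it `normSq` is an `L²` norm. -/
def measure : Measure (ℕ × (Fin n → ℂ)) :=
  Measure.sum fun i => (2 ^ n : ℝ≥0∞) • (volume.restrict (P.piece i)).map (Prod.mk i)

/-- The coefficients of an `n`-form on all pieces of the partition. -/
def coeff (f : NForm n M) (q : ℕ × (Fin n → ℂ)) : ℂ :=
  (P.piece q.1).indicator (formCoeff f (P.chart q.1)) q.2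

theorem coeff_add (f g : NForm n M) : P.coeff (f + g) = P.coeff f + P.coeff g := by
  funext q
  by_cases h : q.2 ∈ P.piece q.1 <;> simp [coeff, h, formCoeff_add]

theorem coeff_smul (c : ℂ) (f : NForm n M) : P.coeff (c • f) = c • P.coeff f := by
  funext q
  by_cases h : q.2 ∈ P.piece q.1 <;> simp [coeff, h, formCoeff_smul]

theorem lintegral_coeff (f : NForm n M) :
    ∫⁻ q, ‖P.coeff f q‖ₑ ^ 2 ∂P.measure = normSq f := by
  rw [measure, lintegral_sum_measure, P.normSq_eq]
  refine tsum_congr fun i => ?_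
  rw [lintegral_smul_measure, (measurableEmbedding_prodMk_left i).lintegral_map, smul_eq_mul]
  congr 1
  refine setLIntegral_congr_fun (P.measurableSet_piece i) fun z hz => ?_
  simp [coeff, hz]

theorem measurable_coeff {f : NForm n M} (hf : IsHolomorphicForm f) : Measurable (P.coeff f) := by
  refine measurable_from_prod_countable_right fun i => ?_
  have h1 : Measurable ((P.chart i).target.indicator (formCoeff f (P.chart i))) := by
    classical
    rw [← piecewise_eq_indicator]
    exact (hf _ (P.mem i)).continuousOn.measurable_piecewise continuousOn_const
      (P.chart i).open_target.measurableSet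
  have h2 : (fun z => P.coeff f (i, z)) =
      (P.piece i).indicator ((P.chart i).target.indicator (formCoeff f (P.chart i))) := by
    have h3 : P.piece i ⊆ (P.chart i).target := inter_subset_left
    rw [indicator_indicator, inter_eq_left.2 h3]
    rfl
  rw [h2]
  exact h1.indicator (P.measurableSet_piece i)

theorem eLpNorm_coeff_sq (f : NForm n M) : eLpNorm (P.coeff f) 2 P.measure ^ 2 = normSq f := by
  have h := eLpNorm_nnreal_pow_eq_lintegral (μ := P.measure) (f := P.coeff f) (p := 2) (by simp)
  rw [← P.lintegral_coeff f]
  simpa using h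

theorem memLp_coeff_iff {f : NForm n M} (hf : IsHolomorphicForm f) :
    MemLp (P.coeff f) 2 P.measure ↔ normSq f < ⊤ := by
  rw [← P.eLpNorm_coeff_sq f]
  refine ⟨fun h => ENNReal.pow_lt_top h.2, fun h =>
    ⟨(P.measurable_coeff hf).aestronglyMeasurable, ?_⟩⟩
  by_contra h'
  rw [not_lt, top_le_iff] at h'
  simp [h'] at h

end ChartCover

theorem IsHolomorphicForm.add {f g : NForm n M} (hf : IsHolomorphicForm f)
    (hg : IsHolomorphicForm g) : IsHolomorphicForm (f + g) :=
  fun φ hφ => (hf φ hφ).add (hg φ hφ)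

theorem IsHolomorphicForm.sub {f g : NForm n M} (hf : IsHolomorphicForm f)
    (hg : IsHolomorphicForm g) : IsHolomorphicForm (f - g) :=
  fun φ hφ => (hf φ hφ).sub (hg φ hφ)

theorem IsHolomorphicForm.smul {f : NForm n M} (c : ℂ) (hf : IsHolomorphicForm f) :
    IsHolomorphicForm (c • f) :=
  fun φ hφ => (hf φ hφ).const_smul c

/-- The sub-mean value inequality for the density of a form. -/
theorem volume_ball_mul_enorm_formCoeff_sq_le {f : NForm n M} (hf : IsHolomorphicForm f)
    (hφ : φ ∈ holCharts n M) {z : Fin n → ℂ} {r : ℝ} (hr : ball z r ⊆ φ.target) :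
    2 ^ n * volume (ball z r) * ‖formCoeff f φ z‖ₑ ^ 2 ≤ normSq f := by
  rw [mul_assoc]
  refine (mul_le_mul_right (volume_ball_mul_enorm_sq_le ((hf φ hφ).mono hr)) _).trans ?_
  refine le_iSup_of_le 1 (le_iSup_of_le (fun _ => φ) (le_iSup_of_le (fun _ => ball z r)
      (le_iSup_of_le (fun i => ⟨hφ, measurableSet_ball, hr⟩)
        (le_iSup_of_le (fun i j hij => absurd (Subsingleton.elim i j) hij) ?_))))
  simp

/-- Point evaluations of square-integrable holomorphic forms are locally uniformly bounded. -/
theorem exists_norm_formCoeff_le (hφ : φ ∈ holCharts n M) {a : Fin n → ℂ} (ha : a ∈ φ.target) :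
    ∃ r > 0, ∃ C : ℝ, ball a r ⊆ φ.target ∧ ∀ f ∈ A2 n M, ∀ z ∈ ball a r,
      ‖formCoeff f φ z‖ ≤ C * Real.sqrt (normSq f).toReal := by
  -- apply the sub-mean value inequality on the balls of radius `R / 2` around the points of
  -- `ball a (R / 2)`, which all have the same volume
  obtain ⟨R, hR, hsub⟩ := Metric.mem_nhds_iff.1 (φ.open_target.mem_nhds ha)
  set V : ℝ≥0∞ := 2 ^ n * volume (ball (0 : Fin n → ℂ) (R / 2)) with hV
  have hV0 : V ≠ 0 := mul_ne_zero (by simp) (measure_ball_pos _ _ (by positivity)).ne'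
  have hVt : V ≠ ⊤ := ENNReal.mul_ne_top (by simp) measure_ball_lt_top.ne
  have hVpos : 0 < V.toReal := ENNReal.toReal_pos hV0 hVt
  refine ⟨R / 2, by positivity, Real.sqrt V.toReal⁻¹,
    (ball_subset_ball (by linarith)).trans hsub, fun f hf z hz => ?_⟩
  have h := volume_ball_mul_enorm_formCoeff_sq_le hf.1 hφ (z := z) (r := R / 2)
    ((ball_subset_ball' (by rw [mem_ball] at hz; linarith)).trans hsub)
  rw [Measure.addHaar_ball_center, ← hV] at h
  have h2 := ENNReal.toReal_mono hf.2.ne h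
  rw [ENNReal.toReal_mul, ENNReal.toReal_pow, toReal_enorm] at h2
  rw [← Real.sqrt_mul (by positivity)]
  refine Real.le_sqrt_of_sq_le ?_
  rw [← div_eq_inv_mul, le_div_iff₀ hVpos]
  linarith

variable [IsManifold 𝓘(ℂ, Fin n → ℂ) ω M]

theorem eq_zero_of_normSq_eq_zero {f : NForm n M} (hf : IsHolomorphicForm f)
    (h : normSq f = 0) : f = 0 := by
  refine nform_ext fun x => ?_
  have hx : x ∈ (chartAt (Fin n → ℂ) x).source := mem_chart_source _ x
  obtain ⟨r, hr, C, -, hC⟩ := exists_norm_formCoeff_le (chartAt_mem_holCharts (n := n) x)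
    ((chartAt (Fin n → ℂ) x).map_source hx)
  have h1 := hC f ⟨hf, by simp [h]⟩ _ (mem_ball_self hr)
  rw [h] at h1
  simp only [ENNReal.toReal_zero, Real.sqrt_zero, mul_zero, norm_le_zero_iff] at h1
  rw [formCoeff_eq, (chartAt (Fin n → ℂ) x).left_inv hx, mul_eq_zero] at h1
  exact h1.resolve_left (chartJac_ne_zero (chartAt_mem_holCharts x) hx)

variable [SecondCountableTopology M] [Nonempty M]

variable (n M) in
/-- `A²(M)` as a complex vector space. -/
def bergmanForms : Submodule ℂ (NForm n M) where
  carrier := A2 n M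
  add_mem' {f g} hf hg := by
    obtain ⟨P⟩ := nonempty_chartCover (n := n) (M := M)
    refine ⟨hf.1.add hg.1, (P.memLp_coeff_iff (hf.1.add hg.1)).1 ?_⟩
    rw [P.coeff_add]
    exact ((P.memLp_coeff_iff hf.1).2 hf.2).add ((P.memLp_coeff_iff hg.1).2 hg.2)
  zero_mem' := by
    obtain ⟨P⟩ := nonempty_chartCover (n := n) (M := M)
    have h0 : IsHolomorphicForm (0 : NForm n M) := fun φ _ => differentiableOn_const 0
    refine ⟨h0, ?_⟩
    rw [← P.lintegral_coeff]
    have h1 : P.coeff (0 : NForm n M) = 0 := by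
      funext q
      exact indicator_apply_eq_zero.2 fun _ => formCoeff_zero _ _
    simp [h1]
  smul_mem' c {f} hf := by
    obtain ⟨P⟩ := nonempty_chartCover (n := n) (M := M)
    refine ⟨hf.1.smul c, (P.memLp_coeff_iff (hf.1.smul c)).1 ?_⟩
    rw [P.coeff_smul]
    exact ((P.memLp_coeff_iff hf.1).2 hf.2).const_smul c

variable (n M) in
/-- An inner product space `E` together with an identification `A²(M) ≃ E` under which `normSq`
becomes the squared norm. -/
structure HilbertModel (E : Type*) [NormedAddCommGroup E] [InnerProductSpace ℂ E] where
  /-- The identification of `A²(M)` with `E`. -/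
  equiv : bergmanForms n M ≃ₗ[ℂ] E
  norm_sq : ∀ f, ‖equiv f‖ ^ 2 = (normSq (f : NForm n M)).toReal

/-- The isometric embedding of `A²(M)` into an `L²` space. -/
def ChartCover.toLp (P : ChartCover n M) : bergmanForms n M →ₗ[ℂ] Lp ℂ 2 P.measure where
  toFun f := ((P.memLp_coeff_iff f.2.1).2 f.2.2).toLp (P.coeff f)
  map_add' f g := by
    rw [← MemLp.toLp_add]
    congr 1
    exact P.coeff_add f g
  map_smul' c f := by
    rw [RingHom.id_apply, ← MemLp.toLp_const_smul]
    congr 1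
    exact P.coeff_smul c f

theorem ChartCover.norm_toLp_sq (P : ChartCover n M) (f : bergmanForms n M) :
    ‖P.toLp f‖ ^ 2 = (normSq (f : NForm n M)).toReal := by
  rw [← P.eLpNorm_coeff_sq, ENNReal.toReal_pow]
  exact congrArg (· ^ 2) (Lp.norm_toLp _ ((P.memLp_coeff_iff f.2.1).2 f.2.2))

theorem ChartCover.toLp_injective (P : ChartCover n M) : Function.Injective P.toLp := by
  rw [injective_iff_map_eq_zero]
  intro f hf
  have h := P.norm_toLp_sq f
  rw [hf, norm_zero, zero_pow two_ne_zero, eq_comm, ENNReal.toReal_eq_zero_iff] at h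
  exact Subtype.ext (eq_zero_of_normSq_eq_zero f.2.1 (h.resolve_right f.2.2.ne))

/-- The image of `A²(M)` in `L²` is a model of `A²(M)`. -/
def ChartCover.hilbertModel (P : ChartCover n M) : HilbertModel n M (LinearMap.range P.toLp) where
  equiv := LinearEquiv.ofInjective P.toLp P.toLp_injective
  norm_sq f := P.norm_toLp_sq f

variable (n M) in
/-- `A²(M)` carries the structure of an inner product space whose norm is given by `normSq`. -/
theorem exists_hilbertModel : ∃ (E : Type) (_ : NormedAddCommGroup E)
    (_ : InnerProductSpace ℂ E), Nonempty (HilbertModel n M E) := by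
  obtain ⟨P⟩ := nonempty_chartCover (n := n) (M := M)
  exact ⟨_, _, _, ⟨P.hilbertModel⟩⟩

namespace HilbertModel

variable {E : Type*} [NormedAddCommGroup E] [InnerProductSpace ℂ E] (H : HilbertModel n M E)

/-- The `n`-form corresponding to a vector. -/
def form (v : E) : NForm n M := (H.equiv.symm v : bergmanForms n M)

theorem form_mem (v : E) : H.form v ∈ A2 n M := (H.equiv.symm v).2

theorem form_add (v w : E) : H.form (v + w) = H.form v + H.form w := by
  simp [form]

theorem form_sub (v w : E) : H.form (v - w) = H.form v - H.form w := by
  simp [form]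

theorem form_smul (c : ℂ) (v : E) : H.form (c • v) = c • H.form v := by
  simp [form]

theorem normSq_form (v : E) : (normSq (H.form v)).toReal = ‖v‖ ^ 2 := by
  rw [form, ← H.norm_sq, H.equiv.apply_symm_apply]

theorem normSq_form' (v : E) : normSq (H.form v) = ENNReal.ofReal (‖v‖ ^ 2) := by
  rw [← H.normSq_form, ENNReal.ofReal_toReal (H.form_mem v).2.ne]

theorem exists_form_eq {f : NForm n M} (hf : f ∈ A2 n M) : ∃ v, H.form v = f :=
  ⟨H.equiv ⟨f, hf⟩, by simp [form]⟩

theorem form_injective : Function.Injective H.form :=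
  Subtype.val_injective.comp H.equiv.symm.injective

/-- The polarized form of `normSq` is the inner product. -/
theorem innerA2_form (v w : E) : innerA2 (H.form v) (H.form w) = inner ℂ w v := by
  have h : ∀ k : ℕ, ((normSq (H.form v + (Complex.I ^ k : ℂ) • H.form w)).toReal : ℂ) =
      (‖v + (Complex.I ^ k : ℂ) • w‖ : ℂ) ^ 2 := by
    intro k
    rw [← H.form_smul, ← H.form_add, H.normSq_form]
    push_cast
    rfl
  have h3 : v + (-Complex.I : ℂ) • w = v - Complex.I • w := by
    rw [neg_smul, sub_eq_add_neg]
  have h2 : v + (-1 : ℂ) • w = v - w := by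
    rw [neg_smul, one_smul, sub_eq_add_neg]
  rw [innerA2, ← inner_conj_symm w v, inner_eq_sum_norm_sq_div_four v w]
  simp only [Finset.sum_range_succ, Finset.sum_range_zero, h, pow_zero, one_smul, pow_one,
    RCLike.I_to_complex, Complex.I_pow_three, Complex.I_sq, h3, h2]
  simp only [map_div₀, map_add, map_sub, map_mul, map_pow, Complex.conj_ofReal, Complex.conj_I,
    Complex.coe_algebraMap, map_ofNat]
  ring

include H in
/-- `A²(M)` is complete: a Cauchy sequence converges locally uniformly in every chart, the limit is
holomorphic, and Fatou's lemma gives convergence in norm. -/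
theorem completeSpace : CompleteSpace E := by
  obtain ⟨P⟩ := nonempty_chartCover (n := n) (M := M)
  refine Metric.complete_of_cauchySeq_tendsto fun u hu => ?_
  rw [Metric.cauchySeq_iff] at hu
  have hdiff : ∀ m k φ z, formCoeff (H.form (u m)) φ z - formCoeff (H.form (u k)) φ z =
      formCoeff (H.form (u m - u k)) φ z := fun m k φ z => by
    rw [H.form_sub, formCoeff_sub]
  have hunif : ∀ φ ∈ holCharts n M, ∀ a ∈ φ.target, ∃ r > 0, ball a r ⊆ φ.target ∧
      UniformCauchySeqOn (fun k => formCoeff (H.form (u k)) φ) atTop (ball a r) := by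
    intro φ hφ a ha
    obtain ⟨r, hr, C, hsub, hC⟩ := exists_norm_formCoeff_le hφ ha
    refine ⟨r, hr, hsub, ?_⟩
    rw [Metric.uniformCauchySeqOn_iff]
    intro ε hε
    obtain ⟨N, hN⟩ := hu (ε / (|C| + 1)) (by positivity)
    refine ⟨N, fun m hm k hk z hz => ?_⟩
    have h1 := hC _ (H.form_mem (u m - u k)) z hz
    have h2 := hN m hm k hk
    rw [dist_eq_norm] at h2 ⊢
    rw [hdiff]
    rw [H.normSq_form, Real.sqrt_sq (norm_nonneg _)] at h1
    rw [lt_div_iff₀ (by positivity)] at h2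
    nlinarith [norm_nonneg (u m - u k), le_abs_self C]
  have hc : ∀ x : M, ∃ c : ℂ, Tendsto (fun k => refCoeff (H.form (u k)) x) atTop (𝓝 c) := by
    intro x
    have hx : x ∈ (chartAt (Fin n → ℂ) x).source := mem_chart_source _ x
    obtain ⟨r, hr, -, h⟩ := hunif _ (chartAt_mem_holCharts x)
      _ ((chartAt (Fin n → ℂ) x).map_source hx)
    obtain ⟨c, hc⟩ := cauchySeq_tendsto_of_complete (h.cauchySeq (mem_ball_self hr))
    refine ⟨(chartJac (chartAt (Fin n → ℂ) x) x)⁻¹ * c, (hc.const_mul _).congr fun k => ?_⟩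
    rw [formCoeff_eq, (chartAt (Fin n → ℂ) x).left_inv hx,
      inv_mul_cancel_left₀ (chartJac_ne_zero (chartAt_mem_holCharts x) hx)]
  choose c hc using hc
  -- the limit form, defined through its pointwise coefficients
  set g : NForm n M := nformOfRefCoeff c with hg
  have hlim : ∀ φ z, Tendsto (fun k => formCoeff (H.form (u k)) φ z) atTop
      (𝓝 (formCoeff g φ z)) := by
    intro φ z
    simp only [formCoeff_eq, hg, refCoeff_nformOfRefCoeff]
    exact (hc _).const_mul _
  have hgh : IsHolomorphicForm g := by
    intro φ hφ a ha
    obtain ⟨r, hr, hsub, h⟩ := hunif φ hφ a ha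
    exact (differentiableAt_of_uniformCauchySeqOn hr
      (fun k => ((H.form_mem (u k)).1 φ hφ).mono hsub) h
      (fun z _ => hlim φ z)).differentiableWithinAt
  have hbound : ∀ ε > 0, ∃ N, ∀ k ≥ N, normSq (g - H.form (u k)) ≤ ENNReal.ofReal (ε ^ 2) := by
    intro ε hε
    obtain ⟨N, hN⟩ := hu ε hε
    refine ⟨N, fun k hk => ?_⟩
    have hlim' : ∀ q, Tendsto (fun m => ‖P.coeff (H.form (u m) - H.form (u k)) q‖ₑ ^ 2) atTop
        (𝓝 (‖P.coeff (g - H.form (u k)) q‖ₑ ^ 2)) := by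
      intro q
      refine ((ENNReal.continuous_pow 2).tendsto _).comp
        ((continuous_enorm.tendsto _).comp ?_)
      by_cases hq : q.2 ∈ P.piece q.1
      · simp only [ChartCover.coeff, indicator_of_mem hq, formCoeff_sub]
        exact (hlim _ _).sub_const _
      · simp only [ChartCover.coeff, indicator_of_notMem hq]
        exact tendsto_const_nhds
    rw [← P.lintegral_coeff]
    calc ∫⁻ q, ‖P.coeff (g - H.form (u k)) q‖ₑ ^ 2 ∂P.measure
        = ∫⁻ q, liminf (fun m => ‖P.coeff (H.form (u m) - H.form (u k)) q‖ₑ ^ 2) atTop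
            ∂P.measure := lintegral_congr fun q => (hlim' q).liminf_eq.symm
      _ ≤ liminf (fun m => ∫⁻ q, ‖P.coeff (H.form (u m) - H.form (u k)) q‖ₑ ^ 2 ∂P.measure)
            atTop := by
          refine lintegral_liminf_le fun m => ?_
          exact (P.measurable_coeff
            ((H.form_mem (u m)).1.sub (H.form_mem (u k)).1)).enorm.pow_const 2
      _ ≤ ENNReal.ofReal (ε ^ 2) := by
          refine liminf_le_of_frequently_le' (Eventually.frequently ?_)
          filter_upwards [eventually_ge_atTop N] with m hm
          rw [P.lintegral_coeff, ← H.form_sub, H.normSq_form']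
          have := hN m hm k hk
          rw [dist_eq_norm] at this
          gcongr
  obtain ⟨N₀, hN₀⟩ := hbound 1 one_pos
  have hgA : g ∈ A2 n M := by
    have h1 : g - H.form (u N₀) ∈ bergmanForms n M :=
      ⟨hgh.sub (H.form_mem _).1, (hN₀ N₀ le_rfl).trans_lt ENNReal.ofReal_lt_top⟩
    -- `g` is the sum of a term of the sequence and a form of finite norm
    have := (bergmanForms n M).add_mem h1 (H.form_mem (u N₀))
    rwa [sub_add_cancel] at this
  obtain ⟨v, hv⟩ := H.exists_form_eq hgA
  refine ⟨v, Metric.tendsto_atTop.2 fun ε hε => ?_⟩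
  obtain ⟨N, hN⟩ := hbound (ε / 2) (by positivity)
  refine ⟨N, fun k hk => ?_⟩
  have h1 := hN k hk
  rw [← hv, ← H.form_sub, H.normSq_form', ENNReal.ofReal_le_ofReal_iff (by positivity)] at h1
  rw [dist_comm, dist_eq_norm]
  rw [sq_le_sq₀ (norm_nonneg _) (by positivity)] at h1
  linarith

end HilbertModel

end HilbertSpace

/-! ### Wirtinger derivatives -/

section Wirtinger

open Filter Topology

variable {n : ℕ} {F : (Fin n → ℂ) → ℂ} {z : Fin n → ℂ}

/-- For a complex differentiable function `∂/∂z_j` is the complex partial derivative. -/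
theorem wirtinger_eq_fderiv (hF : DifferentiableAt ℂ F z) (j : Fin n) :
    wirtinger j F z = fderiv ℂ F z (Pi.single j 1) := by
  have hI : (Pi.single j Complex.I : Fin n → ℂ) = Complex.I • Pi.single j 1 := by
    rw [← Pi.single_smul, smul_eq_mul, mul_one]
  rw [wirtinger, hF.fderiv_restrictScalars ℝ, ContinuousLinearMap.coe_restrictScalars', hI,
    map_smul, smul_eq_mul, ← mul_assoc, Complex.I_mul_I]
  ring

theorem wirtingerBar_conj (hF : DifferentiableAt ℂ F z) (k : Fin n) :
    wirtingerBar k (fun v => conj (F v)) z = conj (fderiv ℂ F z (Pi.single k 1)) := by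
  have hI : (Pi.single k Complex.I : Fin n → ℂ) = Complex.I • Pi.single k 1 := by
    rw [← Pi.single_smul, smul_eq_mul, mul_one]
  have h : HasFDerivAt (fun v => conj (F v))
      ((Complex.conjCLE : ℂ →L[ℝ] ℂ).comp ((fderiv ℂ F z).restrictScalars ℝ)) z :=
    (Complex.conjCLE : ℂ →L[ℝ] ℂ).hasFDerivAt.comp z (hF.hasFDerivAt.restrictScalars ℝ)
  rw [wirtingerBar, h.fderiv, hI]
  simp only [ContinuousLinearMap.comp_apply, ContinuousLinearMap.coe_restrictScalars', map_smul,
    smul_eq_mul, ContinuousLinearEquiv.coe_coe, Complex.conjCLE_apply, map_mul, Complex.conj_I]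
  linear_combination (-(1 / 2) * conj (fderiv ℂ F z (Pi.single k 1))) * Complex.I_mul_I

theorem wirtinger_congr {G : (Fin n → ℂ) → ℂ} (h : F =ᶠ[𝓝 z] G) (j : Fin n) :
    wirtinger j F z = wirtinger j G z := by
  rw [wirtinger, wirtinger, h.fderiv_eq]

theorem wirtingerBar_congr {G : (Fin n → ℂ) → ℂ} (h : F =ᶠ[𝓝 z] G) (k : Fin n) :
    wirtingerBar k F z = wirtingerBar k G z := by
  rw [wirtingerBar, wirtingerBar, h.fderiv_eq]

end Wirtinger

/-! ### The reproducing kernel -/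

section Kernel

open Set Filter Topology Metric

variable {n : ℕ} {M : Type*} [TopologicalSpace M] [ChartedSpace (Fin n → ℂ) M]
  {φ φ' ψ ψ' : OpenPartialHomeomorph M (Fin n → ℂ)}
  [IsManifold 𝓘(ℂ, Fin n → ℂ) ω M] [SecondCountableTopology M] [Nonempty M]

namespace HilbertModel

variable {E : Type*} [NormedAddCommGroup E] [InnerProductSpace ℂ E] (H : HilbertModel n M E)

/-- A bounded linear functional on `A²(M)` is represented by a vector. -/
theorem exists_rep (L : NForm n M → ℂ) (C : ℝ) (hadd : ∀ v w, L (H.form v + H.form w) =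
      L (H.form v) + L (H.form w)) (hsmul : ∀ (c : ℂ) v, L (c • H.form v) = c * L (H.form v))
    (hC : ∀ v, ‖L (H.form v)‖ ≤ C * ‖v‖) : ∃ k : E, ∀ v, L (H.form v) = inner ℂ k v := by
  have := H.completeSpace
  set T : E →ₗ[ℂ] ℂ :=
    { toFun := fun v => L (H.form v)
      map_add' := fun v w => by rw [H.form_add, hadd]
      map_smul' := fun c v => by rw [H.form_smul, hsmul]; rfl } with hT
  refine ⟨(InnerProductSpace.toDual ℂ E).symm (T.mkContinuous C hC), fun v => ?_⟩
  rw [InnerProductSpace.toDual_symm_apply]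
  rfl

/-- The functional `f ↦ f*(z)` on `A²(M)` is represented by a vector. -/
theorem exists_eval_rep (hφ : φ ∈ holCharts n M) {z : Fin n → ℂ} (hz : z ∈ φ.target) :
    ∃ k : E, ∀ v, formCoeff (H.form v) φ z = inner ℂ k v := by
  obtain ⟨r, hr, C, -, hC⟩ := exists_norm_formCoeff_le hφ hz
  refine H.exists_rep (fun f => formCoeff f φ z) C (fun v w => rfl) (fun c v => rfl) fun v => ?_
  have := hC _ (H.form_mem v) z (mem_ball_self hr)
  rwa [H.normSq_form, Real.sqrt_sq (norm_nonneg _)] at this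

/-- The functional `f ↦ ∂f*/∂e (z)` on `A²(M)` is represented by a vector: it is bounded by the
Cauchy estimate. -/
theorem exists_fderiv_rep (hφ : φ ∈ holCharts n M) {z : Fin n → ℂ} (hz : z ∈ φ.target)
    (e : Fin n → ℂ) : ∃ k : E, ∀ v, fderiv ℂ (formCoeff (H.form v) φ) z e = inner ℂ k v := by
  obtain ⟨r, hr, C, hsub, hC⟩ := exists_norm_formCoeff_le hφ hz
  have hd : ∀ v, DifferentiableAt ℂ (formCoeff (H.form v) φ) z := fun v =>
    ((H.form_mem v).1 φ hφ).differentiableAt (φ.open_target.mem_nhds hz)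
  refine H.exists_rep (fun f => fderiv ℂ (formCoeff f φ) z e) (2 * C / r * ‖e‖) (fun v w => ?_)
    (fun c v => ?_) fun v => ?_
  · change fderiv ℂ (formCoeff (H.form v) φ + formCoeff (H.form w) φ) z e = _
    rw [fderiv_add (hd v) (hd w)]
    rfl
  · change fderiv ℂ (c • formCoeff (H.form v) φ) z e = _
    rw [fderiv_const_smul (hd v)]
    rfl
  · have h1 := norm_fderiv_le_of_norm_le (C := C * ‖v‖) hr
      (((H.form_mem v).1 φ hφ).mono hsub) (fun w hw => by
        have := hC _ (H.form_mem v) w hw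
        rwa [H.normSq_form, Real.sqrt_sq (norm_nonneg _)] at this)
    calc ‖fderiv ℂ (formCoeff (H.form v) φ) z e‖
        ≤ ‖fderiv ℂ (formCoeff (H.form v) φ) z‖ * ‖e‖ := ContinuousLinearMap.le_opNorm _ _
      _ ≤ 2 * (C * ‖v‖) / r * ‖e‖ := by gcongr
      _ = 2 * C / r * ‖e‖ * ‖v‖ := by ring

/-- Parseval's identity for an orthonormal basis of `A²(M)`: the kernel is the inner product of the
vectors representing the two point evaluations. -/
theorem tsum_eq_inner {S : Set (NForm n M)} (hS : IsOrthonormalBasis S) {z w : Fin n → ℂ} {k l : E}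
    (hk : ∀ v, formCoeff (H.form v) φ z = inner ℂ k v)
    (hl : ∀ v, formCoeff (H.form v) ψ w = inner ℂ l v) :
    ∑' s : S, formCoeff (s : NForm n M) φ z * conj (formCoeff (s : NForm n M) ψ w) =
      inner ℂ k l := by
  have := H.completeSpace
  have hex : ∀ s : S, ∃ v, H.form v = s := fun s => H.exists_form_eq (hS.subset s.2)
  choose b hb using hex
  have horth : Orthonormal ℂ b := by
    refine ⟨fun s => ?_, fun s t hst => ?_⟩
    · have h := hS.norm_one s s.2
      rw [← hb, H.innerA2_form, inner_self_eq_norm_sq_to_K] at h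
      have h' : ‖b s‖ ^ 2 = 1 := Complex.ofReal_injective (by rw [Complex.ofReal_one, ← h]; simp)
      exact (pow_eq_one_iff_of_nonneg (norm_nonneg _) two_ne_zero).1 h'
    · have h := hS.orthogonal t t.2 s s.2 (fun h => hst (Subtype.ext h.symm))
      rwa [← hb, ← hb, H.innerA2_form] at h
  have hcompl : (Submodule.span ℂ (Set.range b))ᗮ = ⊥ := by
    refine (Submodule.eq_bot_iff _).2 fun v hv => ?_
    have h0 : H.form v = 0 := by
      refine hS.complete _ (H.form_mem v) fun g hg => ?_
      have := (Submodule.mem_orthogonal _ v).1 hv (b ⟨g, hg⟩)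
        (Submodule.subset_span (mem_range_self _))
      rw [← H.innerA2_form, hb] at this
      exact this
    refine H.form_injective (h0.trans ?_)
    rw [← sub_self (0 : E), H.form_sub, sub_self]
  have h := (HilbertBasis.mkOfOrthogonalEqBot horth hcompl).tsum_inner_mul_inner k l
  rw [HilbertBasis.coe_mkOfOrthogonalEqBot] at h
  rw [← h]
  refine tsum_congr fun s => ?_
  rw [← hb, hk, hl, inner_conj_symm]

include H in
theorem exists_isOrthonormalBasis : ∃ S : Set (NForm n M), IsOrthonormalBasis S := by
  have := H.completeSpace
  obtain ⟨w, b, hb⟩ := exists_hilbertBasis ℂ E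
  have horth := b.orthonormal
  refine ⟨range fun i => H.form (b i), ?_, ?_, ?_, ?_⟩
  · rintro _ ⟨i, rfl⟩
    exact H.form_mem _
  · rintro _ ⟨i, rfl⟩
    rw [H.innerA2_form, inner_self_eq_norm_sq_to_K, horth.1 i]
    simp
  · rintro _ ⟨i, rfl⟩ _ ⟨j, rfl⟩ hij
    rw [H.innerA2_form]
    exact horth.2 fun h => hij (by simp [h])
  · intro f hf h
    obtain ⟨v, rfl⟩ := H.exists_form_eq hf
    have hv : v = 0 := by
      apply b.repr.injective
      ext i
      have := h _ ⟨i, rfl⟩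
      rw [H.innerA2_form] at this
      rw [HilbertBasis.repr_apply_apply, this]
      simp
    rw [hv, ← sub_self (0 : E), H.form_sub, sub_self]

theorem kernel_eq_inner {z w : Fin n → ℂ} {k l : E}
    (hk : ∀ v, formCoeff (H.form v) φ z = inner ℂ k v)
    (hl : ∀ v, formCoeff (H.form v) ψ w = inner ℂ l v) : kernel φ ψ z w = inner ℂ k l := by
  rw [kernel, dif_pos H.exists_isOrthonormalBasis]
  exact H.tsum_eq_inner H.exists_isOrthonormalBasis.choose_spec hk hl

end HilbertModel

/-- The kernel does not depend on the orthonormal basis. -/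
theorem kernel_eq_tsum {S : Set (NForm n M)} (hS : IsOrthonormalBasis S) (hφ : φ ∈ holCharts n M)
    (hψ : ψ ∈ holCharts n M) {z w : Fin n → ℂ} (hz : z ∈ φ.target) (hw : w ∈ ψ.target) :
    kernel φ ψ z w =
      ∑' s : S, formCoeff (s : NForm n M) φ z * conj (formCoeff (s : NForm n M) ψ w) := by
  obtain ⟨E, _, _, ⟨H⟩⟩ := exists_hilbertModel n M
  obtain ⟨k, hk⟩ := H.exists_eval_rep hφ hz
  obtain ⟨l, hl⟩ := H.exists_eval_rep hψ hw
  rw [H.kernel_eq_inner hk hl, H.tsum_eq_inner hS hk hl]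

theorem exists_isOrthonormalBasis : ∃ S : Set (NForm n M), IsOrthonormalBasis S := by
  obtain ⟨E, _, _, ⟨H⟩⟩ := exists_hilbertModel n M
  exact H.exists_isOrthonormalBasis

/-- The kernel is hermitian. -/
theorem conj_kernel (hφ : φ ∈ holCharts n M) (hψ : ψ ∈ holCharts n M) {z w : Fin n → ℂ}
    (hz : z ∈ φ.target) (hw : w ∈ ψ.target) : conj (kernel φ ψ z w) = kernel ψ φ w z := by
  obtain ⟨E, _, _, ⟨H⟩⟩ := exists_hilbertModel n M
  obtain ⟨k, hk⟩ := H.exists_eval_rep hφ hz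
  obtain ⟨l, hl⟩ := H.exists_eval_rep hψ hw
  rw [H.kernel_eq_inner hk hl, H.kernel_eq_inner hl hk, inner_conj_symm]

/-- For fixed second argument, the kernel and its first antiholomorphic derivatives in the second
argument are coefficients of holomorphic forms: those representing the functionals `f ↦ f*(w)` and
`f ↦ ∂f*/∂w_k (w)` on `A²(M)`. -/
theorem exists_kernel_forms (hψ : ψ ∈ holCharts n M) {w : Fin n → ℂ} (hw : w ∈ ψ.target) :
    ∃ (h₀ : NForm n M) (h : Fin n → NForm n M), IsHolomorphicForm h₀ ∧
      (∀ k, IsHolomorphicForm (h k)) ∧ ∀ φ ∈ holCharts n M, ∀ z ∈ φ.target,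
        kernel φ ψ z w = formCoeff h₀ φ z ∧
        ∀ k, wirtingerBar k (fun v => kernel φ ψ z v) w = formCoeff (h k) φ z := by
  obtain ⟨E, _, _, ⟨H⟩⟩ := exists_hilbertModel n M
  obtain ⟨l, hl⟩ := H.exists_eval_rep hψ hw
  choose d hd using fun k : Fin n => H.exists_fderiv_rep hψ hw (Pi.single k 1)
  refine ⟨H.form l, fun k => H.form (d k), (H.form_mem _).1, fun k => (H.form_mem _).1,
    fun φ hφ z hz => ?_⟩
  obtain ⟨m, hm⟩ := H.exists_eval_rep hφ hz
  refine ⟨by rw [H.kernel_eq_inner hm hl, hm], fun k => ?_⟩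
  have hev : (fun v => kernel φ ψ z v) =ᶠ[𝓝 w] fun v => conj (formCoeff (H.form m) ψ v) := by
    filter_upwards [ψ.open_target.mem_nhds hw] with v hv
    obtain ⟨l', hl'⟩ := H.exists_eval_rep hψ hv
    rw [H.kernel_eq_inner hm hl', hl', inner_conj_symm]
  rw [wirtingerBar_congr hev, wirtingerBar_conj
    (((H.form_mem m).1 ψ hψ).differentiableAt (ψ.open_target.mem_nhds hw)), hd, inner_conj_symm,
    hm]

theorem kernel_transition_left (hφ : φ ∈ holCharts n M) (hφ' : φ' ∈ holCharts n M)
    (hψ : ψ ∈ holCharts n M) {z w : Fin n → ℂ} (hz : z ∈ φ.target) (hz' : φ.symm z ∈ φ'.source)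
    (hw : w ∈ ψ.target) :
    kernel φ ψ z w = (fderiv ℂ (φ' ∘ φ.symm) z).det * kernel φ' ψ (φ' (φ.symm z)) w := by
  obtain ⟨h₀, h, -, -, hk⟩ := exists_kernel_forms hψ hw
  rw [(hk φ hφ z hz).1, (hk φ' hφ' _ (φ'.map_source hz')).1, formCoeff_transition h₀ hφ hφ' hz hz']

theorem kernel_transition_right (hφ : φ ∈ holCharts n M) (hψ : ψ ∈ holCharts n M)
    (hψ' : ψ' ∈ holCharts n M) {z w : Fin n → ℂ} (hz : z ∈ φ.target) (hw : w ∈ ψ.target)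
    (hw' : ψ.symm w ∈ ψ'.source) : kernel φ ψ z w =
      conj (fderiv ℂ (ψ' ∘ ψ.symm) w).det * kernel φ ψ' z (ψ' (ψ.symm w)) := by
  rw [← conj_kernel hψ hφ hw hz, kernel_transition_left hψ hψ' hφ hw hw' hz, map_mul,
    conj_kernel hψ' hφ (ψ'.map_source hw') hz]

end Kernel

/-! ### Bochner's representative coordinates -/

section BochnerCoordinates

open Set Filter Topology

variable {n : ℕ} {M : Type*} [TopologicalSpace M] [ChartedSpace (Fin n → ℂ) M]
  {φ φ' ψ ψ' : OpenPartialHomeomorph M (Fin n → ℂ)} {p x : M}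

/-- Bochner's representative coordinates `u_k(x) = ∂ log K*(x, w̄) / ∂w̄_k` at `w = p`, formed with
a chart `ψ` around `p`. As a quotient of two `n`-forms in `x`, they do not depend on a chart around
`x`. -/
def bochnerCoord (ψ : OpenPartialHomeomorph M (Fin n → ℂ)) (p x : M) : Fin n → ℂ := fun k =>
  wirtingerBar k (fun v => kernel (chartAt (Fin n → ℂ) x) ψ (chartAt (Fin n → ℂ) x x) v) (ψ p) /
    kernel (chartAt (Fin n → ℂ) x) ψ (chartAt (Fin n → ℂ) x x) (ψ p)

theorem isInvertible_of_det_ne_zero {L : (Fin n → ℂ) →L[ℂ] (Fin n → ℂ)} (h : L.det ≠ 0) :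
    L.IsInvertible :=
  ⟨L.toContinuousLinearEquivOfDetNeZero h, L.coe_toContinuousLinearEquivOfDetNeZero h⟩

theorem isInvertible_iff_det_ne_zero {L : (Fin n → ℂ) →L[ℂ] (Fin n → ℂ)} :
    L.IsInvertible ↔ L.det ≠ 0 := by
  refine ⟨?_, isInvertible_of_det_ne_zero⟩
  rintro ⟨e, rfl⟩
  exact (LinearEquiv.isUnit_det' e.toLinearEquiv).ne_zero

/-- A function on a manifold which is holomorphic in charts is smooth. -/
theorem contMDiffOn_of_differentiableAt_chart [IsManifold 𝓘(ℂ, Fin n → ℂ) ω M]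
    {G : Type*} [NormedAddCommGroup G]
    [NormedSpace ℂ G] [CompleteSpace G] {F : M → G} {W : Set M} (hW : IsOpen W)
    (hF : ∀ φ ∈ holCharts n M, ∀ x ∈ φ.source ∩ W, DifferentiableAt ℂ (F ∘ φ.symm) (φ x)) :
    ContMDiffOn 𝓘(ℂ, Fin n → ℂ) 𝓘(ℂ, G) ∞ F W := by
  intro x hx
  refine ContMDiffAt.contMDiffWithinAt ?_
  set φ := chartAt (Fin n → ℂ) x
  have hφ : φ ∈ holCharts n M := chartAt_mem_holCharts x
  have hxs : x ∈ φ.source := mem_chart_source _ x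
  have hd : DifferentiableOn ℂ (F ∘ φ.symm) (φ.target ∩ φ.symm ⁻¹' W) := fun z hz => by
    have := hF φ hφ (φ.symm z) ⟨φ.map_target hz.1, hz.2⟩
    rw [φ.right_inv hz.1] at this
    exact this.differentiableWithinAt
  have ho : IsOpen (φ.target ∩ φ.symm ⁻¹' W) := φ.isOpen_inter_preimage_symm hW
  have h1 : ContDiffAt ℂ ∞ (F ∘ φ.symm) (φ x) :=
    (contDiffOn_of_differentiableOn ho hd).contDiffAt
      (ho.mem_nhds ⟨φ.map_source hxs, by simpa [hxs] using hx⟩)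
  have h2 : ContMDiffAt 𝓘(ℂ, Fin n → ℂ) 𝓘(ℂ, Fin n → ℂ) ∞ φ x :=
    (contMDiffAt_of_mem_maximalAtlas hφ hxs).of_le (by exact_mod_cast le_top)
  refine (h1.contMDiffAt.comp x h2).congr_of_eventuallyEq ?_
  filter_upwards [φ.open_source.mem_nhds hxs] with y hy
  simp [hy]

variable [IsManifold 𝓘(ℂ, Fin n → ℂ) ω M] [SecondCountableTopology M]

theorem kernel_eq_zero_iff (hφ : φ ∈ holCharts n M) (hφ' : φ' ∈ holCharts n M)
    (hψ : ψ ∈ holCharts n M) (hψ' : ψ' ∈ holCharts n M) (hx : x ∈ φ.source) (hx' : x ∈ φ'.source)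
    (hp : p ∈ ψ.source) (hp' : p ∈ ψ'.source) :
    kernel φ ψ (φ x) (ψ p) = 0 ↔ kernel φ' ψ' (φ' x) (ψ' p) = 0 := by
  have : Nonempty M := ⟨p⟩
  have hz := φ.map_source hx
  have hw := ψ.map_source hp
  have hz' : φ.symm (φ x) ∈ φ'.source := by rwa [φ.left_inv hx]
  have hw' : ψ.symm (ψ p) ∈ ψ'.source := by rwa [ψ.left_inv hp]
  rw [kernel_transition_left hφ hφ' hψ hz hz' hw,
    kernel_transition_right hφ' hψ hψ' (φ'.map_source hz') hw hw', φ.left_inv hx, ψ.left_inv hp,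
    mul_eq_zero, mul_eq_zero, map_eq_zero (starRingEnd ℂ),
    or_iff_right (det_fderiv_transition_ne_zero hφ hφ' hz hz'),
    or_iff_right (det_fderiv_transition_ne_zero hψ hψ' hw hw')]

theorem mem_Z0_iff (hφ : φ ∈ holCharts n M) (hψ : ψ ∈ holCharts n M) (hx : x ∈ φ.source)
    (hp : p ∈ ψ.source) : x ∈ Z0 n p ↔ kernel φ ψ (φ x) (ψ p) = 0 :=
  kernel_eq_zero_iff (chartAt_mem_holCharts x) hφ (chartAt_mem_holCharts p) hψ
    (mem_chart_source _ x) hx (mem_chart_source _ p) hp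

theorem bochnerCoord_apply (hφ : φ ∈ holCharts n M) (hψ : ψ ∈ holCharts n M) (hx : x ∈ φ.source)
    (hp : p ∈ ψ.source) (k : Fin n) : bochnerCoord ψ p x k =
      wirtingerBar k (fun v => kernel φ ψ (φ x) v) (ψ p) / kernel φ ψ (φ x) (ψ p) := by
  have : Nonempty M := ⟨p⟩
  obtain ⟨h₀, h, -, -, hk⟩ := exists_kernel_forms hψ (ψ.map_source hp)
  have hc : chartAt (Fin n → ℂ) x ∈ holCharts n M := chartAt_mem_holCharts x
  have hxc : x ∈ (chartAt (Fin n → ℂ) x).source := mem_chart_source _ x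
  rw [bochnerCoord, (hk _ hc _ ((chartAt _ x).map_source hxc)).1,
    (hk _ hc _ ((chartAt _ x).map_source hxc)).2 k, (hk φ hφ _ (φ.map_source hx)).1,
    (hk φ hφ _ (φ.map_source hx)).2 k]
  simp only [formCoeff_eq, (chartAt _ x).left_inv hxc, φ.left_inv hx]
  rw [mul_div_mul_left _ _ (chartJac_ne_zero hc hxc), mul_div_mul_left _ _ (chartJac_ne_zero hφ hx)]

/-- The complement of `Z₀ᵖ` is open: in a chart it is the nonvanishing set of the coefficient of one
holomorphic form. -/
theorem isOpen_compl_Z0 (p : M) : IsOpen (Z0 n p)ᶜ := by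
  have : Nonempty M := ⟨p⟩
  set ψ := chartAt (Fin n → ℂ) p
  have hψ : ψ ∈ holCharts n M := chartAt_mem_holCharts p
  have hp : p ∈ ψ.source := mem_chart_source _ p
  obtain ⟨h₀, h, hh₀, -, hk⟩ := exists_kernel_forms hψ (ψ.map_source hp)
  rw [isOpen_iff_mem_nhds]
  intro x hx
  set φ := chartAt (Fin n → ℂ) x
  have hφ : φ ∈ holCharts n M := chartAt_mem_holCharts x
  have hxs : x ∈ φ.source := mem_chart_source _ x
  have hiff : ∀ y ∈ φ.source, y ∈ (Z0 n p)ᶜ ↔ formCoeff h₀ φ (φ y) ≠ 0 := fun y hy => by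
    rw [mem_compl_iff, mem_Z0_iff hφ hψ hy hp, (hk φ hφ _ (φ.map_source hy)).1]
  have hc : ContinuousAt (fun y => formCoeff h₀ φ (φ y)) x :=
    ContinuousAt.comp (f := φ) ((hh₀ φ hφ).continuousOn.continuousAt
      (φ.open_target.mem_nhds (φ.map_source hxs))) (φ.continuousAt hxs)
  filter_upwards [hc.eventually_ne ((hiff x hxs).1 hx), φ.open_source.mem_nhds hxs] with y h1 h2
  exact (hiff y h2).2 h1

/-- Bochner's representative coordinates are holomorphic off the zero set of the kernel. -/
theorem differentiableAt_bochnerCoord (hφ : φ ∈ holCharts n M) (hψ : ψ ∈ holCharts n M)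
    (hx : x ∈ φ.source) (hp : p ∈ ψ.source) (hx0 : x ∉ Z0 n p) :
    DifferentiableAt ℂ (bochnerCoord ψ p ∘ φ.symm) (φ x) := by
  have : Nonempty M := ⟨p⟩
  obtain ⟨h₀, h, hh₀, hh, hk⟩ := exists_kernel_forms hψ (ψ.map_source hp)
  have hn := φ.open_target.mem_nhds (φ.map_source hx)
  refine differentiableAt_pi.2 fun k => ?_
  have h1 : DifferentiableAt ℂ (fun z => formCoeff (h k) φ z / formCoeff h₀ φ z) (φ x) := by
    simp only [div_eq_mul_inv]
    refine ((hh k φ hφ).differentiableAt hn).mul (((hh₀ φ hφ).differentiableAt hn).inv ?_)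
    rwa [← (hk φ hφ _ (φ.map_source hx)).1, ne_eq, ← mem_Z0_iff hφ hψ hx hp]
  refine h1.congr_of_eventuallyEq ?_
  filter_upwards [hn] with z hz
  rw [Function.comp_apply, bochnerCoord_apply hφ hψ (φ.map_target hz) hp k, φ.right_inv hz,
    (hk φ hφ z hz).1, (hk φ hφ z hz).2 k]

theorem contMDiffOn_bochnerCoord (hψ : ψ ∈ holCharts n M) (hp : p ∈ ψ.source) :
    ContMDiffOn 𝓘(ℂ, Fin n → ℂ) 𝓘(ℂ, Fin n → ℂ) ∞ (bochnerCoord ψ p) (Z0 n p)ᶜ :=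
  contMDiffOn_of_differentiableAt_chart (isOpen_compl_Z0 p) fun _ hφ _ hx =>
    differentiableAt_bochnerCoord hφ hψ hx.1 hp hx.2

theorem polarizedMetric_apply (hφ : φ ∈ holCharts n M) (hψ : ψ ∈ holCharts n M)
    (hx : x ∈ φ.source) (hp : p ∈ ψ.source) (hx0 : x ∉ Z0 n p) (j k : Fin n) :
    polarizedMetric φ ψ (φ x) (ψ p) j k =
      fderiv ℂ (bochnerCoord ψ p ∘ φ.symm) (φ x) (Pi.single j 1) k := by
  have hd := differentiableAt_bochnerCoord hφ hψ hx hp hx0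
  have hev : (fun u => wirtingerBar k (fun v => kernel φ ψ u v) (ψ p) / kernel φ ψ u (ψ p)) =ᶠ[
      𝓝 (φ x)] fun z => (bochnerCoord ψ p ∘ φ.symm) z k := by
    filter_upwards [φ.open_target.mem_nhds (φ.map_source hx)] with z hz
    rw [Function.comp_apply, bochnerCoord_apply hφ hψ (φ.map_target hz) hp k, φ.right_inv hz]
  rw [polarizedMetric, Matrix.of_apply, wirtinger_congr hev,
    wirtinger_eq_fderiv (differentiableAt_pi.1 hd k), fderiv_apply hd]
  rfl

/-- The matrix `G(z, p̄)` is the Jacobian matrix of Bochner's representative coordinates. -/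
theorem polarizedMetric_eq_mfderiv (hφ : φ ∈ holCharts n M) (hψ : ψ ∈ holCharts n M)
    (hx : x ∈ φ.source) (hp : p ∈ ψ.source) (hx0 : x ∉ Z0 n p) (j k : Fin n) :
    polarizedMetric φ ψ (φ x) (ψ p) j k =
      (mfderiv 𝓘(ℂ, Fin n → ℂ) 𝓘(ℂ, Fin n → ℂ) (bochnerCoord ψ p) x (coordField φ j x) :
        Fin n → ℂ) k := by
  rw [polarizedMetric_apply hφ hψ hx hp hx0, (hasMFDerivAt_of_differentiableAt_chart hφ hx
    (differentiableAt_bochnerCoord hφ hψ hx hp hx0)).mfderiv]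
  have := mfderiv_chart_coordField hφ hx j
  change _ = (fderiv ℂ (bochnerCoord ψ p ∘ φ.symm) (φ x)
    (mfderiv 𝓘(ℂ, Fin n → ℂ) 𝓘(ℂ, Fin n → ℂ) φ x (coordField φ j x))) k
  rw [this]

theorem det_polarizedMetric (hφ : φ ∈ holCharts n M) (hψ : ψ ∈ holCharts n M)
    (hx : x ∈ φ.source) (hp : p ∈ ψ.source) (hx0 : x ∉ Z0 n p) :
    (polarizedMetric φ ψ (φ x) (ψ p)).det =
      (fderiv ℂ (bochnerCoord ψ p ∘ φ.symm) (φ x)).det := by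
  rw [← Matrix.det_transpose, ContinuousLinearMap.det, ← LinearMap.det_toMatrix']
  congr 1
  ext k j
  rw [Matrix.transpose_apply, polarizedMetric_apply hφ hψ hx hp hx0, LinearMap.toMatrix'_apply]
  congr 2

theorem det_polarizedMetric_ne_zero_iff (hφ : φ ∈ holCharts n M) (hψ : ψ ∈ holCharts n M)
    (hx : x ∈ φ.source) (hp : p ∈ ψ.source) (hx0 : x ∉ Z0 n p) :
    (polarizedMetric φ ψ (φ x) (ψ p)).det ≠ 0 ↔
      (mfderiv 𝓘(ℂ, Fin n → ℂ) 𝓘(ℂ, Fin n → ℂ) (bochnerCoord ψ p) x).IsInvertible := by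
  rw [det_polarizedMetric hφ hψ hx hp hx0, ← isInvertible_iff_det_ne_zero,
    (hasMFDerivAt_of_differentiableAt_chart hφ hx
      (differentiableAt_bochnerCoord hφ hψ hx hp hx0)).mfderiv]
  obtain ⟨e, he⟩ := isInvertible_mfderiv_chart hφ hx
  rw [← he]
  exact (ContinuousLinearMap.isInvertible_comp_equiv).symm

/-- A change of the chart around `p` changes Bochner's representative coordinates by an affine
transformation. If `J` is the Jacobian of the transition map `τ = ψ ∘ ψ'⁻¹`, then the kernels are
related by `K_ψ'(z, v̄) = conj (J v) * K_ψ(z, conj (τ v))`. Taking logarithmic derivatives in `v̄`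
at `ψ' p` gives the conjugate of `dτ`, which acts linearly, and the conjugate of `dJ / J`, which is
constant in `z`. -/
theorem exists_bochnerCoord_eq_affine (hψ : ψ ∈ holCharts n M) (hψ' : ψ' ∈ holCharts n M)
    (hp : p ∈ ψ.source) (hp' : p ∈ ψ'.source) :
    ∃ (A : (Fin n → ℂ) →L[ℂ] (Fin n → ℂ)) (b : Fin n → ℂ), ∀ x ∉ Z0 n p,
      bochnerCoord ψ' p x = A (bochnerCoord ψ p x) + b := by
  have : Nonempty M := ⟨p⟩
  set τ : (Fin n → ℂ) → (Fin n → ℂ) := ψ ∘ ψ'.symm with hτ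
  set w := ψ p
  set w' := ψ' p
  set J : (Fin n → ℂ) → ℂ := fun v => (fderiv ℂ τ v).det with hJ
  have hO := isOpen_transition_domain ψ' ψ
  have hw'O : w' ∈ ψ'.target ∩ ψ'.symm ⁻¹' ψ.source :=
    ⟨ψ'.map_source hp', by rw [mem_preimage, ψ'.left_inv hp']; exact hp⟩
  have hτw : τ w' = w := by simp only [hτ, Function.comp_apply, w', w, ψ'.left_inv hp']
  have hτd : DifferentiableOn ℂ τ (ψ'.target ∩ ψ'.symm ⁻¹' ψ.source) :=
    differentiableOn_transition hψ' hψ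
  have hτw' : HasFDerivAt τ (fderiv ℂ τ w') w' :=
    (hτd.differentiableAt (hO.mem_nhds hw'O)).hasFDerivAt
  have hJd : DifferentiableAt ℂ J w' := by
    have h1 : DifferentiableAt ℂ (fderiv ℂ τ) w' :=
      (((contDiffOn_infty_iff_fderiv_of_isOpen hO).1
        (contDiffOn_of_differentiableOn hO hτd)).2.differentiableOn (by simp)).differentiableAt
        (hO.mem_nhds hw'O)
    have h2 : J = fun v => (Matrix.of fun i j => fderiv ℂ τ v (Pi.single j 1) i).det := by
      funext v
      rw [hJ]
      simp only
      rw [ContinuousLinearMap.det, ← LinearMap.det_toMatrix']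
      congr 1
    rw [h2]
    simp only [Matrix.det_apply, Matrix.of_apply]
    refine DifferentiableAt.fun_sum fun σ _ => DifferentiableAt.const_smul ?_ _
    refine (HasFDerivAt.finsetProd fun i _ => DifferentiableAt.hasFDerivAt ?_).differentiableAt
    exact differentiableAt_pi.1 (h1.clm_apply (differentiableAt_const _)) _
  have hJ0 : conj (J w') ≠ 0 := by
    rw [ne_eq, map_eq_zero (starRingEnd ℂ)]
    exact det_fderiv_transition_ne_zero hψ' hψ hw'O.1 hw'O.2
  refine ⟨LinearMap.toContinuousLinearMap (Matrix.toLin' (Matrix.of fun k l =>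
      conj (fderiv ℂ τ w' (Pi.single k 1) l))),
    fun k => conj (fderiv ℂ J w' (Pi.single k 1)) / conj (J w'), fun x hx0 => ?_⟩
  set φ := chartAt (Fin n → ℂ) x
  have hφ : φ ∈ holCharts n M := chartAt_mem_holCharts x
  have hx : x ∈ φ.source := mem_chart_source _ x
  have hz := φ.map_source hx
  -- by hermitian symmetry the kernel is antiholomorphic in its second argument
  obtain ⟨g, _, hg, -, hgk⟩ := exists_kernel_forms hφ hz
  have hgK : ∀ v ∈ ψ.target, kernel φ ψ (φ x) v = conj (formCoeff g ψ v) := fun v hv => by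
    rw [← (hgk ψ hψ v hv).1, conj_kernel hψ hφ hv hz]
  have hgd : HasFDerivAt (formCoeff g ψ) (fderiv ℂ (formCoeff g ψ) w) (τ w') := by
    rw [hτw]
    exact ((hg ψ hψ).differentiableAt (ψ.open_target.mem_nhds (ψ.map_source hp))).hasFDerivAt
  -- the kernel in the chart `ψ'` is the conjugate of the holomorphic function `J * (g ∘ τ)`
  have hprod := hJd.hasFDerivAt.mul (hgd.comp w' hτw')
  have hev : (fun v => kernel φ ψ' (φ x) v) =ᶠ[𝓝 w']
      fun v => conj ((J * (formCoeff g ψ ∘ τ)) v) := by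
    filter_upwards [hO.mem_nhds hw'O] with v hv
    rw [kernel_transition_right hφ hψ' hψ hz hv.1 hv.2, hgK _ (ψ.map_source hv.2)]
    simp [hJ, hτ]
  have hK' : kernel φ ψ' (φ x) w' = conj (J w') * kernel φ ψ (φ x) w := by
    refine hev.self_of_nhds.trans ?_
    simp [hτw, hgK w (ψ.map_source hp)]
  have hbar : ∀ l, wirtingerBar l (fun v => kernel φ ψ (φ x) v) w =
      conj (fderiv ℂ (formCoeff g ψ) w (Pi.single l 1)) := fun l => by
    have : (fun v => kernel φ ψ (φ x) v) =ᶠ[𝓝 w] fun v => conj (formCoeff g ψ v) := by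
      filter_upwards [ψ.open_target.mem_nhds (ψ.map_source hp)] with v hv using hgK v hv
    rw [wirtingerBar_congr this, wirtingerBar_conj
      ((hg ψ hψ).differentiableAt (ψ.open_target.mem_nhds (ψ.map_source hp)))]
  have hbar' : ∀ k, wirtingerBar k (fun v => kernel φ ψ' (φ x) v) w' =
      conj (fderiv ℂ J w' (Pi.single k 1)) * kernel φ ψ (φ x) w + conj (J w') *
        ∑ l, conj (fderiv ℂ τ w' (Pi.single k 1) l) *
          wirtingerBar l (fun v => kernel φ ψ (φ x) v) w := fun k => by
    rw [wirtingerBar_congr hev, wirtingerBar_conj hprod.differentiableAt, hprod.fderiv]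
    simp only [hbar, hgK w (ψ.map_source hp), add_apply,
      smul_apply, ContinuousLinearMap.comp_apply, Function.comp_apply, hτw,
      smul_eq_mul, map_add, map_mul]
    have hs : fderiv ℂ (formCoeff g ψ) w (fderiv ℂ τ w' (Pi.single k 1)) =
        ∑ l, fderiv ℂ τ w' (Pi.single k 1) l * fderiv ℂ (formCoeff g ψ) w (Pi.single l 1) := by
      conv_lhs => rw [← ContinuousLinearMap.coe_coe, LinearMap.pi_apply_eq_sum_univ]
      refine Finset.sum_congr rfl fun l _ => ?_
      rw [smul_eq_mul, ContinuousLinearMap.coe_coe]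
      congr 2
      funext i
      simp [Pi.single_apply, eq_comm]
    rw [hs, map_sum]
    simp only [map_mul]
    ring
  have hK0 : kernel φ ψ (φ x) w ≠ 0 := fun h => hx0 ((mem_Z0_iff hφ hψ hx hp).2 h)
  funext k
  rw [bochnerCoord_apply hφ hψ' hx hp' k, hbar', hK']
  simp only [Pi.add_apply, LinearMap.coe_toContinuousLinearMap', Matrix.toLin'_apply,
    Matrix.mulVec, dotProduct, Matrix.of_apply]
  simp only [bochnerCoord_apply hφ hψ hx hp]
  rw [add_div, add_comm, mul_div_mul_left _ _ hJ0, Finset.sum_div]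
  congr 1
  · refine Finset.sum_congr rfl fun l _ => ?_
    rw [mul_div_assoc]
  · rw [mul_div_mul_right _ _ hK0]

theorem mdifferentiableAt_bochnerCoord (hψ : ψ ∈ holCharts n M) (hp : p ∈ ψ.source)
    (hx0 : x ∉ Z0 n p) :
    MDifferentiableAt 𝓘(ℂ, Fin n → ℂ) 𝓘(ℂ, Fin n → ℂ) (bochnerCoord ψ p) x :=
  ((contMDiffOn_bochnerCoord hψ hp).contMDiffAt
    ((isOpen_compl_Z0 p).mem_nhds hx0)).mdifferentiableAt (by simp)

/-- The linear part of the affine change of Bochner's representative coordinates relates their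
derivatives. -/
theorem exists_mfderiv_bochnerCoord_eq_comp (hψ : ψ ∈ holCharts n M) (hψ' : ψ' ∈ holCharts n M)
    (hp : p ∈ ψ.source) (hp' : p ∈ ψ'.source) :
    ∃ A : (Fin n → ℂ) →L[ℂ] (Fin n → ℂ), ∀ x ∉ Z0 n p,
      mfderiv 𝓘(ℂ, Fin n → ℂ) 𝓘(ℂ, Fin n → ℂ) (bochnerCoord ψ' p) x =
        A ∘L (mfderiv 𝓘(ℂ, Fin n → ℂ) 𝓘(ℂ, Fin n → ℂ) (bochnerCoord ψ p) x) := by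
  obtain ⟨A, b, hA⟩ := exists_bochnerCoord_eq_affine hψ hψ' hp hp'
  refine ⟨A, fun x hx => ?_⟩
  have hev : bochnerCoord ψ' p =ᶠ[𝓝 x] (fun v => A v + b) ∘ bochnerCoord ψ p := by
    filter_upwards [(isOpen_compl_Z0 p).mem_nhds hx] with y hy using hA y hy
  have h1 : HasMFDerivAt 𝓘(ℂ, Fin n → ℂ) 𝓘(ℂ, Fin n → ℂ) (fun v => A v + b)
      (bochnerCoord ψ p x) A := (A.hasFDerivAt.add_const b).hasMFDerivAt
  exact ((h1.comp x (mdifferentiableAt_bochnerCoord hψ hp hx).hasMFDerivAt).congr_of_eventuallyEq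
    hev).mfderiv

/-- Whether the derivative of Bochner's representative coordinates is invertible does not depend on
the chart around `p`: the two derivatives differ by a linear map `A` of `ℂⁿ` on the left, so the
first can only be invertible if the second is. -/
theorem isInvertible_mfderiv_bochnerCoord_of (hψ : ψ ∈ holCharts n M) (hψ' : ψ' ∈ holCharts n M)
    (hp : p ∈ ψ.source) (hp' : p ∈ ψ'.source) (hx : x ∉ Z0 n p)
    (h : (mfderiv 𝓘(ℂ, Fin n → ℂ) 𝓘(ℂ, Fin n → ℂ) (bochnerCoord ψ p) x).IsInvertible) :
    (mfderiv 𝓘(ℂ, Fin n → ℂ) 𝓘(ℂ, Fin n → ℂ) (bochnerCoord ψ' p) x).IsInvertible := by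
  obtain ⟨A, hA⟩ := exists_mfderiv_bochnerCoord_eq_comp hψ' hψ hp' hp
  have h1 := hA x hx
  rw [h1] at h
  refine isInvertible_of_det_ne_zero (L := mfderiv 𝓘(ℂ, Fin n → ℂ) 𝓘(ℂ, Fin n → ℂ)
    (bochnerCoord ψ' p) x) fun h0 => ?_
  refine (isInvertible_iff_det_ne_zero.1 h) ?_
  exact (LinearMap.det_comp _ _).trans (mul_eq_zero_of_right _ h0)

/-- `Mᵖ` is the set where Bochner's representative coordinates are defined and have an invertible
derivative. -/
theorem mem_regularSet_iff (hψ : ψ ∈ holCharts n M) (hp : p ∈ ψ.source) :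
    x ∈ regularSet n p ↔ x ∉ Z0 n p ∧
      (mfderiv 𝓘(ℂ, Fin n → ℂ) 𝓘(ℂ, Fin n → ℂ) (bochnerCoord ψ p) x).IsInvertible := by
  have hc : chartAt (Fin n → ℂ) p ∈ holCharts n M := chartAt_mem_holCharts p
  have hpc : p ∈ (chartAt (Fin n → ℂ) p).source := mem_chart_source _ p
  rw [regularSet, mem_compl_iff, mem_union, not_or]
  refine and_congr_right fun hx0 => ?_
  have : x ∉ Z1 n p ↔ (polarizedMetric (chartAt (Fin n → ℂ) x) (chartAt (Fin n → ℂ) p)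
      (chartAt (Fin n → ℂ) x x) (chartAt (Fin n → ℂ) p p)).det ≠ 0 := by
    simp [Z1, hx0]
  rw [this, det_polarizedMetric_ne_zero_iff (chartAt_mem_holCharts x) hc (mem_chart_source _ x)
    hpc hx0]
  exact ⟨isInvertible_mfderiv_bochnerCoord_of hc hψ hpc hp hx0,
    isInvertible_mfderiv_bochnerCoord_of hψ hc hp hpc hx0⟩

theorem isOpen_regularSet (p : M) : IsOpen (regularSet n p) := by
  set ψ := chartAt (Fin n → ℂ) p
  have hψ : ψ ∈ holCharts n M := chartAt_mem_holCharts p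
  have hp : p ∈ ψ.source := mem_chart_source _ p
  rw [isOpen_iff_mem_nhds]
  intro x hx
  obtain ⟨hx0, hxi⟩ := (mem_regularSet_iff hψ hp).1 hx
  set φ := chartAt (Fin n → ℂ) x
  have hφ : φ ∈ holCharts n M := chartAt_mem_holCharts x
  have hxs : x ∈ φ.source := mem_chart_source _ x
  set O := φ.target ∩ φ.symm ⁻¹' (Z0 n p)ᶜ with hO
  have hOo : IsOpen O := φ.isOpen_inter_preimage_symm (isOpen_compl_Z0 p)
  have hd : DifferentiableOn ℂ (bochnerCoord ψ p ∘ φ.symm) O := fun z hz => by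
    have := differentiableAt_bochnerCoord hφ hψ (φ.map_target hz.1) hp hz.2
    rw [φ.right_inv hz.1] at this
    exact this.differentiableWithinAt
  have hxO : φ x ∈ O := ⟨φ.map_source hxs, by rw [mem_preimage, φ.left_inv hxs]; exact hx0⟩
  have hc : ContinuousAt (fun y => (fderiv ℂ (bochnerCoord ψ p ∘ φ.symm) (φ y)).det) x := by
    refine ContinuousLinearMap.continuous_det.continuousAt.comp (ContinuousAt.comp (f := φ) ?_
      (φ.continuousAt hxs))
    exact ((contDiffOn_infty_iff_fderiv_of_isOpen hOo).1
      (contDiffOn_of_differentiableOn hOo hd)).2.continuousOn.continuousAt (hOo.mem_nhds hxO)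
  have hne : (fderiv ℂ (bochnerCoord ψ p ∘ φ.symm) (φ x)).det ≠ 0 := by
    rw [← det_polarizedMetric hφ hψ hxs hp hx0]
    exact (det_polarizedMetric_ne_zero_iff hφ hψ hxs hp hx0).2 hxi
  filter_upwards [hc.eventually_ne hne, φ.open_source.mem_nhds hxs,
    (isOpen_compl_Z0 p).mem_nhds hx0] with y h1 h2 h3
  refine (mem_regularSet_iff hψ hp).2 ⟨h3, ?_⟩
  rw [← det_polarizedMetric_ne_zero_iff hφ hψ h2 hp h3, det_polarizedMetric hφ hψ h2 hp h3]
  exact h1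

end BochnerCoordinates

/-! ### Derivatives of functions along vector fields -/

section LieDerivative

open Set Filter Topology VectorField

variable {n : ℕ} {M : Type*} [TopologicalSpace M] [ChartedSpace (Fin n → ℂ) M]
  {φ : OpenPartialHomeomorph M (Fin n → ℂ)} {x : M}
  {G : Type*} [NormedAddCommGroup G] [NormedSpace ℂ G] {F : M → G}

/-- The derivative `X F` of a vector-valued function `F` along the vector field `X`. -/
def lieDeriv (X : VField n M) (F : M → G) (x : M) : G := mvfderiv 𝓘(ℂ, Fin n → ℂ) F x (X x)

theorem mvfderiv_congr {F' : M → G} (h : F =ᶠ[𝓝 x] F') :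
    mvfderiv 𝓘(ℂ, Fin n → ℂ) F x = mvfderiv 𝓘(ℂ, Fin n → ℂ) F' x := by
  ext v
  change mfderiv 𝓘(ℂ, Fin n → ℂ) 𝓘(ℂ, G) F x v = mfderiv 𝓘(ℂ, Fin n → ℂ) 𝓘(ℂ, G) F' x v
  rw [h.mfderiv_eq]
  rfl

theorem lieDeriv_congr {F' : M → G} (X : VField n M) (h : F =ᶠ[𝓝 x] F') :
    lieDeriv X F x = lieDeriv X F' x := by
  rw [lieDeriv, lieDeriv, mvfderiv_congr h]

theorem isInvertible_mvfderiv_iff {u : M → Fin n → ℂ} :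
    (mvfderiv 𝓘(ℂ, Fin n → ℂ) u x).IsInvertible ↔
      (mfderiv 𝓘(ℂ, Fin n → ℂ) 𝓘(ℂ, Fin n → ℂ) u x).IsInvertible :=
  ContinuousLinearMap.isInvertible_equiv_comp

theorem mdifferentiableAt_iff_chart (hφ : φ ∈ holCharts n M) (hx : x ∈ φ.source) :
    MDifferentiableAt 𝓘(ℂ, Fin n → ℂ) 𝓘(ℂ, G) F x ↔ DifferentiableAt ℂ (F ∘ φ.symm) (φ x) := by
  refine ⟨fun h => ?_, fun h => (hasMFDerivAt_of_differentiableAt_chart hφ hx h).mdifferentiableAt⟩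
  have h1 := (mdifferentiable_of_mem_holCharts hφ).mdifferentiableAt_symm (φ.map_source hx)
  refine MDifferentiableAt.differentiableAt (MDifferentiableAt.comp (φ x) ?_ h1)
  rwa [φ.left_inv hx]

theorem mvfderiv_eq_fderiv (hφ : φ ∈ holCharts n M) (hx : x ∈ φ.source)
    (hF : MDifferentiableAt 𝓘(ℂ, Fin n → ℂ) 𝓘(ℂ, G) F x)
    (v : TangentSpace 𝓘(ℂ, Fin n → ℂ) x) :
    mvfderiv 𝓘(ℂ, Fin n → ℂ) F x v =
      fderiv ℂ (F ∘ φ.symm) (φ x) (mvfderiv 𝓘(ℂ, Fin n → ℂ) φ x v) := by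
  have := (hasMFDerivAt_of_differentiableAt_chart hφ hx
    ((mdifferentiableAt_iff_chart hφ hx).1 hF)).mfderiv
  change mfderiv 𝓘(ℂ, Fin n → ℂ) 𝓘(ℂ, G) F x v = _
  rw [this]
  rfl

theorem mdifferentiableAt_chart (hφ : φ ∈ holCharts n M) (hx : x ∈ φ.source) :
    MDifferentiableAt 𝓘(ℂ, Fin n → ℂ) 𝓘(ℂ, Fin n → ℂ) φ x :=
  (mdifferentiable_of_mem_holCharts hφ).mdifferentiableAt hx

theorem isInvertible_mvfderiv_chart (hφ : φ ∈ holCharts n M) (hx : x ∈ φ.source) :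
    (mvfderiv 𝓘(ℂ, Fin n → ℂ) φ x).IsInvertible :=
  isInvertible_mvfderiv_iff.2 (isInvertible_mfderiv_chart hφ hx)

theorem mvfderiv_chart_coordField (hφ : φ ∈ holCharts n M) (hx : x ∈ φ.source) (i : Fin n) :
    mvfderiv 𝓘(ℂ, Fin n → ℂ) φ x (coordField φ i x) = Pi.single i 1 :=
  mfderiv_chart_coordField hφ hx i

/-- The chain rule for `X F` in a chart `φ`; `lieDeriv X φ` is the vector of components of `X`. -/
theorem lieDeriv_eventuallyEq (hφ : φ ∈ holCharts n M) (hx : x ∈ φ.source)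
    (hF : ∀ᶠ y in 𝓝 x, MDifferentiableAt 𝓘(ℂ, Fin n → ℂ) 𝓘(ℂ, G) F y) (X : VField n M) :
    lieDeriv X F =ᶠ[𝓝 x] fun y => fderiv ℂ (F ∘ φ.symm) (φ y) (lieDeriv X φ y) := by
  filter_upwards [hF, φ.open_source.mem_nhds hx] with y hy hyφ
  exact mvfderiv_eq_fderiv hφ hyφ hy (X y)

theorem contDiffAt_comp_symm [CompleteSpace G] (hφ : φ ∈ holCharts n M) (hx : x ∈ φ.source)
    (hF : ∀ᶠ y in 𝓝 x, MDifferentiableAt 𝓘(ℂ, Fin n → ℂ) 𝓘(ℂ, G) F y) :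
    ContDiffAt ℂ ∞ (F ∘ φ.symm) (φ x) := by
  obtain ⟨V, hV, hVo, hxV⟩ := mem_nhds_iff.1 hF
  have ho : IsOpen (φ.target ∩ φ.symm ⁻¹' V) := φ.isOpen_inter_preimage_symm hVo
  have hmem : φ x ∈ φ.target ∩ φ.symm ⁻¹' V := ⟨φ.map_source hx, by simpa [hx] using hxV⟩
  refine (contDiffOn_of_differentiableOn ho fun z hz => ?_).contDiffAt (ho.mem_nhds hmem)
  have := (mdifferentiableAt_iff_chart hφ (φ.map_target hz.1)).1 (hV hz.2)
  rw [φ.right_inv hz.1] at this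
  exact this.differentiableWithinAt

theorem differentiableAt_fderiv_comp_symm [CompleteSpace G] (hφ : φ ∈ holCharts n M)
    (hx : x ∈ φ.source) (hF : ∀ᶠ y in 𝓝 x, MDifferentiableAt 𝓘(ℂ, Fin n → ℂ) 𝓘(ℂ, G) F y) :
    DifferentiableAt ℂ (fderiv ℂ (F ∘ φ.symm)) (φ x) :=
  ((contDiffAt_comp_symm hφ hx hF).fderiv_right (m := ∞) (by simp)).differentiableAt
    (by simp)

variable [IsManifold 𝓘(ℂ, Fin n → ℂ) ω M]

/-- The vector field `X` is complex differentiable at `x`. -/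
abbrev HolomorphicFieldAt (X : VField n M) (x : M) : Prop :=
  MDifferentiableAt 𝓘(ℂ, Fin n → ℂ) (𝓘(ℂ, Fin n → ℂ).tangent)
    (fun y => (⟨y, X y⟩ : TangentBundle 𝓘(ℂ, Fin n → ℂ) M)) x

theorem IsHolomorphicField.at {X : VField n M} {U : Set M} (hX : IsHolomorphicField X U)
    (hU : IsOpen U) (hx : x ∈ U) : HolomorphicFieldAt X x :=
  (hX x hx).mdifferentiableAt (hU.mem_nhds hx)

/-- A vector field is holomorphic if and only if its components in the preferred chart are. The
reason is that the trivialization of the tangent bundle at `x` is the derivative of that chart. -/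
theorem holomorphicFieldAt_iff_chartAt {X : VField n M} : HolomorphicFieldAt X x ↔
    MDifferentiableAt 𝓘(ℂ, Fin n → ℂ) 𝓘(ℂ, Fin n → ℂ)
      (lieDeriv X (chartAt (Fin n → ℂ) x)) x := by
  have : IsManifold 𝓘(ℂ, Fin n → ℂ) 1 M := IsManifold.of_le (n := ω) le_top
  refine (mdifferentiableAt_section _ X).trans ?_
  refine Filter.EventuallyEq.mdifferentiableAt_iff ?_
  filter_upwards [chart_source_mem_nhds (Fin n → ℂ) x] with y hy
  have h1 := TangentBundle.continuousLinearMapAt_trivializationAt (I := 𝓘(ℂ, Fin n → ℂ)) hy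
  have h2 := congrArg (fun L => L (X y)) h1
  rw [Bundle.Trivialization.continuousLinearMapAt_apply,
    Bundle.Trivialization.linearMapAt_apply] at h2
  rw [if_pos (by simpa using hy)] at h2
  rw [h2]
  rfl

theorem mdifferentiableAt_lieDeriv [CompleteSpace G] {X : VField n M}
    (hF : ∀ᶠ y in 𝓝 x, MDifferentiableAt 𝓘(ℂ, Fin n → ℂ) 𝓘(ℂ, G) F y)
    (hX : HolomorphicFieldAt X x) :
    MDifferentiableAt 𝓘(ℂ, Fin n → ℂ) 𝓘(ℂ, G) (lieDeriv X F) x := by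
  have hφ := chartAt_mem_holCharts (n := n) x
  have hxs := mem_chart_source (Fin n → ℂ) x
  refine MDifferentiableAt.congr_of_eventuallyEq ?_ (lieDeriv_eventuallyEq hφ hxs hF X)
  exact ((differentiableAt_fderiv_comp_symm hφ hxs hF).comp_mdifferentiableAt
    (mdifferentiableAt_chart hφ hxs)).clm_apply (holomorphicFieldAt_iff_chartAt.1 hX)

/-- A vector field is holomorphic as soon as its image under a local biholomorphism `u` to `ℂⁿ`
is. -/
theorem holomorphicFieldAt_of_lieDeriv {X : VField n M} {u : M → Fin n → ℂ}
    (hu : ∀ᶠ y in 𝓝 x, MDifferentiableAt 𝓘(ℂ, Fin n → ℂ) 𝓘(ℂ, Fin n → ℂ) u y)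
    (hinv : ∀ᶠ y in 𝓝 x, (mvfderiv 𝓘(ℂ, Fin n → ℂ) u y).IsInvertible)
    (hX : MDifferentiableAt 𝓘(ℂ, Fin n → ℂ) 𝓘(ℂ, Fin n → ℂ) (lieDeriv X u) x) :
    HolomorphicFieldAt X x := by
  have hφ := chartAt_mem_holCharts (n := n) x
  have hxs := mem_chart_source (Fin n → ℂ) x
  set φ := chartAt (Fin n → ℂ) x
  have hinv' : ∀ᶠ y in 𝓝 x, (fderiv ℂ (u ∘ φ.symm) (φ y)).IsInvertible := by
    filter_upwards [hu, hinv, φ.open_source.mem_nhds hxs] with y h1 h2 h3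
    have : mvfderiv 𝓘(ℂ, Fin n → ℂ) u y =
        fderiv ℂ (u ∘ φ.symm) (φ y) ∘L mvfderiv 𝓘(ℂ, Fin n → ℂ) φ y := by
      ext v : 1
      exact mvfderiv_eq_fderiv hφ h3 h1 v
    rw [this] at h2
    obtain ⟨e, he⟩ := isInvertible_mvfderiv_chart hφ h3
    rw [← he] at h2
    exact ContinuousLinearMap.isInvertible_comp_equiv.1 h2
  refine holomorphicFieldAt_iff_chartAt.2 (MDifferentiableAt.congr_of_eventuallyEq
    (f := fun y => (fderiv ℂ (u ∘ φ.symm) (φ y)).inverse (lieDeriv X u y)) ?_ ?_)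
  · refine MDifferentiableAt.clm_apply ?_ hX
    have h1 : DifferentiableAt ℂ (fun z => (fderiv ℂ (u ∘ φ.symm) z).inverse) (φ x) :=
      ((hinv'.self_of_nhds.contDiffAt_map_inverse (n := 1)).differentiableAt (by simp)).comp (φ x)
        (differentiableAt_fderiv_comp_symm hφ hxs hu)
    exact h1.comp_mdifferentiableAt (mdifferentiableAt_chart hφ hxs)
  · filter_upwards [hinv', lieDeriv_eventuallyEq hφ hxs hu X] with y h1 h2
    rw [h2, h1.inverse_apply_self]

theorem holomorphicFieldAt_coordField (hφ : φ ∈ holCharts n M) (hx : x ∈ φ.source) (i : Fin n) :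
    HolomorphicFieldAt (coordField φ i) x := by
  have h := φ.open_source.mem_nhds hx
  refine holomorphicFieldAt_of_lieDeriv (u := φ) ?_ ?_ ?_
  · filter_upwards [h] with y hy using mdifferentiableAt_chart hφ hy
  · filter_upwards [h] with y hy using isInvertible_mvfderiv_chart hφ hy
  · refine (mdifferentiableAt_const (c := (Pi.single i 1 : Fin n → ℂ))).congr_of_eventuallyEq ?_
    filter_upwards [h] with y hy using mvfderiv_chart_coordField hφ hy i

end LieDerivative

/-! ### The Lie bracket as a commutator of derivations -/

section LieBracket

open Set Filter Topology VectorField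

variable {n : ℕ} {M : Type*} [TopologicalSpace M] [ChartedSpace (Fin n → ℂ) M]
  [IsManifold 𝓘(ℂ, Fin n → ℂ) ω M]
  {φ : OpenPartialHomeomorph M (Fin n → ℂ)} {x : M}
  {G : Type*} [NormedAddCommGroup G] [NormedSpace ℂ G] {F : M → G} {X Y Z : VField n M}

/-- The vector field on `φ.target` which represents `V` in the chart `φ`. -/
def chartField (φ : OpenPartialHomeomorph M (Fin n → ℂ)) (V : VField n M) : VField n (Fin n → ℂ) :=
  fun z => (lieDeriv V φ (φ.symm z) : Fin n → ℂ)

/-- The coordinate representation of the Lie bracket. -/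
theorem mvfderiv_chart_mlieBracket (hX : HolomorphicFieldAt X x) (hY : HolomorphicFieldAt Y x) :
    let φ := chartAt (Fin n → ℂ) x
    mvfderiv 𝓘(ℂ, Fin n → ℂ) φ x (mlieBracket 𝓘(ℂ, Fin n → ℂ) X Y x) =
      fderiv ℂ (lieDeriv Y φ ∘ φ.symm) (φ x) (lieDeriv X φ x) -
        fderiv ℂ (lieDeriv X φ ∘ φ.symm) (φ x) (lieDeriv Y φ x) := by
  intro φ
  have hφ : φ ∈ holCharts n M := chartAt_mem_holCharts x
  have hxs : x ∈ φ.source := mem_chart_source _ x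
  have : IsManifold 𝓘(ℂ, Fin n → ℂ) (minSmoothness ℂ 2) M := IsManifold.of_le (n := ω) le_top
  have : IsManifold 𝓘(ℂ, Fin n → ℂ) (minSmoothness ℂ 3) M := IsManifold.of_le (n := ω) le_top
  have hpull : ∀ V : VField n M,
      V =ᶠ[𝓝 x] mpullback 𝓘(ℂ, Fin n → ℂ) 𝓘(ℂ, Fin n → ℂ) φ (chartField φ V) := fun V => by
    filter_upwards [φ.open_source.mem_nhds hxs] with y hy
    have h1 := (isInvertible_mfderiv_chart hφ hy).inverse_apply_self (V y)
    rw [mpullback_apply, ← h1]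
    congr 1
    change _ = lieDeriv V φ (φ.symm (φ y))
    rw [φ.left_inv hy]
    rfl
  have hsec : ∀ {V : VField n M}, HolomorphicFieldAt V x →
      HolomorphicFieldAt (chartField φ V) (φ x) := fun {V} hV => by
    have hd : DifferentiableAt ℂ (lieDeriv V φ ∘ φ.symm) (φ x) :=
      (mdifferentiableAt_iff_chart hφ hxs).1 (holomorphicFieldAt_iff_chartAt.1 hV)
    refine holomorphicFieldAt_iff_chartAt.2 (hd.mdifferentiableAt.congr_of_eventuallyEq ?_)
    refine Eventually.of_forall fun z => ?_
    change mfderiv 𝓘(ℂ, Fin n → ℂ) 𝓘(ℂ, Fin n → ℂ) id z _ = _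
    rw [mfderiv_id]
    rfl
  have h1 := mpullback_mlieBracket (I := 𝓘(ℂ, Fin n → ℂ)) (I' := 𝓘(ℂ, Fin n → ℂ)) (f := φ)
    (x₀ := x) (n := ω) (hsec hX) (hsec hY)
    (contMDiffAt_of_mem_maximalAtlas hφ hxs) le_top
  have h2 : mlieBracket 𝓘(ℂ, Fin n → ℂ) (chartField φ X) (chartField φ Y) =
      lieBracket ℂ (lieDeriv X φ ∘ φ.symm) (lieDeriv Y φ ∘ φ.symm) := by
    rw [← mlieBracketWithin_univ, mlieBracketWithin_eq_lieBracketWithin]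
    exact lieBracketWithin_univ
  rw [Filter.EventuallyEq.mlieBracket_vectorField_eq (hpull X) (hpull Y), ← h1, mpullback_apply]
  refine ((isInvertible_mfderiv_chart hφ hxs).self_apply_inverse _).trans ?_
  rw [h2]
  change fderiv ℂ (lieDeriv Y φ ∘ φ.symm) (φ x) (lieDeriv X φ (φ.symm (φ x))) -
    fderiv ℂ (lieDeriv X φ ∘ φ.symm) (φ x) (lieDeriv Y φ (φ.symm (φ x))) = _
  rw [φ.left_inv hxs]

/-- The derivation property `[X, Y] F = X (Y F) - Y (X F)` of the Lie bracket. -/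
theorem mvfderiv_mlieBracket [CompleteSpace G]
    (hF : ∀ᶠ y in 𝓝 x, MDifferentiableAt 𝓘(ℂ, Fin n → ℂ) 𝓘(ℂ, G) F y)
    (hX : HolomorphicFieldAt X x) (hY : HolomorphicFieldAt Y x) :
    lieDeriv (mlieBracket 𝓘(ℂ, Fin n → ℂ) X Y) F x =
      lieDeriv X (lieDeriv Y F) x - lieDeriv Y (lieDeriv X F) x := by
  set φ := chartAt (Fin n → ℂ) x with hφdef
  have hφ : φ ∈ holCharts n M := chartAt_mem_holCharts x
  have hxs : x ∈ φ.source := mem_chart_source _ x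
  have hsymm : IsSymmSndFDerivAt ℂ (F ∘ φ.symm) (φ x) :=
    (contDiffAt_comp_symm hφ hxs hF).isSymmSndFDerivAt
      (by simpa using WithTop.coe_le_coe.2 (le_top : (2 : ℕ∞) ≤ ⊤))
  have hlin : ∀ {V W : VField n M}, HolomorphicFieldAt W x → lieDeriv V (lieDeriv W F) x =
      fderiv ℂ (fderiv ℂ (F ∘ φ.symm)) (φ x) (lieDeriv V φ x) (lieDeriv W φ x) +
        fderiv ℂ (F ∘ φ.symm) (φ x)
          (fderiv ℂ (lieDeriv W φ ∘ φ.symm) (φ x) (lieDeriv V φ x)) := fun {V W} hW => by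
    rw [lieDeriv, mvfderiv_eq_fderiv hφ hxs (mdifferentiableAt_lieDeriv hF hW)]
    have hev : lieDeriv W F ∘ φ.symm =ᶠ[𝓝 (φ x)]
        fun z => fderiv ℂ (F ∘ φ.symm) z ((lieDeriv W φ ∘ φ.symm) z) := by
      have h1 := lieDeriv_eventuallyEq hφ hxs hF W
      have h2 : Tendsto φ.symm (𝓝 (φ x)) (𝓝 x) := by
        have := (φ.continuousAt_symm (φ.map_source hxs)).tendsto
        rwa [φ.left_inv hxs] at this
      filter_upwards [h2.eventually h1, φ.open_target.mem_nhds (φ.map_source hxs)] with z hz hz'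
      rw [Function.comp_apply, hz, φ.right_inv hz']
      rfl
    rw [hev.fderiv_eq, fderiv_clm_apply (differentiableAt_fderiv_comp_symm hφ hxs hF)
      ((mdifferentiableAt_iff_chart hφ hxs).1 (holomorphicFieldAt_iff_chartAt.1 hW))]
    simp only [Function.comp_apply, φ.left_inv hxs]
    rw [add_comm]
    rfl
  rw [lieDeriv, mvfderiv_eq_fderiv hφ hxs hF.self_of_nhds, mvfderiv_chart_mlieBracket hX hY,
    hlin hY, hlin hX, map_sub, hsymm.eq (lieDeriv X φ x) (lieDeriv Y φ x)]
  abel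

end LieBracket

/-! ### The flat connection of a developing map -/

section DevelopingMap

open Set Filter Topology VectorField

variable {n : ℕ} {M : Type*} [TopologicalSpace M] [ChartedSpace (Fin n → ℂ) M]

/-- `u` is a local biholomorphism from the open set `W` to `ℂⁿ`. -/
structure IsDevelopingMapOn (u : M → Fin n → ℂ) (W : Set M) : Prop where
  isOpen : IsOpen W
  mdifferentiableAt : ∀ x ∈ W, MDifferentiableAt 𝓘(ℂ, Fin n → ℂ) 𝓘(ℂ, Fin n → ℂ) u x
  isInvertible : ∀ x ∈ W, (mvfderiv 𝓘(ℂ, Fin n → ℂ) u x).IsInvertible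

/-- The pull-back under `u` of the standard flat connection of `ℂⁿ`: `du (∇_X Y) = X (du Y)`. -/
def devConn (u : M → Fin n → ℂ) : ConnOp n M := fun Y x =>
  (mvfderiv 𝓘(ℂ, Fin n → ℂ) u x).inverse ∘L mvfderiv 𝓘(ℂ, Fin n → ℂ) (lieDeriv Y u) x

variable {G : Type*} [NormedAddCommGroup G] [NormedSpace ℂ G] {F : M → G} {X Y Z : VField n M}
  {u : M → Fin n → ℂ} {U W : Set M} {x : M}

theorem lieDeriv_add_field (X Y : VField n M) (F : M → G) :
    lieDeriv (X + Y) F = lieDeriv X F + lieDeriv Y F :=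
  funext fun x => map_add (mvfderiv 𝓘(ℂ, Fin n → ℂ) F x) _ _

theorem lieDeriv_smul_field (g : M → ℂ) (X : VField n M) (F : M → G) :
    lieDeriv (g • X) F = g • lieDeriv X F :=
  funext fun x => map_smul (mvfderiv 𝓘(ℂ, Fin n → ℂ) F x) (g x) _

namespace IsDevelopingMapOn

theorem eventually_mdifferentiableAt (hu : IsDevelopingMapOn u W) (hx : x ∈ W) :
    ∀ᶠ y in 𝓝 x, MDifferentiableAt 𝓘(ℂ, Fin n → ℂ) 𝓘(ℂ, Fin n → ℂ) u y := by
  filter_upwards [hu.isOpen.mem_nhds hx] with y hy using hu.mdifferentiableAt y hy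

theorem eventually_isInvertible (hu : IsDevelopingMapOn u W) (hx : x ∈ W) :
    ∀ᶠ y in 𝓝 x, (mvfderiv 𝓘(ℂ, Fin n → ℂ) u y).IsInvertible := by
  filter_upwards [hu.isOpen.mem_nhds hx] with y hy using hu.isInvertible y hy

theorem mvfderiv_devConn (hu : IsDevelopingMapOn u W) (hx : x ∈ W) (Y : VField n M)
    (v : TangentSpace 𝓘(ℂ, Fin n → ℂ) x) :
    mvfderiv 𝓘(ℂ, Fin n → ℂ) u x (devConn u Y x v) =
      mvfderiv 𝓘(ℂ, Fin n → ℂ) (lieDeriv Y u) x v :=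
  (hu.isInvertible x hx).self_apply_inverse _

theorem injective (hu : IsDevelopingMapOn u W) (hx : x ∈ W) :
    Function.Injective (mvfderiv 𝓘(ℂ, Fin n → ℂ) u x) :=
  (hu.isInvertible x hx).injective

theorem lieDeriv_devConn (hu : IsDevelopingMapOn u W) (hx : x ∈ W) (X Y : VField n M) :
    lieDeriv (fun y => devConn u Y y (X y)) u x = lieDeriv X (lieDeriv Y u) x :=
  hu.mvfderiv_devConn hx Y (X x)

variable [IsManifold 𝓘(ℂ, Fin n → ℂ) ω M]

theorem mdifferentiableAt_lieDeriv (hu : IsDevelopingMapOn u W) (hx : x ∈ W)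
    (hY : HolomorphicFieldAt Y x) :
    MDifferentiableAt 𝓘(ℂ, Fin n → ℂ) 𝓘(ℂ, Fin n → ℂ) (lieDeriv Y u) x :=
  BergmanGeometry.mdifferentiableAt_lieDeriv (hu.eventually_mdifferentiableAt hx) hY

theorem isCovariantDerivativeOn (hu : IsDevelopingMapOn u W) :
    IsCovariantDerivativeOn (Fin n → ℂ) (devConn u) W where
  add {σ σ' x} hσ hσ' hx := by
    rw [devConn, lieDeriv_add_field, mvfderiv_add (hu.mdifferentiableAt_lieDeriv hx hσ)
      (hu.mdifferentiableAt_lieDeriv hx hσ'), ContinuousLinearMap.comp_add]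
    rfl
  leibniz {σ g x} hσ hg hx := by
    rw [devConn, lieDeriv_smul_field, mvfderiv_smul hg (hu.mdifferentiableAt_lieDeriv hx hσ)]
    ext v : 1
    have h := (hu.isInvertible x hx).inverse_apply_self (σ x)
    simp only [ContinuousLinearMap.comp_apply, add_apply, smul_apply,
      ContinuousLinearMap.smulRight_apply, map_add, map_smul, devConn]
    congr 2

/-- The image of `∇_X Y` under `du` is the holomorphic function `X (Y u)`. -/
theorem holomorphicFieldAt_devConn (hu : IsDevelopingMapOn u W) (hU : IsOpen U) (hUW : U ⊆ W)
    (hX : IsHolomorphicField X U) (hY : IsHolomorphicField Y U) (hx : x ∈ U) :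
    HolomorphicFieldAt (fun y => devConn u Y y (X y)) x := by
  refine holomorphicFieldAt_of_lieDeriv (hu.eventually_mdifferentiableAt (hUW hx))
    (hu.eventually_isInvertible (hUW hx)) ?_
  refine MDifferentiableAt.congr_of_eventuallyEq (f := lieDeriv X (lieDeriv Y u)) ?_ ?_
  · refine BergmanGeometry.mdifferentiableAt_lieDeriv ?_ (hX.at hU hx)
    filter_upwards [hU.mem_nhds hx] with y hy
    exact hu.mdifferentiableAt_lieDeriv (hUW hy) (hY.at hU hy)
  · filter_upwards [hU.mem_nhds hx] with y hy using hu.lieDeriv_devConn (hUW hy) X Y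

theorem isHolomorphicConnectionOn (hu : IsDevelopingMapOn u W) :
    IsHolomorphicConnectionOn (devConn u) W where
  covariant := hu.isCovariantDerivativeOn
  holomorphic _ hU hUW _ _ hX hY _ hx :=
    (hu.holomorphicFieldAt_devConn hU hUW hX hY hx).mdifferentiableWithinAt

/-- The torsion vanishes, since `du` maps it to `X (Y u) - Y (X u) - [X, Y] u`. -/
theorem torsion_devConn (hu : IsDevelopingMapOn u W) (hx : x ∈ W) (hX : HolomorphicFieldAt X x)
    (hY : HolomorphicFieldAt Y x) : torsion (devConn u) X Y x = 0 := by
  refine hu.injective hx ?_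
  rw [torsion, map_sub, map_sub, hu.mvfderiv_devConn hx, hu.mvfderiv_devConn hx, map_zero,
    sub_eq_zero]
  exact (mvfderiv_mlieBracket (hu.eventually_mdifferentiableAt hx) hX hY).symm

/-- The curvature vanishes, since `du` maps it to `X (Y F) - Y (X F) - [X, Y] F` for the function
`F = Z u`. -/
theorem curvature_devConn (hu : IsDevelopingMapOn u W) (hU : IsOpen U) (hUW : U ⊆ W)
    (hX : IsHolomorphicField X U) (hY : IsHolomorphicField Y U) (hZ : IsHolomorphicField Z U)
    (hx : x ∈ U) : curvature (devConn u) X Y Z x = 0 := by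
  refine hu.injective (hUW hx) ?_
  have hg : ∀ᶠ y in 𝓝 x, MDifferentiableAt 𝓘(ℂ, Fin n → ℂ) 𝓘(ℂ, Fin n → ℂ) (lieDeriv Z u) y := by
    filter_upwards [hU.mem_nhds hx] with y hy
    exact hu.mdifferentiableAt_lieDeriv (hUW hy) (hZ.at hU hy)
  have hev : ∀ V : VField n M, lieDeriv (fun y => devConn u Z y (V y)) u =ᶠ[𝓝 x]
      lieDeriv V (lieDeriv Z u) := fun V => by
    filter_upwards [hU.mem_nhds hx] with y hy using hu.lieDeriv_devConn (hUW hy) V Z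
  rw [curvature, map_sub, map_sub, hu.mvfderiv_devConn (hUW hx), hu.mvfderiv_devConn (hUW hx),
    hu.mvfderiv_devConn (hUW hx), map_zero, sub_eq_zero, mvfderiv_congr (hev Y),
    mvfderiv_congr (hev X)]
  exact (mvfderiv_mlieBracket hg (hX.at hU hx) (hY.at hU hx)).symm

theorem isLocallyFlatOn (hu : IsDevelopingMapOn u W) : IsLocallyFlatOn (devConn u) W :=
  fun _ hU hUW _ _ _ hX hY hZ _ hx =>
    ⟨hu.torsion_devConn (hUW hx) (hX.at hU hx) (hY.at hU hx),
      hu.curvature_devConn hU hUW hX hY hZ hx⟩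

end IsDevelopingMapOn

/-! ### Uniqueness of a connection with given connection form -/

variable {D D' : ConnOp n M} {φ : OpenPartialHomeomorph M (Fin n → ℂ)}

theorem eq_sum_coordField (hφ : φ ∈ holCharts n M) (hx : x ∈ φ.source)
    (v : TangentSpace 𝓘(ℂ, Fin n → ℂ) x) :
    v = ∑ i, mvfderiv 𝓘(ℂ, Fin n → ℂ) φ x v i • coordField φ i x := by
  refine (isInvertible_mvfderiv_chart hφ hx).injective ?_
  rw [map_sum]
  simp only [map_smul, mvfderiv_chart_coordField hφ hx]
  funext j
  simp [Finset.sum_apply, Pi.single_apply]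

theorem sum_smul_coordField_inj (hφ : φ ∈ holCharts n M) (hx : x ∈ φ.source) {a b : Fin n → ℂ}
    (h : ∑ i, a i • coordField φ i x = ∑ i, b i • coordField φ i x) : a = b := by
  have := congrArg (mvfderiv 𝓘(ℂ, Fin n → ℂ) φ x) h
  rw [map_sum, map_sum] at this
  simp only [map_smul, mvfderiv_chart_coordField hφ hx] at this
  funext j
  simpa [Finset.sum_apply, Pi.single_apply] using congrFun this j

variable [IsManifold 𝓘(ℂ, Fin n → ℂ) ω M]

/-- The Leibniz rule for a finite linear combination of holomorphic vector fields. -/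
theorem _root_.IsCovariantDerivativeOn.sum_smul {ι : Type*}
    (hD : IsCovariantDerivativeOn (Fin n → ℂ) D W) (hx : x ∈ W) (s : Finset ι) {g : ι → M → ℂ}
    {E : ι → VField n M} (hg : ∀ i, MDifferentiableAt 𝓘(ℂ, Fin n → ℂ) 𝓘(ℂ, ℂ) (g i) x)
    (hE : ∀ i, HolomorphicFieldAt (E i) x) :
    HolomorphicFieldAt (∑ i ∈ s, g i • E i) x ∧ D (∑ i ∈ s, g i • E i) x =
      ∑ i ∈ s, (g i x • D (E i) x +
        (mvfderiv 𝓘(ℂ, Fin n → ℂ) (g i) x).smulRight (E i x)) := by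
  classical
  have : IsManifold 𝓘(ℂ, Fin n → ℂ) 1 M := IsManifold.of_le (n := ω) le_top
  induction s using Finset.induction_on with
  | empty =>
    refine ⟨?_, hD.zero hx⟩
    exact Bundle.mdifferentiableAt_zeroSection ..
  | insert i s hi ih =>
    have h1 : HolomorphicFieldAt (g i • E i) x := (hg i).smul_section (hE i)
    rw [Finset.sum_insert hi, Finset.sum_insert hi]
    refine ⟨mdifferentiableAt_add_section h1 ih.1, ?_⟩
    rw [hD.add h1 ih.1 hx, ih.2, hD.leibniz (hE i) (hg i) hx]

/-- A covariant derivative is determined by its values on the coordinate vector fields: near `x` a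
vector field is a combination of these with holomorphic coefficients. -/
theorem covariant_ext (hD : IsCovariantDerivativeOn (Fin n → ℂ) D W)
    (hD' : IsCovariantDerivativeOn (Fin n → ℂ) D' W) (hW : IsOpen W) (hxW : x ∈ W)
    (hφ : φ ∈ holCharts n M) (hx : x ∈ φ.source)
    (h : ∀ k l, D (coordField φ k) x (coordField φ l x) = D' (coordField φ k) x (coordField φ l x))
    (hY : HolomorphicFieldAt Y x) : D Y x = D' Y x := by
  have hc := φ.open_source.mem_nhds hx
  set g : Fin n → M → ℂ := fun i y => lieDeriv Y φ y i
  have hg : ∀ i, MDifferentiableAt 𝓘(ℂ, Fin n → ℂ) 𝓘(ℂ, ℂ) (g i) x := fun i => by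
    have h1 : MDifferentiableAt 𝓘(ℂ, Fin n → ℂ) 𝓘(ℂ, Fin n → ℂ) (lieDeriv Y φ) x := by
      refine mdifferentiableAt_lieDeriv ?_ hY
      filter_upwards [hc] with y hy using mdifferentiableAt_chart hφ hy
    exact (ContinuousLinearMap.proj (R := ℂ) (φ := fun _ : Fin n => ℂ)
      i).differentiableAt.comp_mdifferentiableAt h1
  have hE : ∀ i, HolomorphicFieldAt (coordField φ i) x := holomorphicFieldAt_coordField hφ hx
  have hYeq : ∀ᶠ y in 𝓝 x, Y y = (∑ i, g i • coordField φ i) y := by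
    filter_upwards [hc] with y hy
    rw [Finset.sum_apply]
    exact eq_sum_coordField hφ hy (Y y)
  have h1 := hD.sum_smul hxW Finset.univ hg hE
  have h2 := hD'.sum_smul hxW Finset.univ hg hE
  have h3 : ∀ k, D (coordField φ k) x = D' (coordField φ k) x := fun k => by
    ext v : 1
    rw [eq_sum_coordField hφ hx v, map_sum, map_sum]
    simp only [map_smul, h]
  rw [hD.congr_of_eventuallyEq hY h1.1 (hW.mem_nhds hxW) hYeq,
    hD'.congr_of_eventuallyEq hY h1.1 (hW.mem_nhds hxW) hYeq, h1.2, h2.2]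
  simp only [h3]

end DevelopingMap

/-! ### Geodesics -/

section Geodesics

open Set Filter Topology

variable {n : ℕ} {M : Type*} [TopologicalSpace M] [ChartedSpace (Fin n → ℂ) M]
  {φ : OpenPartialHomeomorph M (Fin n → ℂ)} {x : M}
  {G : Type*} [NormedAddCommGroup G] [NormedSpace ℂ G] [NormedSpace ℝ G] [IsScalarTower ℝ ℂ G]
  {F : M → G} {X Y Z : VField n M}
  {γ : ℝ → M} {J : Set ℝ} {t : ℝ} {D : ConnOp n M} {u : M → Fin n → ℂ} {W : Set M}

/-- The chain rule for a holomorphic function along a curve which is differentiable in a chart. -/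
theorem hasDerivAt_comp_curve_of_chart (hφ : φ ∈ holCharts n M) (ht : γ t ∈ φ.source)
    (hγ : ContinuousAt γ t) (hd : DifferentiableAt ℝ (φ ∘ γ) t)
    (hF : MDifferentiableAt 𝓘(ℂ, Fin n → ℂ) 𝓘(ℂ, G) F (γ t)) :
    HasDerivAt (F ∘ γ) (fderiv ℂ (F ∘ φ.symm) (φ (γ t)) (deriv (φ ∘ γ) t)) t := by
  have h1 := ((mdifferentiableAt_iff_chart hφ ht).1 hF).hasFDerivAt.restrictScalars ℝ
  refine (h1.comp_hasDerivAt t hd.hasDerivAt).congr_of_eventuallyEq ?_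
  filter_upwards [hγ.preimage_mem_nhds (φ.open_source.mem_nhds ht)] with s hs
  simp only [Function.comp_apply, φ.left_inv hs]

theorem IsC2Curve.differentiableAt (hγ : IsC2Curve n γ J) (ht : t ∈ J) :
    DifferentiableAt ℝ (chartAt (Fin n → ℂ) (γ t) ∘ γ) t :=
  (hγ t ht).2.differentiableAt (by simp)

variable [IsManifold 𝓘(ℂ, Fin n → ℂ) ω M]

/-- The components of the velocity in the preferred chart at `γ t`. -/
theorem mvfderiv_chartAt_velocity (hd : DifferentiableAt ℝ (chartAt (Fin n → ℂ) (γ t) ∘ γ) t) :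
    mvfderiv 𝓘(ℂ, Fin n → ℂ) (chartAt (Fin n → ℂ) (γ t)) (γ t) (velocity n γ t) =
      deriv (chartAt (Fin n → ℂ) (γ t) ∘ γ) t := by
  have hφ := chartAt_mem_holCharts (n := n) (γ t)
  have hxs := mem_chart_source (Fin n → ℂ) (γ t)
  rw [velocity, map_sum]
  simp only [map_smul, mvfderiv_chart_coordField hφ hxs]
  rw [deriv_pi (differentiableAt_pi.1 hd)]
  funext j
  simp [Finset.sum_apply, Pi.single_apply]

/-- The chain rule for a holomorphic function along a curve. -/
theorem IsC2Curve.hasDerivAt_comp (hγ : IsC2Curve n γ J) (ht : t ∈ J)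
    (hF : MDifferentiableAt 𝓘(ℂ, Fin n → ℂ) 𝓘(ℂ, G) F (γ t)) :
    HasDerivAt (F ∘ γ) (mvfderiv 𝓘(ℂ, Fin n → ℂ) F (γ t) (velocity n γ t)) t := by
  rw [mvfderiv_eq_fderiv (chartAt_mem_holCharts (γ t)) (mem_chart_source (Fin n → ℂ) (γ t)) hF,
    mvfderiv_chartAt_velocity (hγ.differentiableAt ht)]
  exact hasDerivAt_comp_curve_of_chart (chartAt_mem_holCharts (γ t))
    (mem_chart_source (Fin n → ℂ) (γ t)) (hγ t ht).1 (hγ.differentiableAt ht) hF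

/-- A `C²` curve is `C²` in every holomorphic chart, not only in the preferred ones. -/
theorem IsC2Curve.contDiffAt_chart (hγ : IsC2Curve n γ J) (ht : t ∈ J) (hφ : φ ∈ holCharts n M)
    (hx : γ t ∈ φ.source) : ContDiffAt ℝ 2 (φ ∘ γ) t := by
  have hc := chartAt_mem_holCharts (n := n) (γ t)
  have hxs := mem_chart_source (Fin n → ℂ) (γ t)
  have hF : ∀ᶠ y in 𝓝 (γ t), MDifferentiableAt 𝓘(ℂ, Fin n → ℂ) 𝓘(ℂ, Fin n → ℂ) φ y := by
    filter_upwards [φ.open_source.mem_nhds hx] with y hy using mdifferentiableAt_chart hφ hy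
  have h1 := ((contDiffAt_comp_symm hc hxs hF).of_le (m := 2)
    (WithTop.coe_le_coe.2 le_top)).restrict_scalars ℝ
  refine (h1.comp t (hγ t ht).2).congr_of_eventuallyEq ?_
  filter_upwards [(hγ t ht).1.preimage_mem_nhds
    ((chartAt (Fin n → ℂ) (γ t)).open_source.mem_nhds hxs)] with s hs
  simp only [Function.comp_apply, (chartAt (Fin n → ℂ) (γ t)).left_inv hs]

/-- The velocity, defined with the preferred chart at `γ t`, has the expected components in every
holomorphic chart. -/
theorem IsC2Curve.velocity_eq (hγ : IsC2Curve n γ J) (ht : t ∈ J) (hφ : φ ∈ holCharts n M)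
    (hx : γ t ∈ φ.source) :
    velocity n γ t = ∑ i, deriv (fun s => φ (γ s) i) t • coordField φ i (γ t) := by
  have hd := (hγ.contDiffAt_chart ht hφ hx).differentiableAt (by simp)
  rw [eq_sum_coordField hφ hx (velocity n γ t)]
  refine Finset.sum_congr rfl fun i _ => ?_
  rw [← (hγ.hasDerivAt_comp ht (mdifferentiableAt_chart hφ hx)).deriv,
    deriv_pi (differentiableAt_pi.1 hd)]
  rfl

/-- For the flat connection of a developing map `u`, the derivative `du` maps the covariant
derivative along a curve to the ordinary derivative of `du V`. In particular the covariant
derivative does not depend on the frame in which it is computed. -/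
theorem IsDevelopingMapOn.mvfderiv_hasCovDerivAlong (hu : IsDevelopingMapOn u W)
    (hγ : IsC2Curve n γ J) (ht : t ∈ J) (htW : γ t ∈ W)
    {V : ∀ t : ℝ, TangentSpace 𝓘(ℂ, Fin n → ℂ) (γ t)} {V' : TangentSpace 𝓘(ℂ, Fin n → ℂ) (γ t)}
    (h : HasCovDerivAlong (devConn u) γ V t V') :
    mvfderiv 𝓘(ℂ, Fin n → ℂ) u (γ t) V' =
      deriv (fun s => mvfderiv 𝓘(ℂ, Fin n → ℂ) u (γ s) (V s)) t := by
  obtain ⟨U, E, a, hU, htU, hE, ha, hV, rfl⟩ := h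
  have hg : ∀ i, HasDerivAt (lieDeriv (E i) u ∘ γ) (mvfderiv 𝓘(ℂ, Fin n → ℂ) (lieDeriv (E i) u)
      (γ t) (velocity n γ t)) t := fun i =>
    hγ.hasDerivAt_comp ht (hu.mdifferentiableAt_lieDeriv htW ((hE i).at hU htU))
  have h1 : HasDerivAt (fun s => ∑ i, a i s • (lieDeriv (E i) u ∘ γ) s)
      (∑ i, (a i t • mvfderiv 𝓘(ℂ, Fin n → ℂ) (lieDeriv (E i) u) (γ t) (velocity n γ t) +
        deriv (a i) t • (lieDeriv (E i) u ∘ γ) t)) t :=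
    HasDerivAt.fun_sum fun i _ => (ha i).hasDerivAt.smul (hg i)
  have h2 : (fun s => mvfderiv 𝓘(ℂ, Fin n → ℂ) u (γ s) (V s)) =ᶠ[𝓝 t]
      fun s => ∑ i, a i s • (lieDeriv (E i) u ∘ γ) s := by
    filter_upwards [hV] with s hs
    rw [hs, map_sum]
    simp only [map_smul]
    rfl
  rw [(h1.congr_of_eventuallyEq h2).deriv, map_sum]
  refine Finset.sum_congr rfl fun i _ => ?_
  rw [map_add, map_smul, map_smul, hu.mvfderiv_devConn htW, add_comm]
  rfl

/-- The covariant derivative of the velocity of a curve, computed in the coordinate frame of a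
chart. -/
theorem IsC2Curve.hasCovDerivAlong_velocity (hγ : IsC2Curve n γ J) (hJ : IsOpen J) (ht : t ∈ J)
    (hφ : φ ∈ holCharts n M) (hx : γ t ∈ φ.source) {Γ : Fin n → Fin n → Fin n → ℂ}
    (hΓ : ∀ k l, D (coordField φ k) (γ t) (coordField φ l (γ t)) =
      ∑ j, Γ j k l • coordField φ j (γ t)) :
    HasCovDerivAlong D γ (velocity n γ) t
      (∑ j, (iteratedDeriv 2 (fun s => φ (γ s) j) t + ∑ k, ∑ l, Γ j k l *
        deriv (fun s => φ (γ s) k) t * deriv (fun s => φ (γ s) l) t) • coordField φ j (γ t)) := by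
  refine ⟨φ.source, coordField φ, fun i => deriv fun s => φ (γ s) i, φ.open_source, hx,
    fun i y hy => (holomorphicFieldAt_coordField hφ hy i).mdifferentiableWithinAt, fun i => ?_,
    ?_, ?_⟩
  · have h1 : ContDiffAt ℝ 2 (fun s => φ (γ s) i) t :=
      contDiffAt_pi.1 (hγ.contDiffAt_chart ht hφ hx) i
    exact ((h1.fderiv_right (m := 1) (by norm_num)).differentiableAt (by simp)).clm_apply
      (differentiableAt_const (1 : ℝ))
  · filter_upwards [hJ.mem_nhds ht,
      (hγ t ht).1.preimage_mem_nhds (φ.open_source.mem_nhds hx)] with s hs hsφ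
    exact hγ.velocity_eq hs hφ hsφ
  · have hDv : ∀ k, D (coordField φ k) (γ t) (velocity n γ t) =
        ∑ j, (∑ l, deriv (fun s => φ (γ s) l) t * Γ j k l) • coordField φ j (γ t) := fun k => by
      rw [hγ.velocity_eq ht hφ hx, map_sum]
      simp only [map_smul, hΓ, Finset.smul_sum, Finset.sum_smul, smul_smul]
      exact Finset.sum_comm
    simp only [hDv, Finset.sum_add_distrib, add_smul, Finset.smul_sum, smul_smul]
    congr 1
    · refine Finset.sum_congr rfl fun i _ => ?_
      rw [iteratedDeriv_succ, iteratedDeriv_one]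
    · rw [Finset.sum_comm]
      refine Finset.sum_congr rfl fun j _ => ?_
      rw [← Finset.sum_smul]
      congr 1
      refine Finset.sum_congr rfl fun k _ => ?_
      rw [Finset.mul_sum]
      refine Finset.sum_congr rfl fun l _ => ?_
      ring

/-- The geodesic equation in a chart. -/
theorem IsC2Curve.hasCovDerivAlong_zero_iff (hu : IsDevelopingMapOn u W)
    (hγ : IsC2Curve n γ J) (hJ : IsOpen J) (ht : t ∈ J) (htW : γ t ∈ W)
    (hφ : φ ∈ holCharts n M) (hx : γ t ∈ φ.source) {Γ : Fin n → Fin n → Fin n → ℂ}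
    (hΓ : ∀ k l, devConn u (coordField φ k) (γ t) (coordField φ l (γ t)) =
      ∑ j, Γ j k l • coordField φ j (γ t)) :
    HasCovDerivAlong (devConn u) γ (velocity n γ) t 0 ↔
      ∀ j, iteratedDeriv 2 (fun s => φ (γ s) j) t + ∑ k, ∑ l, Γ j k l *
        deriv (fun s => φ (γ s) k) t * deriv (fun s => φ (γ s) l) t = 0 := by
  have h1 := hγ.hasCovDerivAlong_velocity hJ ht hφ hx hΓ
  refine ⟨fun h => ?_, fun h => ?_⟩
  · have h2 := hu.injective htW ((hu.mvfderiv_hasCovDerivAlong hγ ht htW h1).trans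
      (hu.mvfderiv_hasCovDerivAlong hγ ht htW h).symm)
    refine congrFun (sum_smul_coordField_inj hφ hx (b := fun _ => 0) (h2.trans ?_))
    simp
  · simpa only [h, zero_smul, Finset.sum_const_zero] using h1

end Geodesics

/-! ### The connection with connection form `∂G · G⁻¹` -/

section BochnerConnection

open Set Filter Topology

variable {n : ℕ} {M : Type*} [TopologicalSpace M] [ChartedSpace (Fin n → ℂ) M]
  [IsManifold 𝓘(ℂ, Fin n → ℂ) ω M]
  {φ ψ ψ' : OpenPartialHomeomorph M (Fin n → ℂ)} {p x : M} {u u' : M → Fin n → ℂ} {W : Set M}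
  {Y : VField n M} {D : ConnOp n M}

/-- The connection of a developing map depends on the map only up to affine transformations. -/
theorem IsDevelopingMapOn.devConn_eq_of_comp (hu : IsDevelopingMapOn u W)
    (hu' : IsDevelopingMapOn u' W) {A : (Fin n → ℂ) →L[ℂ] (Fin n → ℂ)}
    (hA : ∀ y ∈ W, mvfderiv 𝓘(ℂ, Fin n → ℂ) u' y = A ∘L mvfderiv 𝓘(ℂ, Fin n → ℂ) u y)
    (hx : x ∈ W) (hY : HolomorphicFieldAt Y x) : devConn u' Y x = devConn u Y x := by
  have hev : lieDeriv Y u' =ᶠ[𝓝 x] A ∘ lieDeriv Y u := by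
    filter_upwards [hu.isOpen.mem_nhds hx] with y hy
    rw [lieDeriv, hA y hy]
    rfl
  have h1 : HasMFDerivAt 𝓘(ℂ, Fin n → ℂ) 𝓘(ℂ, Fin n → ℂ) A (lieDeriv Y u x) A :=
    A.hasFDerivAt.hasMFDerivAt
  have h2 := (h1.comp x (hu.mdifferentiableAt_lieDeriv hx hY).hasMFDerivAt).mfderiv
  ext v : 1
  refine hu'.injective hx ?_
  rw [hu'.mvfderiv_devConn hx, mvfderiv_congr hev, hA x hx, ContinuousLinearMap.comp_apply,
    hu.mvfderiv_devConn hx]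
  exact congrArg (fun L => L v) h2

variable [SecondCountableTopology M]

theorem isDevelopingMapOn_bochnerCoord (hψ : ψ ∈ holCharts n M) (hp : p ∈ ψ.source) :
    IsDevelopingMapOn (bochnerCoord ψ p) (regularSet n p) where
  isOpen := isOpen_regularSet p
  mdifferentiableAt _ hx := mdifferentiableAt_bochnerCoord hψ hp ((mem_regularSet_iff hψ hp).1 hx).1
  isInvertible _ hx := isInvertible_mvfderiv_iff.2 ((mem_regularSet_iff hψ hp).1 hx).2

/-- The connection induced by Bochner's representative coordinates does not depend on the chart
around `p`. -/
theorem devConn_bochnerCoord_eq (hψ : ψ ∈ holCharts n M) (hψ' : ψ' ∈ holCharts n M)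
    (hp : p ∈ ψ.source) (hp' : p ∈ ψ'.source) (hx : x ∈ regularSet n p)
    (hY : HolomorphicFieldAt Y x) :
    devConn (bochnerCoord ψ' p) Y x = devConn (bochnerCoord ψ p) Y x := by
  obtain ⟨A, hA⟩ := exists_mfderiv_bochnerCoord_eq_comp hψ hψ' hp hp'
  refine (isDevelopingMapOn_bochnerCoord hψ hp).devConn_eq_of_comp
    (isDevelopingMapOn_bochnerCoord hψ' hp') (A := A) (fun y hy => ?_) hx hY
  exact hA y ((mem_regularSet_iff hψ hp).1 hy).1

/-- The connection form of the pull-back connection is `∂G · G⁻¹`. Since `G` is the Jacobian matrix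
of the representative coordinates `u`, the `m`-th component of `X_l (X_k u)` for coordinate fields
is `∂G_{km}/∂z_l`, and `du (X_j)` is the `j`-th row of `G`. -/
theorem devConn_bochnerCoord_coordField (hφ : φ ∈ holCharts n M) (hψ : ψ ∈ holCharts n M)
    (hp : p ∈ ψ.source) (hxφ : x ∈ φ.source) (hx : x ∈ regularSet n p) (k l : Fin n) :
    devConn (bochnerCoord ψ p) (coordField φ k) x (coordField φ l x) =
      ∑ j, christoffel φ ψ p j k l (φ x) • coordField φ j x := by
  have hu := isDevelopingMapOn_bochnerCoord hψ hp
  set u := bochnerCoord ψ p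
  have hx0 : x ∉ Z0 n p := ((mem_regularSet_iff hψ hp).1 hx).1
  have hdet : IsUnit (polarizedMetric φ ψ (φ x) (ψ p)).det := isUnit_iff_ne_zero.2
    ((det_polarizedMetric_ne_zero_iff hφ hψ hxφ hp hx0).2 ((mem_regularSet_iff hψ hp).1 hx).2)
  have hG : ∀ y ∈ φ.source ∩ regularSet n p, ∀ j m,
      polarizedMetric φ ψ (φ y) (ψ p) j m = lieDeriv (coordField φ j) u y m := fun y hy j m =>
    polarizedMetric_eq_mfderiv hφ hψ hy.1 hp ((mem_regularSet_iff hψ hp).1 hy.2).1 j m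
  have hd : DifferentiableAt ℂ (lieDeriv (coordField φ k) u ∘ φ.symm) (φ x) :=
    (mdifferentiableAt_iff_chart hφ hxφ).1 (hu.mdifferentiableAt_lieDeriv hx
      (holomorphicFieldAt_coordField hφ hxφ k))
  have hdG : ∀ m, wirtinger l (fun z => polarizedMetric φ ψ z (ψ p) k m) (φ x) =
      fderiv ℂ (lieDeriv (coordField φ k) u ∘ φ.symm) (φ x) (Pi.single l 1) m := fun m => by
    have hev : (fun z => polarizedMetric φ ψ z (ψ p) k m) =ᶠ[𝓝 (φ x)]
        fun z => (lieDeriv (coordField φ k) u ∘ φ.symm) z m := by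
      have ho : IsOpen (φ.target ∩ φ.symm ⁻¹' regularSet n p) :=
        φ.isOpen_inter_preimage_symm (isOpen_regularSet p)
      filter_upwards [ho.mem_nhds ⟨φ.map_source hxφ, by rwa [mem_preimage, φ.left_inv hxφ]⟩]
        with z hz
      have := hG (φ.symm z) ⟨φ.map_target hz.1, hz.2⟩ k m
      rwa [φ.right_inv hz.1] at this
    rw [wirtinger_congr hev, wirtinger_eq_fderiv (differentiableAt_pi.1 hd m), fderiv_apply hd]
    rfl
  refine hu.injective hx ?_
  rw [hu.mvfderiv_devConn hx, mvfderiv_eq_fderiv hφ hxφ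
    ((mdifferentiableAt_iff_chart hφ hxφ).2 hd), mvfderiv_chart_coordField hφ hxφ, map_sum]
  funext m
  simp only [map_smul, Finset.sum_apply, Pi.smul_apply, smul_eq_mul]
  have h1 : ∀ j, mvfderiv 𝓘(ℂ, Fin n → ℂ) u x (coordField φ j x) m =
      polarizedMetric φ ψ (φ x) (ψ p) j m := fun j => (hG x ⟨hxφ, hx⟩ j m).symm
  simp only [h1, christoffel, hdG, Finset.sum_mul, mul_assoc]
  rw [Finset.sum_comm]
  simp only [← Finset.mul_sum]
  simp only [← Matrix.mul_apply, Matrix.nonsing_inv_mul _ hdet, Matrix.one_apply, mul_ite, mul_one,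
    mul_zero, Finset.sum_ite_eq', Finset.mem_univ, if_true]

theorem isBochnerConnection_devConn (hψ : ψ ∈ holCharts n M) (hp : p ∈ ψ.source) :
    IsBochnerConnection p (devConn (bochnerCoord ψ p)) where
  toIsHolomorphicConnectionOn := (isDevelopingMapOn_bochnerCoord hψ hp).isHolomorphicConnectionOn
  connection_form φ hφ ψ' hψ' hp' x hx k l := by
    rw [← devConn_bochnerCoord_eq hψ hψ' hp hp' hx.2 (holomorphicFieldAt_coordField hφ hx.1 k)]
    exact devConn_bochnerCoord_coordField hφ hψ' hp' hx.1 hx.2 k l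

/-- Every connection with connection form `∂G · G⁻¹` is the pull-back of the flat connection by
Bochner's representative coordinates. -/
theorem IsBochnerConnection.eq_devConn (hD : IsBochnerConnection p D) (hψ : ψ ∈ holCharts n M)
    (hp : p ∈ ψ.source) (hx : x ∈ regularSet n p) (hY : HolomorphicFieldAt Y x) :
    D Y x = devConn (bochnerCoord ψ p) Y x := by
  have hφ := chartAt_mem_holCharts (n := n) x
  have hxs := mem_chart_source (Fin n → ℂ) x
  refine covariant_ext hD.covariant (isDevelopingMapOn_bochnerCoord hψ hp).isCovariantDerivativeOn
    (isOpen_regularSet p) hx hφ hxs (fun k l => ?_) hY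
  rw [hD.connection_form _ hφ ψ hψ hp x ⟨hxs, hx⟩,
    devConn_bochnerCoord_coordField hφ hψ hp hxs hx]

/-- Geodesics of the pull-back connection are the solutions of the geodesic system in all charts. -/
theorem isGeodesicOn_devConn_iff (hψ : ψ ∈ holCharts n M) (hp : p ∈ ψ.source) {γ : ℝ → M}
    {J : Set ℝ} (hJ : IsOpen J) (hγJ : MapsTo γ J (regularSet n p)) :
    IsGeodesicOn (devConn (bochnerCoord ψ p)) γ J ↔
      IsC2Curve n γ J ∧ SolvesPolarizedGeodesicODE (n := n) p γ J := by
  refine and_congr_right fun hγ => ?_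
  have hiff : ∀ t ∈ J, ∀ φ ∈ holCharts n M, γ t ∈ φ.source → ∀ ψ' ∈ holCharts n M,
      p ∈ ψ'.source → (HasCovDerivAlong (devConn (bochnerCoord ψ p)) γ (velocity n γ) t 0 ↔ _) :=
    fun t ht φ hφ hx ψ' hψ' hp' => hγ.hasCovDerivAlong_zero_iff
      (isDevelopingMapOn_bochnerCoord hψ hp) hJ ht (hγJ ht) hφ hx
      (Γ := fun j k l => christoffel φ ψ' p j k l (φ (γ t)))
      ((isBochnerConnection_devConn hψ hp).connection_form φ hφ ψ' hψ' hp' _ ⟨hx, hγJ ht⟩)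
  refine ⟨fun h φ hφ ψ' hψ' hp' t ht hx => (hiff t ht φ hφ hx ψ' hψ' hp').1 (h t ht),
    fun h t ht => ?_⟩
  have hφ := chartAt_mem_holCharts (n := n) (γ t)
  have hx := mem_chart_source (Fin n → ℂ) (γ t)
  exact (hiff t ht _ hφ hx ψ hψ hp).2 (h _ hφ ψ hψ hp t ht hx)

end BochnerConnection

/-! ### Invariance of the kernel under biholomorphisms -/

section Transport

open Set Filter Topology

variable {n : ℕ} {M N : Type*} [TopologicalSpace M] [ChartedSpace (Fin n → ℂ) M]
  [TopologicalSpace N] [ChartedSpace (Fin n → ℂ) N]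
  (f : M ≃ₘ^ω⟮𝓘(ℂ, Fin n → ℂ), 𝓘(ℂ, Fin n → ℂ)⟯ N)
  {φ ψ : OpenPartialHomeomorph M (Fin n → ℂ)} {x : M} {z w : Fin n → ℂ}

/-- The chart `φ ∘ f⁻¹` of `N`. -/
def transportChart (φ : OpenPartialHomeomorph M (Fin n → ℂ)) :
    OpenPartialHomeomorph N (Fin n → ℂ) :=
  f.toHomeomorph.symm.transOpenPartialHomeomorph φ

theorem transportChart_apply (φ : OpenPartialHomeomorph M (Fin n → ℂ)) (x : M) :
    transportChart f φ (f x) = φ x :=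
  congrArg φ (f.symm_apply_apply x)

theorem transportChart_symm_apply (φ : OpenPartialHomeomorph M (Fin n → ℂ)) (z : Fin n → ℂ) :
    (transportChart f φ).symm z = f (φ.symm z) := rfl

theorem mem_transportChart_source (hx : x ∈ φ.source) : f x ∈ (transportChart f φ).source := by
  change f.symm (f x) ∈ φ.source
  rwa [f.symm_apply_apply]

theorem mdifferentiableAt_diffeomorph (x : M) :
    MDifferentiableAt 𝓘(ℂ, Fin n → ℂ) 𝓘(ℂ, Fin n → ℂ) f x :=
  f.mdifferentiable (by simp) x

theorem isInvertible_mfderiv_diffeomorph (x : M) :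
    (mfderiv 𝓘(ℂ, Fin n → ℂ) 𝓘(ℂ, Fin n → ℂ) f x).IsInvertible :=
  ⟨f.mfderivToContinuousLinearEquiv (by simp) x, rfl⟩

/-- The pull-back of `n`-forms. -/
def pullbackForm (α : NForm n N) : NForm n M := fun x =>
  (α (f x)).compContinuousLinearMap (mfderiv 𝓘(ℂ, Fin n → ℂ) 𝓘(ℂ, Fin n → ℂ) f x)

theorem pullbackForm_add (α β : NForm n N) :
    pullbackForm f (α + β) = pullbackForm f α + pullbackForm f β := rfl

theorem pullbackForm_smul (c : ℂ) (α : NForm n N) :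
    pullbackForm f (c • α) = c • pullbackForm f α := rfl

theorem pullbackForm_symm_pullbackForm (α : NForm n N) :
    pullbackForm f.symm (pullbackForm f α) = α := by
  funext y
  have h1 : (mfderiv 𝓘(ℂ, Fin n → ℂ) 𝓘(ℂ, Fin n → ℂ) f (f.symm y)).comp
      (mfderiv 𝓘(ℂ, Fin n → ℂ) 𝓘(ℂ, Fin n → ℂ) f.symm y) =
      ContinuousLinearMap.id ℂ (Fin n → ℂ) := by
    have := mfderiv_comp y (mdifferentiableAt_diffeomorph f (f.symm y))
      (mdifferentiableAt_diffeomorph f.symm y)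
    rw [← this]
    have h2 : (f : M → N) ∘ f.symm = id := funext f.apply_symm_apply
    rw [h2]
    exact mfderiv_id
  ext v
  change α (f (f.symm y)) (fun i => (mfderiv 𝓘(ℂ, Fin n → ℂ) 𝓘(ℂ, Fin n → ℂ) f (f.symm y)).comp
      (mfderiv 𝓘(ℂ, Fin n → ℂ) 𝓘(ℂ, Fin n → ℂ) f.symm y) (v i)) = α y v
  rw [h1]
  have h3 : ∀ y' : N, y' = y → α y' (v : Fin n → Fin n → ℂ) = α y v := by
    rintro _ rfl
    rfl
  exact h3 _ (f.apply_symm_apply y)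

theorem pullbackForm_injective : Function.Injective (pullbackForm f) :=
  Function.LeftInverse.injective (pullbackForm_symm_pullbackForm f)

variable [IsManifold 𝓘(ℂ, Fin n → ℂ) ω N]

theorem transportChart_mem_holCharts (hφ : φ ∈ holCharts n M) :
    transportChart f φ ∈ holCharts n N := by
  refine OpenPartialHomeomorph.mem_maximalAtlas_of_contMDiffOn _ ?_ ?_
  · exact (contMDiffOn_of_mem_maximalAtlas hφ).comp f.symm.contMDiff.contMDiffOn fun y hy => hy
  · exact f.contMDiff.comp_contMDiffOn (contMDiffOn_symm_of_mem_maximalAtlas hφ)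

theorem coordField_transportChart (hφ : φ ∈ holCharts n M) (hx : x ∈ φ.source) (i : Fin n) :
    coordField (transportChart f φ) i (f x) =
      mfderiv 𝓘(ℂ, Fin n → ℂ) 𝓘(ℂ, Fin n → ℂ) f x (coordField φ i x) := by
  have ht := transportChart_mem_holCharts f hφ
  have hfx := mem_transportChart_source f hx
  refine (isInvertible_mfderiv_chart ht hfx).injective ?_
  rw [mfderiv_chart_coordField ht hfx]
  have h1 := mfderiv_comp x ((mdifferentiable_of_mem_holCharts ht).mdifferentiableAt hfx)
    (mdifferentiableAt_diffeomorph f x)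
  have h2 : transportChart f φ ∘ f = φ := funext (transportChart_apply f φ)
  rw [h2] at h1
  rw [← mfderiv_chart_coordField hφ hx i, h1]
  rfl

/-- The coefficient of `f^* α` in the chart `φ` is that of `α` in the chart `φ ∘ f⁻¹`. -/
theorem formCoeff_pullbackForm (α : NForm n N) (hφ : φ ∈ holCharts n M) (hz : z ∈ φ.target) :
    formCoeff (pullbackForm f α) φ z = formCoeff α (transportChart f φ) z := by
  rw [formCoeff, formCoeff, transportChart_symm_apply]
  simp only [coordField_transportChart f hφ (φ.map_target hz)]
  rfl

theorem isHolomorphicForm_pullbackForm {α : NForm n N} (hα : IsHolomorphicForm α) :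
    IsHolomorphicForm (pullbackForm f α) := fun _ hφ =>
  (hα _ (transportChart_mem_holCharts f hφ)).congr fun _ hz => formCoeff_pullbackForm f α hφ hz

theorem normSq_pullbackForm_le (α : NForm n N) : normSq (pullbackForm f α) ≤ normSq α := by
  simp only [normSq, iSup_le_iff]
  intro k φ A h hd
  refine le_iSup_of_le k <| le_iSup_of_le (fun i => transportChart f (φ i)) <| le_iSup_of_le A <|
    le_iSup_of_le (fun i => ⟨transportChart_mem_holCharts f (h i).1, (h i).2.1, (h i).2.2⟩) <|
    le_iSup_of_le (fun i j hij => ?_) ?_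
  · have h1 : ∀ i, (transportChart f (φ i)).symm '' A i = f '' ((φ i).symm '' A i) := fun i => by
      rw [image_image]
      rfl
    simp only [h1]
    exact (disjoint_image_iff f.injective).2 (hd hij)
  · refine le_of_eq (Finset.sum_congr rfl fun i _ => ?_)
    congr 1
    refine MeasureTheory.setLIntegral_congr_fun (h i).2.1 fun z hz => ?_
    simp only [formCoeff_pullbackForm f α (h i).1 ((h i).2.2 hz)]

variable [IsManifold 𝓘(ℂ, Fin n → ℂ) ω M]

theorem normSq_pullbackForm (α : NForm n N) : normSq (pullbackForm f α) = normSq α :=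
  le_antisymm (normSq_pullbackForm_le f α) <| by
    conv_lhs => rw [← pullbackForm_symm_pullbackForm f α]
    exact normSq_pullbackForm_le f.symm _

theorem innerA2_pullbackForm (α β : NForm n N) :
    innerA2 (pullbackForm f α) (pullbackForm f β) = innerA2 α β := by
  simp only [innerA2, ← pullbackForm_smul, ← pullbackForm_add, normSq_pullbackForm]

theorem pullbackForm_mem_A2 {α : NForm n N} (hα : α ∈ A2 n N) : pullbackForm f α ∈ A2 n M :=
  ⟨isHolomorphicForm_pullbackForm f hα.1, by rw [normSq_pullbackForm]; exact hα.2⟩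

theorem IsOrthonormalBasis.pullbackForm {S : Set (NForm n N)} (hS : IsOrthonormalBasis S) :
    IsOrthonormalBasis (pullbackForm f '' S) where
  subset := by
    rintro _ ⟨s, hs, rfl⟩
    exact pullbackForm_mem_A2 f (hS.subset hs)
  norm_one := by
    rintro _ ⟨s, hs, rfl⟩
    rw [innerA2_pullbackForm]
    exact hS.norm_one s hs
  orthogonal := by
    rintro _ ⟨s, hs, rfl⟩ _ ⟨t, ht, rfl⟩ hst
    rw [innerA2_pullbackForm]
    exact hS.orthogonal s hs t ht fun h => hst (h ▸ rfl)
  complete := by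
    intro α hα h
    have h1 := hS.complete _ (pullbackForm_mem_A2 f.symm hα) fun s hs => by
      rw [← innerA2_pullbackForm f]
      rw [show BergmanGeometry.pullbackForm f (BergmanGeometry.pullbackForm f.symm α) = α from
        pullbackForm_symm_pullbackForm f.symm α]
      exact h _ ⟨s, hs, rfl⟩
    refine pullbackForm_injective f.symm (h1.trans ?_)
    rfl

variable [SecondCountableTopology M] [SecondCountableTopology N]

/-- The Bergman kernel form is invariant under biholomorphisms: it can be computed from an
orthonormal basis of `A²(N)` and from its pull-back, which is an orthonormal basis of `A²(M)`. -/
theorem kernel_transportChart (hφ : φ ∈ holCharts n M) (hψ : ψ ∈ holCharts n M)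
    (hz : z ∈ φ.target) (hw : w ∈ ψ.target) :
    kernel (transportChart f φ) (transportChart f ψ) z w = kernel φ ψ z w := by
  have : Nonempty M := ⟨φ.symm z⟩
  have : Nonempty N := ⟨f (φ.symm z)⟩
  obtain ⟨S, hS⟩ := exists_isOrthonormalBasis (n := n) (M := N)
  rw [kernel_eq_tsum hS (transportChart_mem_holCharts f hφ) (transportChart_mem_holCharts f hψ)
    hz hw, kernel_eq_tsum (hS.pullbackForm f) hφ hψ hz hw,
    tsum_image (fun s => formCoeff s φ z * conj (formCoeff s ψ w)) (pullbackForm_injective f).injOn]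
  simp only [formCoeff_pullbackForm f _ hφ hz, formCoeff_pullbackForm f _ hψ hw]

variable {p : M}

theorem mem_Z0_diffeomorph : f x ∈ Z0 n (f p) ↔ x ∈ Z0 n p := by
  have hφ := chartAt_mem_holCharts (n := n) x
  have hx := mem_chart_source (Fin n → ℂ) x
  have hψ := chartAt_mem_holCharts (n := n) p
  have hp := mem_chart_source (Fin n → ℂ) p
  rw [mem_Z0_iff hφ hψ hx hp, mem_Z0_iff (transportChart_mem_holCharts f hφ)
    (transportChart_mem_holCharts f hψ) (mem_transportChart_source f hx)
    (mem_transportChart_source f hp), transportChart_apply, transportChart_apply,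
    kernel_transportChart f hφ hψ (OpenPartialHomeomorph.map_source _ hx)
    (OpenPartialHomeomorph.map_source _ hp)]

/-- Bochner's representative coordinates are invariant under biholomorphisms. -/
theorem bochnerCoord_diffeomorph (hψ : ψ ∈ holCharts n M) (hp : p ∈ ψ.source) (x : M) :
    bochnerCoord (transportChart f ψ) (f p) (f x) = bochnerCoord ψ p x := by
  have hφ := chartAt_mem_holCharts (n := n) x
  have hx := mem_chart_source (Fin n → ℂ) x
  have hz := OpenPartialHomeomorph.map_source _ hx
  funext k
  rw [bochnerCoord_apply hφ hψ hx hp, bochnerCoord_apply (transportChart_mem_holCharts f hφ)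
    (transportChart_mem_holCharts f hψ) (mem_transportChart_source f hx)
    (mem_transportChart_source f hp), transportChart_apply, transportChart_apply,
    kernel_transportChart f hφ hψ hz (ψ.map_source hp)]
  congr 1
  refine wirtingerBar_congr ?_ k
  filter_upwards [ψ.open_target.mem_nhds (ψ.map_source hp)] with v hv
  exact kernel_transportChart f hφ hψ hz hv

theorem mvfderiv_bochnerCoord_diffeomorph (hψ : ψ ∈ holCharts n M) (hp : p ∈ ψ.source)
    (hx : x ∉ Z0 n p) (v : TangentSpace 𝓘(ℂ, Fin n → ℂ) x) :
    mvfderiv 𝓘(ℂ, Fin n → ℂ) (bochnerCoord (transportChart f ψ) (f p)) (f x)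
        (mfderiv 𝓘(ℂ, Fin n → ℂ) 𝓘(ℂ, Fin n → ℂ) f x v) =
      mvfderiv 𝓘(ℂ, Fin n → ℂ) (bochnerCoord ψ p) x v := by
  have h1 := mfderiv_comp_apply x (mdifferentiableAt_bochnerCoord
    (transportChart_mem_holCharts f hψ) (mem_transportChart_source f hp)
    ((mem_Z0_diffeomorph f).not.2 hx)) (mdifferentiableAt_diffeomorph f x) v
  have h2 : bochnerCoord (transportChart f ψ) (f p) ∘ f = bochnerCoord ψ p :=
    funext (bochnerCoord_diffeomorph f hψ hp)
  rw [h2] at h1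
  exact h1.symm

theorem mem_regularSet_diffeomorph : f x ∈ regularSet n (f p) ↔ x ∈ regularSet n p := by
  have hψ := chartAt_mem_holCharts (n := n) p
  have hp := mem_chart_source (Fin n → ℂ) p
  rw [mem_regularSet_iff hψ hp, mem_regularSet_iff (transportChart_mem_holCharts f hψ)
    (mem_transportChart_source f hp), mem_Z0_diffeomorph f]
  refine and_congr_right fun hx => ?_
  rw [← isInvertible_mvfderiv_iff, ← isInvertible_mvfderiv_iff]
  obtain ⟨e, he⟩ := isInvertible_mfderiv_diffeomorph f x
  have h1 : mvfderiv 𝓘(ℂ, Fin n → ℂ) (bochnerCoord (chartAt (Fin n → ℂ) p) p) x =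
      mvfderiv 𝓘(ℂ, Fin n → ℂ) (bochnerCoord (transportChart f (chartAt (Fin n → ℂ) p)) (f p))
        (f x) ∘L (e : _ →L[ℂ] _) := by
    ext v : 1
    rw [he]
    exact (mvfderiv_bochnerCoord_diffeomorph f hψ hp hx v).symm
  rw [h1]
  exact ContinuousLinearMap.isInvertible_comp_equiv.symm

theorem image_regularSet (p : M) : f '' regularSet n p = regularSet n (f p) := by
  ext y
  refine ⟨?_, fun hy => ⟨f.symm y, ?_, f.apply_symm_apply y⟩⟩
  · rintro ⟨x, hx, rfl⟩
    exact (mem_regularSet_diffeomorph f).2 hx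
  · rw [← mem_regularSet_diffeomorph f, f.apply_symm_apply]
    exact hy

end Transport

/-! ### Naturality of the connection -/

section Naturality

open Set Filter Topology

variable {n : ℕ} {M N : Type*} [TopologicalSpace M] [ChartedSpace (Fin n → ℂ) M]
  [TopologicalSpace N] [ChartedSpace (Fin n → ℂ) N]
  (f : M ≃ₘ^ω⟮𝓘(ℂ, Fin n → ℂ), 𝓘(ℂ, Fin n → ℂ)⟯ N)
  {ψ : OpenPartialHomeomorph M (Fin n → ℂ)} {p x : M} {y : N} {X Y : VField n M}
  {G : Type*} [NormedAddCommGroup G] [NormedSpace ℂ G]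

/-- The derivation `(f_* X) F` is `X (F ∘ f)`, transported to `N`. -/
theorem lieDeriv_pushforward {F : N → G} (X : VField n M)
    (hF : MDifferentiableAt 𝓘(ℂ, Fin n → ℂ) 𝓘(ℂ, G) F y) :
    lieDeriv (pushforward f X) F y = lieDeriv X (F ∘ f) (f.symm y) := by
  have h1 : MDifferentiableAt 𝓘(ℂ, Fin n → ℂ) 𝓘(ℂ, G) (F ∘ f) (f.symm y) :=
    MDifferentiableAt.comp _ (by rwa [f.apply_symm_apply]) (mdifferentiableAt_diffeomorph f _)
  have h2 := mfderiv_comp_apply y h1 (mdifferentiableAt_diffeomorph f.symm y) (pushforward f X y)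
  have h3 : (F ∘ f) ∘ f.symm = F := by
    funext y'
    simp
  rw [h3] at h2
  refine Eq.trans h2 ?_
  have h4 := (isInvertible_mfderiv_diffeomorph f.symm y).self_apply_inverse (X (f.symm y))
  exact congrArg (mfderiv 𝓘(ℂ, Fin n → ℂ) 𝓘(ℂ, G) (F ∘ f) (f.symm y)) h4

variable [IsManifold 𝓘(ℂ, Fin n → ℂ) ω M] [IsManifold 𝓘(ℂ, Fin n → ℂ) ω N]

theorem holomorphicFieldAt_pushforward (hY : HolomorphicFieldAt Y (f.symm y)) :
    HolomorphicFieldAt (pushforward f Y) y := by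
  have : IsManifold 𝓘(ℂ, Fin n → ℂ) 2 M := IsManifold.of_le (n := ω) le_top
  have : IsManifold 𝓘(ℂ, Fin n → ℂ) 2 N := IsManifold.of_le (n := ω) le_top
  exact MDifferentiableAt.mpullback_vectorField hY (f.symm.contMDiff y)
    (isInvertible_mfderiv_diffeomorph f.symm y) le_top

variable [SecondCountableTopology M] [SecondCountableTopology N]

/-- The connections `∇ᵖ` correspond to each other under biholomorphisms. The representative
coordinates `u` of `M` and `v` of `N` satisfy `v ∘ f = u`, and `dv` maps both sides to
`X (Y u)`. -/
theorem mfderiv_devConn_bochnerCoord (hψ : ψ ∈ holCharts n M) (hp : p ∈ ψ.source)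
    {D' : ConnOp n N} (hD' : IsBochnerConnection (f p) D') {U : Set M} (hU : IsOpen U)
    (hUp : U ⊆ regularSet n p) (hY : IsHolomorphicField Y U) (hx : x ∈ U) :
    mfderiv 𝓘(ℂ, Fin n → ℂ) 𝓘(ℂ, Fin n → ℂ) f x (devConn (bochnerCoord ψ p) Y x (X x)) =
      D' (pushforward f Y) (f x) (pushforward f X (f x)) := by
  have hu := isDevelopingMapOn_bochnerCoord hψ hp
  have hv := isDevelopingMapOn_bochnerCoord (transportChart_mem_holCharts f hψ)
    (mem_transportChart_source f hp)
  set u := bochnerCoord ψ p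
  set v := bochnerCoord (transportChart f ψ) (f p)
  have hvu : v ∘ f = u := funext (bochnerCoord_diffeomorph f hψ hp)
  have hfx : f x ∈ regularSet n (f p) := (mem_regularSet_diffeomorph f).2 (hUp hx)
  have hYf : HolomorphicFieldAt (pushforward f Y) (f x) := by
    refine holomorphicFieldAt_pushforward f ?_
    rw [f.symm_apply_apply]
    exact hY.at hU hx
  rw [hD'.eq_devConn (transportChart_mem_holCharts f hψ) (mem_transportChart_source f hp) hfx hYf]
  refine hv.injective hfx ?_
  rw [hv.mvfderiv_devConn hfx, mvfderiv_bochnerCoord_diffeomorph f hψ hp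
    ((mem_regularSet_iff hψ hp).1 (hUp hx)).1, hu.mvfderiv_devConn (hUp hx)]
  have hev : lieDeriv (pushforward f Y) v =ᶠ[𝓝 (f x)] lieDeriv Y u ∘ f.symm := by
    filter_upwards [hv.eventually_mdifferentiableAt hfx] with y hy
    rw [lieDeriv_pushforward f Y hy, hvu]
    rfl
  have hd := hu.mdifferentiableAt_lieDeriv (hUp hx) (hY.at hU hx)
  have hd' : MDifferentiableAt 𝓘(ℂ, Fin n → ℂ) 𝓘(ℂ, Fin n → ℂ) (lieDeriv Y u ∘ f.symm) (f x) :=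
    MDifferentiableAt.comp _ (by rwa [f.symm_apply_apply]) (mdifferentiableAt_diffeomorph f.symm _)
  have hcomp : (lieDeriv Y u ∘ f.symm) ∘ f = lieDeriv Y u := by
    funext y'
    simp
  change lieDeriv X (lieDeriv Y u) x =
    lieDeriv (pushforward f X) (lieDeriv (pushforward f Y) v) (f x)
  rw [lieDeriv_congr _ hev, lieDeriv_pushforward f X hd', hcomp, f.symm_apply_apply]

end Naturality

end BergmanGeometry

end

open BergmanGeometry in
theorem mainTheorem2 {n : ℕ} {M : Type*} [TopologicalSpace M] [T2Space M]
    [SecondCountableTopology M] [ChartedSpace (Fin n → ℂ) M]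
    [IsManifold 𝓘(ℂ, Fin n → ℂ) ω M]
    (hM : HasBergmanMetric n M) (p : M) :
    IsOpen (regularSet n p) ∧
    ∃ D : ConnOp n M,
      IsBochnerConnection p D ∧
      IsLocallyFlatOn D (regularSet n p) ∧
      (∀ (γ : ℝ → M) (J : Set ℝ), IsOpen J → Set.MapsTo γ J (regularSet n p) →
        (IsGeodesicOn D γ J ↔
          IsC2Curve n γ J ∧ SolvesPolarizedGeodesicODE (n := n) p γ J)) ∧
      (∀ (N : Type*) [TopologicalSpace N] [T2Space N] [SecondCountableTopology N]
        [ChartedSpace (Fin n → ℂ) N] [IsManifold 𝓘(ℂ, Fin n → ℂ) ω N]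
        (f : M ≃ₘ^ω⟮𝓘(ℂ, Fin n → ℂ), 𝓘(ℂ, Fin n → ℂ)⟯ N),
        f '' regularSet n p = regularSet n (f p) ∧
        ∀ D' : ConnOp n N, IsBochnerConnection (f p) D' →
          ∀ U : Set M, IsOpen U → U ⊆ regularSet n p → ∀ X Y : VField n M,
            IsHolomorphicField X U → IsHolomorphicField Y U →
              ∀ x ∈ U,
                mfderiv 𝓘(ℂ, Fin n → ℂ) 𝓘(ℂ, Fin n → ℂ) f x (D Y x (X x)) =
                  D' (pushforward f Y) (f x) (pushforward f X (f x))) := by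
  have hψ := chartAt_mem_holCharts (n := n) p
  have hp := mem_chart_source (Fin n → ℂ) p
  have hu := isDevelopingMapOn_bochnerCoord hψ hp
  refine ⟨isOpen_regularSet p, devConn (bochnerCoord (chartAt (Fin n → ℂ) p) p),
    isBochnerConnection_devConn hψ hp, hu.isLocallyFlatOn,
    fun γ J hJ hγJ => isGeodesicOn_devConn_iff hψ hp hJ hγJ, fun N _ _ _ _ _ f =>
      ⟨image_regularSet f p, fun D' hD' U hU hUp X Y _ hY x hx =>
        mfderiv_devConn_bochnerCoord f hψ hp hD' hU hUp hY hx⟩⟩
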